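/- Let $d\ge 1$, $\mathbf T^d=\mathbf R^d/\mathbf Z^d$, $G=U(1)$, $\mathfrak g=\mathbf R$. Fix any real $s>\frac d2-1$ and let $\mathcal S=H^{-s}(\mathbf T^d;\mathbf R^d)$ be the space of real distributional $1$-forms $A=(A_1,\dots,A_d)$ of Sobolev regularity $-s$, with its norm $\|\cdot\|$. Write $A\sim B$ (gauge equivalence) if $A=B+\mathrm d\omega$ for some $\omega$ on $\mathbf R^d$ such that $e^{\mathbf i\omega}$ is periodic (distributional $\omega$ are allowed: $\omega=\theta+\eta$ with $\theta$ smooth, $e^{\mathbf i\theta}$ periodic, and $\eta$ a distribution on $\mathbf T^d$). Let $\mathfrak O=\mathcal S/{\sim}$ be the space of gauge orbits, with quotient topology and quotient $\sigma$-algebra, and $\pi$ the projection, extended to a cemetery state $\dagger$ by $\pi(\dagger)=\dagger$. For $C\in\mathbf R$ (the bare mass) consider $$\partial_t A=\Delta A+CA+\xi, \qquad (*)$$ where $\xi=(\xi_1,\dots,\xi_d)$ is a space-time white noise on $\mathbf R_+\times\mathbf T^d$; solutions are understood in the weak sense. A probability measure $\mu$ on the space of càdlàg paths with values in $\mathcal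 S\sqcup\{\dagger\}$ ($\dagger$ absorbing) is called generative with bare mass $C$ and initial condition $a\in\mathcal S$ if, on some filtered probability space carrying a white noise $\xi$ adapted to the filtration with increments independent of the past, there is an adapted process $A$ with law $\mu$ such that (i) $A(0)=a$ a.s.; (ii) there are stopping times $0=\varsigma_0\le\varsigma_1\le\cdots$ such that $A$ solves $(*)$ on each $[\varsigma_j,\varsigma_{j+1})$; (iii) for each $j$, whenever $\varsigma_{j+1}<\infty$ and $A(\varsigma_{j+1})\ne\dagger$, $A(\varsigma_{j+1})\sim\lim_{t\uparrow\varsigma_{j+1}}A(t)$; (iv) $\lim_j\varsigma_j=T^*:=\inf\{t: A(t)=\dagger\}$ and, on $\{T^*<\infty\}$, $\lim_{t\uparrow T^*}\inf_{B\sim A(t)}\|B\|=\infty$. Call the dynamics with bare mass $C$ gauge covariant if $\pi_*\mu=\pi_*\nu$ whenever $\mu,\nu$ are generative with bare mass $C$ and gauge equivalent initial conditions $a\sim b$. Then: 1. For every $C\in\mathbf R$ and $a\in\mathcal S$ there is a generative probability measure with bare mass $C$ and initial condition $a$. 2. The dynamics with bare mass $C$ is gauge covariant if and only if $C=0$; that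 is, $\check C=0$ makes the dynamics gauge covariant and is the only such value. 3. For $C=0$, there are laws $\mathbf P^x$, $x\in\mathfrak O$, such that $\pi_*\mu=\mathbf P^{[a]}$ for every generative $\mu$ with bare mass $0$ and initial condition $a$, and $\{\mathbf P^x\}$ is the family of laws of a time-homogeneous Markov process on $\mathfrak O\sqcup\{\dagger\}$ with continuous paths, which never reaches $\dagger$ when started in $\mathfrak O$. Moreover, if $A,B$ are solutions of $(*)$ in $C(\mathbf R_+,\mathcal S)$ with $C=0$, driven by the same noise, with $A(0)\sim B(0)$ deterministic, then almost surely $A(t)\sim B(t)$ for all $t\ge0$. 4. The $1$-forms $0$ and $(2\pi,0,\dots,0)$ are gauge equivalent, and the observable $I[A]=\exp\bigl(\mathbf i\int_{\mathbf T^d}A_1\bigr)$ is gauge invariant. For every $C\neq0$, equation $(*)$ has solutions $A,B$ in $C(\mathbf R_+,\mathcal S)$ with $A(0)=0$ and $B(0)=(2\pi,0,\dots,0)$, on a common probability space and driven by the same noise; and there is $t_0>0$ such that, for all such solutions $A$ and $B$ (on whichever probability spaces and driven by whichever white noises), $\mathbf E\,I[A(t)]\ne\mathbf E\,I[B(t)]$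 for all $t\in(0,t_0)$. -/

import Mathlib

open MeasureTheory ProbabilityTheory Filter Topology
open scoped NNReal ENNReal

noncomputable section

namespace AbelianYM

/-! ### Test functions on the torus `T^d = ℝ^d / ℤ^d` -/

/-- Real smooth functions on `T^d`, as smooth `ℤ^d`-periodic functions on `ℝ^d`. -/
def TestFun (d : ℕ) : Submodule ℝ ((Fin d → ℝ) → ℝ) where
  carrier := {φ | ContDiff ℝ (⊤ : ℕ∞) φ ∧
    ∀ (k : Fin d → ℤ) (x : Fin d → ℝ), φ (x + fun i => (k i : ℝ)) = φ x}
  add_mem' := fun {φ ψ} hφ hψ =>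
    ⟨hφ.1.add hψ.1, fun k x => by simp only [Pi.add_apply]; rw [hφ.2 k x, hψ.2 k x]⟩
  zero_mem' := ⟨contDiff_const, fun _ _ => rfl⟩
  smul_mem' := fun c φ hφ =>
    ⟨contDiff_const.smul hφ.1, fun k x => by simp only [Pi.smul_apply]; rw [hφ.2 k x]⟩

/-- The constant function `1`. -/
def TestFun.one (d : ℕ) : TestFun d := ⟨fun _ => 1, contDiff_const, fun _ _ => rfl⟩

/-- The `j`-th partial derivative. -/
def partialD {d : ℕ} (j : Fin d) (φ : TestFun d) : TestFun d :=
  ⟨fun x => fderiv ℝ φ.1 x (Pi.single j 1), by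
    refine ⟨?_, fun k x => ?_⟩
    · exact (φ.2.1.fderiv_right (m := (⊤ : ℕ∞)) (by simp)).clm_apply contDiff_const
    · have h : (fun y => φ.1 (y + fun i => (k i : ℝ))) = φ.1 := funext fun y => φ.2.2 k y
      have h' := fderiv_comp_add_right (𝕜 := ℝ) (f := φ.1) (x := x) (fun i => (k i : ℝ))
      rw [h] at h'
      exact congrArg (fun L : (Fin d → ℝ) →L[ℝ] ℝ => L (Pi.single j 1)) h'.symm⟩

/-- The Laplacian. -/
def laplacian {d : ℕ} (φ : TestFun d) : TestFun d := ∑ j, partialD j (partialD j φ)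

/-- The integral over `T^d`, that is, over the unit cell `[0,1]^d`. -/
def torusInt {d : ℕ} {E : Type*} [NormedAddCommGroup E] [NormedSpace ℝ E]
    (f : (Fin d → ℝ) → E) : E := ∫ x in Set.Icc (0 : Fin d → ℝ) 1, f x

/-- Fourier coefficients `∫_{T^d} φ(x) exp(-2πi k·x) dx`. -/
def fourierCoef {d : ℕ} (φ : TestFun d) (k : Fin d → ℤ) : ℂ :=
  torusInt fun x =>
    Complex.exp (-(2 * Real.pi * Complex.I * ((∑ i, (k i : ℝ) * x i : ℝ) : ℂ))) * (φ.1 x : ℂ)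

/-- The norm of the Sobolev space `H^s(T^d)` (finite on every test function). -/
def sobolevNorm {d : ℕ} (s : ℝ) (φ : TestFun d) : ℝ≥0∞ :=
  (∑' k : Fin d → ℤ, ENNReal.ofReal ((1 + ∑ i, (k i : ℝ) ^ 2) ^ s) * ‖fourierCoef φ k‖ₑ ^ 2)
    ^ (1 / 2 : ℝ)

/-! ### The state space: distributional `1`-forms of class `H^{-s}` -/

/-- Continuity of a linear functional on `C^∞(T^d)`: it is bounded by finitely many derivatives. -/
def IsDistribution {d : ℕ} (η : Module.Dual ℝ (TestFun d)) : Prop :=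
  ∃ (m : ℕ) (M : ℝ), ∀ (φ : TestFun d) (K : ℝ),
    (∀ l : List (Fin d), l.length ≤ m → ∀ x, |(l.foldr partialD φ).1 x| ≤ K) → |η φ| ≤ M * K

/-- `H^{-s}(T^d)`, the dual of `H^s(T^d)`: real distributions `a` on `T^d` with
`|a(φ)| ≤ M ‖φ‖_{H^s}`. -/
def negSobolevSubmodule (d : ℕ) (s : ℝ) : Submodule ℝ (Module.Dual ℝ (TestFun d)) where
  carrier := {a | ∃ M : ℝ≥0, ∀ φ, ‖a φ‖ₑ ≤ M * sobolevNorm s φ}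
  add_mem' := by
    rintro a b ⟨M, hM⟩ ⟨N, hN⟩
    refine ⟨M + N, fun φ => ?_⟩
    calc ‖(a + b) φ‖ₑ ≤ ‖a φ‖ₑ + ‖b φ‖ₑ := enorm_add_le _ _
      _ ≤ M * sobolevNorm s φ + N * sobolevNorm s φ := add_le_add (hM φ) (hN φ)
      _ = _ := by rw [ENNReal.coe_add, add_mul]
  zero_mem' := ⟨0, fun φ => by simp⟩
  smul_mem' := by
    rintro c a ⟨M, hM⟩
    refine ⟨‖c‖₊ * M, fun φ => ?_⟩
    calc ‖(c • a) φ‖ₑ = ‖c‖ₑ * ‖a φ‖ₑ := by simp [enorm_mul]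
      _ ≤ ‖c‖ₑ * (M * sobolevNorm s φ) := by gcongr; exact hM φ
      _ = _ := by rw [ENNReal.coe_mul, mul_assoc]; rfl

def NegSobolev (d : ℕ) (s : ℝ) : Type := negSobolevSubmodule d s

instance (d : ℕ) (s : ℝ) : AddCommGroup (NegSobolev d s) :=
  inferInstanceAs (AddCommGroup (negSobolevSubmodule d s))

/-- The unit ball of `C^∞(T^d)` in the `H^s`-norm. -/
def sobolevBall (d : ℕ) (s : ℝ) : Set (TestFun d) := {φ | sobolevNorm s φ ≤ 1}

/-- The restriction of `a` to the unit ball of `H^s`, as a bounded function. -/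
def toBounded (d : ℕ) (s : ℝ) :
    NegSobolev d s →+ lp (fun _ : sobolevBall d s => ℝ) ∞ where
  toFun a := ⟨fun φ => a.1 φ.1, by
    obtain ⟨M, hM⟩ := a.2
    refine memℓp_infty ⟨M, ?_⟩
    rintro _ ⟨φ, rfl⟩
    have h : ‖a.1 φ.1‖ₑ ≤ M := (hM φ.1).trans (mul_le_of_le_one_right' φ.2)
    exact_mod_cast h⟩
  map_zero' := rfl
  map_add' _ _ := rfl

/-- The dual norm `‖a‖ = sup {|a(φ)| : ‖φ‖_{H^s} ≤ 1}` of `H^{-s}(T^d)`. -/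
instance (d : ℕ) (s : ℝ) : SeminormedAddCommGroup (NegSobolev d s) :=
  SeminormedAddCommGroup.induced _ _ (toBounded d s)

/-- The σ-algebra generated by the evaluations `a ↦ a(φ)`; as `H^{-s}` is a separable Hilbert
space, this is its Borel σ-algebra. -/
instance (d : ℕ) (s : ℝ) : MeasurableSpace (NegSobolev d s) :=
  MeasurableSpace.comap (fun (a : NegSobolev d s) (φ : TestFun d) => a.1 φ) inferInstance

/-- Real `1`-forms `A = (A_1, …, A_d)` on `T^d` with components in `H^{-s}`. -/
abbrev OneForm (d : ℕ) (s : ℝ) : Type := Fin d → NegSobolev d s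

/-- Smooth `1`-forms, used as test objects. -/
abbrev TestForm (d : ℕ) : Type := Fin d → TestFun d

/-- The pairing `⟨A, φ⟩ = ∑_j ∫ A_j φ_j`. -/
def pair {d : ℕ} {s : ℝ} (a : OneForm d s) (φ : TestForm d) : ℝ := ∑ j, (a j).1 (φ j)

/-- The constant `1`-form `(c_1, …, c_d)`. -/
def constForm (d : ℕ) (s : ℝ) (c : Fin d → ℝ) : OneForm d s := fun j =>
  ⟨{ toFun := fun φ => torusInt fun x => c j * φ.1 x
     map_add' := fun φ ψ => by
       have hφ : IntegrableOn (fun x => c j * φ.1 x) (Set.Icc (0 : Fin d → ℝ) 1) :=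
         (continuous_const.mul φ.2.1.continuous).integrableOn_Icc
       have hψ : IntegrableOn (fun x => c j * ψ.1 x) (Set.Icc (0 : Fin d → ℝ) 1) :=
         (continuous_const.mul ψ.2.1.continuous).integrableOn_Icc
       simp only [torusInt, Submodule.coe_add, Pi.add_apply, mul_add]
       exact integral_add hφ hψ
     map_smul' := fun r φ => by
       simp only [torusInt, Submodule.coe_smul, Pi.smul_apply, smul_eq_mul, RingHom.id_apply]
       rw [← integral_const_mul]
       congr 1; funext x; ring },
   by
    refine ⟨‖c j‖₊, fun φ => ?_⟩
    have h0 : fourierCoef φ 0 = ((∫ x in Set.Icc (0 : Fin d → ℝ) 1, φ.1 x : ℝ) : ℂ) := by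
      simp only [fourierCoef, torusInt, Pi.zero_apply, Int.cast_zero, zero_mul,
        Finset.sum_const_zero, Complex.ofReal_zero, mul_zero, neg_zero, Complex.exp_zero, one_mul]
      exact integral_ofReal
    have h1 : ‖fourierCoef φ 0‖ₑ ≤ sobolevNorm s φ := by
      have h := ENNReal.le_tsum (f := fun k : Fin d → ℤ =>
        ENNReal.ofReal ((1 + ∑ i, (k i : ℝ) ^ 2) ^ s) * ‖fourierCoef φ k‖ₑ ^ 2) 0
      have h' := ENNReal.rpow_le_rpow h (show (0 : ℝ) ≤ 1 / 2 by norm_num)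
      refine le_trans (le_of_eq ?_) h'
      simp only [Pi.zero_apply, Int.cast_zero, ne_eq, OfNat.ofNat_ne_zero, not_false_eq_true,
        zero_pow, Finset.sum_const_zero, add_zero, Real.one_rpow, ENNReal.ofReal_one, one_mul]
      rw [← ENNReal.rpow_natCast, ← ENNReal.rpow_mul]
      norm_num
    have h2 : ‖fourierCoef φ 0‖ₑ = ‖∫ x in Set.Icc (0 : Fin d → ℝ) 1, φ.1 x‖ₑ := by
      rw [h0, ← ofReal_norm, ← ofReal_norm, Complex.norm_real]
    calc ‖∫ x in Set.Icc (0 : Fin d → ℝ) 1, c j * φ.1 x‖ₑ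
        = ‖c j‖ₑ * ‖fourierCoef φ 0‖ₑ := by rw [h2, integral_const_mul, enorm_mul]
      _ ≤ _ := by gcongr; rfl⟩

/-! ### Gauge equivalence -/

/-- `A ∼ B` iff `A = B + dω` for some `ω` on `ℝ^d` such that `exp(iω)` is periodic.
As `A` and `B` are distributions, `ω` may be one: `ω = θ + η` with `θ` a smooth function such that
`exp(iθ)` is periodic and `η` a distribution on `T^d`; `dη` is the distributional differential. -/
def GaugeEquiv {d : ℕ} {s : ℝ} (a b : OneForm d s) : Prop :=
  ∃ θ : (Fin d → ℝ) → ℝ, ContDiff ℝ (⊤ : ℕ∞) θ ∧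
    (∀ (k : Fin d → ℤ) (x : Fin d → ℝ),
      Complex.exp (Complex.I * θ (x + fun i => (k i : ℝ))) = Complex.exp (Complex.I * θ x)) ∧
    ∃ η : Module.Dual ℝ (TestFun d), IsDistribution η ∧
      ∀ (j : Fin d) (φ : TestFun d),
        (a j).1 φ = (b j).1 φ
          + ((torusInt fun x => fderiv ℝ θ x (Pi.single j 1) * φ.1 x) - η (partialD j φ))

theorem GaugeEquiv.equivalence (d : ℕ) (s : ℝ) :
    Equivalence (GaugeEquiv (d := d) (s := s)) where
  refl a := by
    refine ⟨fun _ => 0, contDiff_const, fun _ _ => rfl, 0, ⟨0, 0, fun φ K _ => by simp⟩, ?_⟩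
    intro j φ
    simp [torusInt]
  symm := by
    rintro a b ⟨θ, hθ, hp, η, ⟨m, M, hM⟩, h⟩
    refine ⟨fun x => -θ x, hθ.neg, fun k x => ?_, -η, ⟨m, M, fun φ K hK => ?_⟩, fun j φ => ?_⟩
    · simp only [Complex.ofReal_neg, mul_neg, Complex.exp_neg]
      rw [hp k x]
    · simpa using hM φ K hK
    · rw [h j φ]
      simp only [torusInt, fderiv_fun_neg, neg_apply, neg_mul,
        integral_neg, LinearMap.neg_apply]
      ring
  trans := by
    rintro a b c ⟨θ, hθ, hp, η, ⟨m, M, hM⟩, h⟩ ⟨θ', hθ', hp', η', ⟨m', M', hM'⟩, h'⟩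
    refine ⟨fun x => θ x + θ' x, hθ.add hθ', fun k x => ?_, η + η',
      ⟨max m m', M + M', fun φ K hK => ?_⟩, fun j φ => ?_⟩
    · simp only [Complex.ofReal_add, mul_add, Complex.exp_add]
      rw [hp k x, hp' k x]
    · have h1 := hM φ K fun l hl => hK l (hl.trans (le_max_left _ _))
      have h2 := hM' φ K fun l hl => hK l (hl.trans (le_max_right _ _))
      calc |(η + η') φ| ≤ |η φ| + |η' φ| := abs_add_le _ _
        _ ≤ (M + M') * K := by rw [add_mul]; exact add_le_add h1 h2
    · have hd : ∀ x, fderiv ℝ (fun x => θ x + θ' x) x = fderiv ℝ θ x + fderiv ℝ θ' x := fun x =>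
        fderiv_fun_add (hθ.differentiable (by simp) x) (hθ'.differentiable (by simp) x)
      have hi : ∀ ϑ : (Fin d → ℝ) → ℝ, ContDiff ℝ (⊤ : ℕ∞) ϑ → IntegrableOn
          (fun x => fderiv ℝ ϑ x (Pi.single j 1) * φ.1 x) (Set.Icc (0 : Fin d → ℝ) 1) := by
        intro ϑ hϑ
        have hc : Continuous fun x => fderiv ℝ ϑ x (Pi.single j 1) :=
          ((hϑ.fderiv_right (m := (⊤ : ℕ∞)) (by simp)).clm_apply contDiff_const).continuous
        exact (hc.mul φ.2.1.continuous).integrableOn_Icc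
      rw [h j φ, h' j φ]
      simp only [torusInt, hd, add_apply, add_mul, LinearMap.add_apply]
      rw [integral_add (hi θ hθ) (hi θ' hθ')]
      ring

def gaugeSetoid (d : ℕ) (s : ℝ) : Setoid (OneForm d s) := ⟨GaugeEquiv, GaugeEquiv.equivalence d s⟩

/-- The space of gauge orbits, with the quotient topology and the quotient σ-algebra. -/
abbrev Orbit (d : ℕ) (s : ℝ) : Type := Quotient (gaugeSetoid d s)

/-! ### Noise and solutions -/

/-- `W` is the primitive in time, `W_t(φ) = ξ(1_{[0,t]} φ)`, of a space-time white noise `ξ` on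
`ℝ_+ × T^d` with values in `1`-forms, relative to the filtration `𝓕`. -/
structure IsWhiteNoise {d : ℕ} {Ω : Type} {mΩ : MeasurableSpace Ω} (P : Measure Ω)
    (𝓕 : Filtration ℝ≥0 mΩ) (W : ℝ≥0 → TestForm d → Ω → ℝ) : Prop where
  gaussian : IsGaussianProcess (fun (p : ℝ≥0 × TestForm d) => W p.1 p.2) P
  mean_zero : ∀ t φ, ∫ ω, W t φ ω ∂P = 0
  covariance : ∀ (t u : ℝ≥0) (φ ψ : TestForm d),
    ∫ ω, W t φ ω * W u ψ ω ∂P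
      = min (t : ℝ) u * torusInt fun x => ∑ j, (φ j).1 x * (ψ j).1 x
  continuous : ∀ φ, ∀ᵐ ω ∂P, Continuous fun t => W t φ ω
  adapted : ∀ t φ, Measurable[𝓕 t] (W t φ)
  indep : ∀ t u, t ≤ u →
    Indep (⨆ φ, MeasurableSpace.comap (fun ω => W u φ ω - W t φ ω) inferInstance) (𝓕 t) P

/-- The right-hand side operator `Δ + C` (which is symmetric) applied to a test form. -/
def genOp {d : ℕ} (C : ℝ) (φ : TestForm d) : TestForm d := fun j => laplacian (φ j) + C • φ j

/-- `A` is a (weak, continuous, global in time) solution of `∂_t A = Δ A + C A + ξ`, `A(0) = a`. -/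
structure IsSolution {d : ℕ} {s : ℝ} {Ω : Type} {mΩ : MeasurableSpace Ω} (P : Measure Ω)
    (W : ℝ≥0 → TestForm d → Ω → ℝ) (C : ℝ) (a : OneForm d s) (A : Ω → ℝ≥0 → OneForm d s) :
    Prop where
  measurable : ∀ t, Measurable fun ω => A ω t
  continuous : ∀ ω, Continuous (A ω)
  init : ∀ᵐ ω ∂P, A ω 0 = a
  equation : ∀ φ : TestForm d, ∀ᵐ ω ∂P, ∀ t : ℝ≥0,
    pair (A ω t) φ = pair (A ω 0) φ
      + (∫ r in (0 : ℝ)..t, pair (A ω r.toNNReal) (genOp C φ)) + W t φ ω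

/-! ### Generative probability measures -/

/-- The state space with a cemetery `inr ()` added. The topology of the sum is only used near
points of the state space (of which it gives the usual neighbourhoods). -/
abbrev State (d : ℕ) (s : ℝ) : Type := OneForm d s ⊕ Unit

/-- Càdlàg paths with values in `State d s`. The cemetery is absorbing; the set of times at which
the path is in the cemetery is closed, by right-continuity. No left limit is asked for at the
explosion time. -/
structure IsCadlag {d : ℕ} {s : ℝ} (f : ℝ≥0 → State d s) : Prop where
  absorbing : ∀ t u, t ≤ u → f t = Sum.inr () → f u = Sum.inr ()
  right_cont : ∀ t a, f t = Sum.inl a → Tendsto f (𝓝[≥] t) (𝓝 (Sum.inl a))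
  left_lim : ∀ t a, f t = Sum.inl a → ∃ l : OneForm d s, Tendsto f (𝓝[<] t) (𝓝 (Sum.inl l))

/-- The space of càdlàg paths, with the σ-algebra generated by the evaluations. -/
abbrev CadlagPath (d : ℕ) (s : ℝ) : Type := {f : ℝ≥0 → State d s // IsCadlag f}

/-- `T^* = inf {t : f(t) = cemetery}`. -/
def explosionTime {d : ℕ} {s : ℝ} (f : ℝ≥0 → State d s) : WithTop ℝ≥0 :=
  sInf ((fun t : ℝ≥0 => (t : WithTop ℝ≥0)) '' {t | f t = Sum.inr ()})

/-- The pairing of a state with a test form (`0` at the cemetery, where it is not used). -/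
def statePair {d : ℕ} {s : ℝ} (x : State d s) (φ : TestForm d) : ℝ :=
  Sum.elim (fun a => pair a φ) (fun _ => 0) x

/-- `inf_{B ∼ A} ‖B‖` (`0` at the cemetery, where it is not used). -/
def orbitNorm {d : ℕ} {s : ℝ} (x : State d s) : ℝ :=
  Sum.elim (fun a => sInf ((fun b => ‖b‖) '' {b : OneForm d s | GaugeEquiv b a})) (fun _ => 0) x

/-- `A` solves `∂_t A = Δ A + C A + ξ` on each `[ς_j, ς_{j+1})`, jumps at each `ς_{j+1}` to a new
representative of its gauge orbit, and does not explode unless its whole gauge orbit does. -/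
structure IsGenerativeProcess {d : ℕ} {s : ℝ} {Ω : Type} {mΩ : MeasurableSpace Ω} (P : Measure Ω)
    (𝓕 : Filtration ℝ≥0 mΩ) (W : ℝ≥0 → TestForm d → Ω → ℝ) (C : ℝ) (a : OneForm d s)
    (A : Ω → CadlagPath d s) (ς : ℕ → Ω → WithTop ℝ≥0) : Prop where
  measurable : Measurable A
  adapted : ∀ t, Measurable[𝓕 t] fun ω => (A ω).1 t
  init : ∀ᵐ ω ∂P, (A ω).1 0 = Sum.inl a
  stopping : ∀ j, IsStoppingTime 𝓕 (ς j)
  stopping_zero : ∀ ω, ς 0 ω = 0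
  stopping_mono : ∀ ω, Monotone fun j => ς j ω
  equation : ∀ φ : TestForm d, ∀ᵐ ω ∂P, ∀ (j : ℕ) (u t : ℝ≥0),
    ς j ω = u → u ≤ t → (t : WithTop ℝ≥0) < ς (j + 1) ω →
      statePair ((A ω).1 t) φ = statePair ((A ω).1 u) φ
        + (∫ r in (u : ℝ)..t, statePair ((A ω).1 r.toNNReal) (genOp C φ)) + (W t φ ω - W u φ ω)
  jump : ∀ᵐ ω ∂P, ∀ (j : ℕ) (u : ℝ≥0) (b : OneForm d s),
    ς (j + 1) ω = u → (A ω).1 u = Sum.inl b →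
      ∃ l : OneForm d s, Tendsto (A ω).1 (𝓝[<] u) (𝓝 (Sum.inl l)) ∧ GaugeEquiv b l
  exhaust : ∀ᵐ ω ∂P, Tendsto (fun j => ς j ω) atTop (𝓝 (explosionTime (A ω).1))
  blow_up : ∀ᵐ ω ∂P, ∀ T : ℝ≥0, explosionTime (A ω).1 = T →
    Tendsto (fun t => orbitNorm ((A ω).1 t)) (𝓝[<] T) atTop

/-- `μ` is generative with bare mass `C` and initial condition `a`: it is the law of a process as
above, driven by some white noise. -/
def IsGenerative {d : ℕ} {s : ℝ} (C : ℝ) (a : OneForm d s) (μ : Measure (CadlagPath d s)) : Prop :=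
  ∃ (Ω : Type) (mΩ : MeasurableSpace Ω) (P : Measure Ω) (𝓕 : Filtration ℝ≥0 mΩ)
    (W : ℝ≥0 → TestForm d → Ω → ℝ) (A : Ω → CadlagPath d s) (ς : ℕ → Ω → WithTop ℝ≥0),
    IsProbabilityMeasure P ∧ IsWhiteNoise P 𝓕 W ∧ IsGenerativeProcess P 𝓕 W C a A ς ∧
      μ = P.map A

/-- The projection `π` to gauge orbits (fixing the cemetery), applied along a path. -/
def projPath {d : ℕ} {s : ℝ} (f : CadlagPath d s) : ℝ≥0 → Orbit d s ⊕ Unit :=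
  fun t => Sum.map (Quotient.mk (gaugeSetoid d s)) id (f.1 t)

/-- The dynamics with bare mass `C` is gauge covariant: generative measures with gauge equivalent
initial conditions have the same projection to gauge orbits. -/
def IsGaugeCovariant (d : ℕ) (s : ℝ) (C : ℝ) : Prop :=
  ∀ a b : OneForm d s, GaugeEquiv a b → ∀ μ ν : Measure (CadlagPath d s),
    IsGenerative C a μ → IsGenerative C b ν → μ.map projPath = ν.map projPath

/-! ### Markov processes -/

/-- The law `P^y` of the process started from `y`; from the cemetery it stays there. -/
def withCemetery {E : Type} [MeasurableSpace E] (P : E → Measure (ℝ≥0 → E ⊕ Unit)) :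
    E ⊕ Unit → Measure (ℝ≥0 → E ⊕ Unit) :=
  Sum.elim P fun _ => Measure.dirac fun _ => Sum.inr ()

/-- `(P^x)` are the laws of a time-homogeneous Markov process on `E ⊔ {cemetery}`, which has
continuous paths and (when started in `E`) never reaches the cemetery. -/
structure IsContinuousMarkov {E : Type} [TopologicalSpace E] [MeasurableSpace E]
    (P : E → Measure (ℝ≥0 → E ⊕ Unit)) : Prop where
  continuous : ∀ x, ∃ (Ω : Type) (_ : MeasurableSpace Ω) (Q : Measure Ω) (X : Ω → ℝ≥0 → E),
    IsProbabilityMeasure Q ∧ Measurable X ∧ (∀ ω, X ω 0 = x) ∧ (∀ ω, Continuous (X ω)) ∧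
      P x = Q.map fun ω t => Sum.inl (X ω t)
  measurable : ∀ (t : ℝ≥0) (F : Set (E ⊕ Unit)), MeasurableSet F →
    Measurable fun y => withCemetery P y {X | X t ∈ F}
  markov : ∀ (x : E) (t u : ℝ≥0) (G : Set (Set.Iic t → E ⊕ Unit)) (F : Set (E ⊕ Unit)),
    MeasurableSet G → MeasurableSet F →
      P x ({X | (fun r : Set.Iic t => X r) ∈ G} ∩ {X | X (t + u) ∈ F})
        = ∫⁻ X in {X | (fun r : Set.Iic t => X r) ∈ G}, withCemetery P (X t) {Y | Y u ∈ F} ∂(P x)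

/-! ### The observable -/

/-- `I[A] = exp(i ∫_{T^d} A_1)`. -/
def observable {d : ℕ} [NeZero d] {s : ℝ} (a : OneForm d s) : ℂ :=
  Complex.exp (Complex.I * ((a 0).1 (TestFun.one d) : ℂ))

end AbelianYM

end

open AbelianYM

noncomputable section

namespace AbelianYM

/-! ### Integrals over the torus -/

variable {d : ℕ}

/-! The equation is linear with additive noise, and `Δ + C` is diagonal in the trigonometric modes.
Hence each mode of a solution is a scalar Ornstein–Uhlenbeck path with rate `eigen m - C`, and for
two solutions with the same noise the noise cancels: the modes of the difference are just multiplied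
by `exp (-(eigen m - C) t)` (`formModes_flow_sub`).

Gauge equivalence is also a condition on modes (`gaugeEquiv_iff`): the difference `z` of two
equivalent forms is curl-free, `k_i z_j(k) = k_j z_i(k)`, and its mean lies in `2πℤ^d`. One
direction splits a gauge transformation into a linear function with integer winding and a periodic
function; the other builds a potential by dividing by `|k|²`. The factor `exp (-eigen m t)` depends
on the frequency only and equals `1` at frequency zero, so for `C = 0` both conditions persist
(`GaugeTrivial.heat`). For `C ≠ 0` the mean is multiplied by `exp (C t)`, and a mean `2π` leaves
`2πℤ` at once. On the observable this reads `E I[B(t)] = exp (2πi e^{Ct}) E I[A(t)]`. By continuity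
from `1` at time `0` the expectation on the right is nonzero for small `t`, so the two expectations
differ (`exists_observable_ne`).

A generative path with `C = 0` is compared with the global continuous solution `X` from the same
initial condition and with the same noise. Between jumps their difference evolves by the heat flow,
so they remain equivalent. At a jump, equivalence passes to the left limit because the conditions on
modes are closed, and the jump stays in the orbit. So the path is equivalent to `X` up to the
explosion time. Explosion at a finite time would send the orbit norm to infinity, whereas it is at
most `‖X t‖`, which is locally bounded. The path is therefore global and projects to the orbit of
`X` (`exists_gaugeEquiv_of_generative`). The projected law depends only on the orbit of the initial
condition, which gives covariance. The Markov property follows from the flow property and the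
independence of noise increments.

Solutions are constructed pathwise. An isonormal Gaussian process on `L²(ℝ_+ × T^d; ℝ^d)` gives
white noise, and dyadic chaining gives each noise mode a `γ`-Hölder constant with second moment
bounded uniformly in the mode, for any fixed `γ` in `(0, 1/2)`. Damping at rate about `1 + eigen m`
makes the corresponding solution of size `(1 + eigen m)^(-γ)` times that constant. The modes are
then square summable with weight `(1 + |k|²)^(-s)`, locally uniformly in time, provided `s + 2γ >
d/2`. A `γ < 1/2` with this property exists exactly when `s > d/2 - 1`. Since `flow` is a measurable
function of the initial condition and the noise path, laws do not depend on the probability space,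
and they depend measurably on the initial condition. -/

lemma volume_cell (d : ℕ) : volume (Set.Icc (0 : Fin d → ℝ) 1) = 1 := by
  simp [Real.volume_Icc_pi]

instance isProbabilityMeasure_cell (d : ℕ) :
    IsProbabilityMeasure ((volume : Measure (Fin d → ℝ)).restrict (Set.Icc 0 1)) :=
  ⟨by simp [volume_cell]⟩

lemma torusInt_const {E : Type*} [NormedAddCommGroup E] [NormedSpace ℝ E] [CompleteSpace E]
    (c : E) : torusInt (d := d) (fun _ => c) = c := by
  simp [torusInt]

lemma integrableOn_cell {E : Type*} [NormedAddCommGroup E] {f : (Fin d → ℝ) → E}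
    (hf : Continuous f) : IntegrableOn f (Set.Icc 0 1) := hf.integrableOn_Icc

lemma torusInt_add {E : Type*} [NormedAddCommGroup E] [NormedSpace ℝ E] {f g : (Fin d → ℝ) → E}
    (hf : Continuous f) (hg : Continuous g) :
    torusInt (fun x => f x + g x) = torusInt f + torusInt g :=
  integral_add (integrableOn_cell hf) (integrableOn_cell hg)

lemma torusInt_const_mul (c : ℝ) (f : (Fin d → ℝ) → ℝ) :
    torusInt (fun x => c * f x) = c * torusInt f := integral_const_mul _ _

lemma abs_torusInt_le {f : (Fin d → ℝ) → ℝ} {K : ℝ} (h : ∀ x, |f x| ≤ K) :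
    |torusInt f| ≤ K := by
  have := norm_setIntegral_le_of_norm_le_const (μ := volume) (s := Set.Icc (0 : Fin d → ℝ) 1)
    (f := f) (C := K) (by simp [volume_cell]) (fun x _ => h x)
  simpa [torusInt, Measure.real, volume_cell] using this

/-- The integral over the unit cell of a partial derivative of a function that is periodic up to
an additive constant. -/
lemma torusInt_fderiv {θ : (Fin d → ℝ) → ℝ} (hθ : ContDiff ℝ (⊤ : ℕ∞) θ) (j : Fin d) (c : ℝ)
    (hc : ∀ x, θ (x + Pi.single j 1) = θ x + c) :
    torusInt (fun x => fderiv ℝ θ x (Pi.single j 1)) = c := by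
  obtain ⟨n, rfl⟩ : ∃ n, d = n + 1 := ⟨d - 1, by have := j.pos; omega⟩
  have hcont : ∀ v, Continuous fun x => fderiv ℝ θ x v := fun v =>
    ((hθ.fderiv_right (m := (⊤ : ℕ∞)) (by simp)).clm_apply contDiff_const).continuous
  -- Divergence theorem for the vector field with `θ` in slot `j` and `0` elsewhere: only the two
  -- faces orthogonal to direction `j` contribute, and there the values of `θ` differ by `c`.
  have key := integral_divergence_of_hasFDerivAt_off_countable' (E := ℝ) (0 : Fin (n + 1) → ℝ) 1
    (fun _ => zero_le_one) (fun i => if i = j then θ else fun _ => 0)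
    (fun i x => if i = j then fderiv ℝ θ x else 0) ∅ Set.countable_empty
    (fun i => by
      split_ifs
      · exact hθ.continuous.continuousOn
      · exact continuousOn_const)
    (fun x _ i => by
      split_ifs
      · exact (hθ.differentiable (by simp) x).hasFDerivAt
      · exact hasFDerivAt_const _ _)
    (by
      have : (fun x => ∑ i, (if i = j then fderiv ℝ θ x else 0) (Pi.single i (1 : ℝ)))
          = fun x => fderiv ℝ θ x (Pi.single j 1) := by
        funext x
        rw [Finset.sum_eq_single j]
        · simp
        · intro b _ hb; simp [hb]
        · simp
      rw [this]
      exact (hcont _).integrableOn_Icc)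
  have e1 : (fun x => ∑ i, (if i = j then fderiv ℝ θ x else 0) (Pi.single i (1 : ℝ)))
      = fun x => fderiv ℝ θ x (Pi.single j 1) := by
    funext x
    rw [Finset.sum_eq_single j]
    · simp
    · intro b _ hb; simp [hb]
    · simp
  rw [torusInt, ← e1, key, Finset.sum_eq_single j]
  · have hins : ∀ y : Fin n → ℝ, (j.insertNth (1 : ℝ) y : Fin (n + 1) → ℝ)
        = j.insertNth (0 : ℝ) y + Pi.single j 1 := by
      intro y
      funext i
      induction i using j.succAboveCases <;> simp
    have hci : ∀ u : ℝ, Continuous fun y : Fin n → ℝ => θ (j.insertNth u y) := fun u =>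
      hθ.continuous.comp (by fun_prop)
    simp only [if_true, Pi.one_apply, Pi.zero_apply]
    rw [← integral_sub ((hci 1).integrableOn_Icc) ((hci 0).integrableOn_Icc)]
    simp only [hins, hc, add_sub_cancel_left]
    simp [Measure.real]
  · intro b _ hb; simp [hb]
  · simp

lemma periodic_single (φ : TestFun d) (j : Fin d) (x : Fin d → ℝ) :
    φ.1 (x + Pi.single j 1) = φ.1 x := by
  have h := φ.2.2 (Pi.single j 1) x
  have e : (fun i => ((Pi.single j 1 : Fin d → ℤ) i : ℝ)) = Pi.single j 1 := by
    funext i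
    by_cases hi : i = j
    · subst hi; simp
    · simp [hi]
  rwa [e] at h

/-! ### Calculus of test functions and integration by parts -/

lemma continuous_testFun (φ : TestFun d) : Continuous φ.1 := φ.2.1.continuous

lemma differentiable_testFun (φ : TestFun d) : Differentiable ℝ φ.1 :=
  φ.2.1.differentiable (by simp)

lemma continuous_mul_testFun (φ ψ : TestFun d) : Continuous fun x => φ.1 x * ψ.1 x :=
  (continuous_testFun φ).mul (continuous_testFun ψ)

lemma partialD_apply (j : Fin d) (φ : TestFun d) (x : Fin d → ℝ) :
    (partialD j φ).1 x = fderiv ℝ φ.1 x (Pi.single j 1) := rfl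

lemma partialD_add (j : Fin d) (φ ψ : TestFun d) :
    partialD j (φ + ψ) = partialD j φ + partialD j ψ := by
  ext x
  change fderiv ℝ (φ.1 + ψ.1) x _ = fderiv ℝ φ.1 x _ + fderiv ℝ ψ.1 x _
  rw [fderiv_add (differentiable_testFun φ x) (differentiable_testFun ψ x)]
  rfl

lemma partialD_smul (j : Fin d) (c : ℝ) (φ : TestFun d) :
    partialD j (c • φ) = c • partialD j φ := by
  ext x
  change fderiv ℝ (c • φ.1) x _ = c • fderiv ℝ φ.1 x _
  rw [fderiv_const_smul (differentiable_testFun φ x)]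
  rfl

/-- The `L²` inner product of test functions. -/
def ip (φ ψ : TestFun d) : ℝ := torusInt fun x => φ.1 x * ψ.1 x

lemma ip_comm (φ ψ : TestFun d) : ip φ ψ = ip ψ φ := by simp only [ip, mul_comm]

lemma ip_add_right (φ ψ χ : TestFun d) : ip φ (ψ + χ) = ip φ ψ + ip φ χ := by
  simp only [ip]
  rw [← torusInt_add (continuous_mul_testFun φ ψ) (continuous_mul_testFun φ χ)]
  congr 1; funext x; exact mul_add _ _ _

lemma ip_smul_right (c : ℝ) (φ ψ : TestFun d) : ip φ (c • ψ) = c * ip φ ψ := by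
  simp only [ip]
  rw [← torusInt_const_mul]
  congr 1; funext x
  change φ.1 x * (c * ψ.1 x) = _
  ring

/-- The inner product with a fixed test function as a linear map. -/
def ipₗ (φ : TestFun d) : TestFun d →ₗ[ℝ] ℝ where
  toFun := ip φ
  map_add' := ip_add_right φ
  map_smul' c ψ := ip_smul_right c φ ψ

/-- The product `φ ψ` is periodic, so its derivative integrates to zero and no boundary term
appears. -/
lemma ip_partialD (j : Fin d) (φ ψ : TestFun d) : ip φ (partialD j ψ) = -ip (partialD j φ) ψ := by
  have h := torusInt_fderiv (θ := fun x => φ.1 x * ψ.1 x) (φ.2.1.mul ψ.2.1) j 0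
    (fun x => by rw [(periodic_single φ), (periodic_single ψ), add_zero])
  have e : (fun x => fderiv ℝ (fun x => φ.1 x * ψ.1 x) x (Pi.single j 1))
      = fun x => φ.1 x * (partialD j ψ).1 x + (partialD j φ).1 x * ψ.1 x := by
    funext x
    rw [fderiv_fun_mul (differentiable_testFun φ x) (differentiable_testFun ψ x)]
    simp only [partialD_apply, add_apply, smul_apply, smul_eq_mul]
    ring
  rw [e, torusInt_add (continuous_mul_testFun _ _) (continuous_mul_testFun _ _)] at h
  simp only [ip]; linarith

/-! ### Trigonometric modes -/

/-- The phase `2π k·x`. -/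
def phase (k : Fin d → ℤ) (x : Fin d → ℝ) : ℝ := 2 * Real.pi * ∑ i, (k i : ℝ) * x i

lemma contDiff_phase (k : Fin d → ℤ) : ContDiff ℝ (⊤ : ℕ∞) (phase k) := by
  unfold phase; fun_prop

lemma phase_add_int (k n : Fin d → ℤ) (x : Fin d → ℝ) :
    phase k (x + fun i => (n i : ℝ)) = phase k x + (∑ i, k i * n i : ℤ) * (2 * Real.pi) := by
  simp only [phase, Pi.add_apply, mul_add, Finset.sum_add_distrib]
  push_cast
  ring

lemma hasFDerivAt_phase (k : Fin d → ℤ) (x : Fin d → ℝ) (j : Fin d) :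
    fderiv ℝ (phase k) x (Pi.single j 1) = 2 * Real.pi * k j := by
  have h : phase k = fun x => (∑ i, (2 * Real.pi * k i) •
      (ContinuousLinearMap.proj (R := ℝ) (φ := fun _ : Fin d => ℝ) i)) x := by
    funext x
    simp [phase, Finset.mul_sum, sum_apply, mul_assoc]
  rw [h, ContinuousLinearMap.fderiv]
  simp [sum_apply, Pi.single_apply]

/-- The mode `cos(2π k·x)`. -/
def cosMode (k : Fin d → ℤ) : TestFun d := ⟨fun x => Real.cos (phase k x),
  Real.contDiff_cos.comp (contDiff_phase k),
  fun n x => by beta_reduce; rw [phase_add_int, Real.cos_add_int_mul_two_pi]⟩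

/-- The mode `sin(2π k·x)`. -/
def sinMode (k : Fin d → ℤ) : TestFun d := ⟨fun x => Real.sin (phase k x),
  Real.contDiff_sin.comp (contDiff_phase k),
  fun n x => by beta_reduce; rw [phase_add_int, Real.sin_add_int_mul_two_pi]⟩

/-- The index set of the trigonometric modes. -/
abbrev Mode (d : ℕ) : Type := (Fin d → ℤ) × Bool

/-- The trigonometric modes. -/
def mode : Mode d → TestFun d
  | (k, false) => cosMode k
  | (k, true) => sinMode k

lemma partialD_cosMode (j : Fin d) (k : Fin d → ℤ) :
    partialD j (cosMode k) = (-(2 * Real.pi * k j)) • sinMode k := by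
  ext x
  change fderiv ℝ (fun x => Real.cos (phase k x)) x _ = -(2 * Real.pi * k j) * Real.sin (phase k x)
  rw [fderiv_cos ((contDiff_phase k).differentiable (by simp) x)]
  simp only [smul_apply, hasFDerivAt_phase, smul_eq_mul]
  ring

lemma partialD_sinMode (j : Fin d) (k : Fin d → ℤ) :
    partialD j (sinMode k) = (2 * Real.pi * k j) • cosMode k := by
  ext x
  change fderiv ℝ (fun x => Real.sin (phase k x)) x _ = (2 * Real.pi * k j) * Real.cos (phase k x)
  rw [fderiv_sin ((contDiff_phase k).differentiable (by simp) x)]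
  simp only [smul_apply, hasFDerivAt_phase, smul_eq_mul]
  ring

lemma abs_mode_le (m : Mode d) (x : Fin d → ℝ) : |(mode m).1 x| ≤ 1 := by
  obtain ⟨k, _ | _⟩ := m
  · exact Real.abs_cos_le_one _
  · exact Real.abs_sin_le_one _

lemma cosMode_zero : cosMode (0 : Fin d → ℤ) = TestFun.one d := by
  ext x
  change Real.cos (phase 0 x) = 1
  simp [phase]

lemma sinMode_zero : sinMode (0 : Fin d → ℤ) = 0 := by
  ext x
  change Real.sin (phase 0 x) = 0
  simp [phase]

lemma phase_neg (k : Fin d → ℤ) (x) : phase (-k) x = -phase k x := by simp [phase]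

lemma phase_add (k l : Fin d → ℤ) (x) : phase (k + l) x = phase k x + phase l x := by
  simp [phase, add_mul, Finset.sum_add_distrib, mul_add]

lemma phase_sub (k l : Fin d → ℤ) (x) : phase (k - l) x = phase k x - phase l x := by
  rw [sub_eq_add_neg, phase_add, phase_neg, sub_eq_add_neg]

lemma cosMode_neg (k : Fin d → ℤ) : cosMode (-k) = cosMode k := by
  ext x
  change Real.cos (phase (-k) x) = Real.cos (phase k x)
  rw [phase_neg, Real.cos_neg]

lemma sinMode_neg (k : Fin d → ℤ) : sinMode (-k) = -sinMode k := by
  ext x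
  change Real.sin (phase (-k) x) = -Real.sin (phase k x)
  rw [phase_neg, Real.sin_neg]

lemma torusInt_partialD (j : Fin d) (φ : TestFun d) : torusInt (partialD j φ).1 = 0 :=
  torusInt_fderiv φ.2.1 j 0 fun x => by rw [(periodic_single φ), add_zero]

lemma torusInt_smul' (c : ℝ) (φ : TestFun d) : torusInt (c • φ).1 = c * torusInt φ.1 :=
  torusInt_const_mul c φ.1

lemma torusInt_cosMode (k : Fin d → ℤ) : torusInt (cosMode k).1 = if k = 0 then 1 else 0 := by
  split_ifs with h
  · subst h
    rw [cosMode_zero]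
    exact torusInt_const (1 : ℝ)
  -- For `k ≠ 0` some `k j` is nonzero, and the cosine is up to the factor `2π k j` a derivative of
  -- the sine, so its integral vanishes.
  · obtain ⟨j, hj⟩ := Function.ne_iff.mp h
    have h1 := torusInt_partialD j (sinMode k)
    rw [partialD_sinMode, torusInt_smul'] at h1
    have : (k j : ℝ) ≠ 0 := by exact_mod_cast hj
    simpa [this, Real.pi_ne_zero] using h1

lemma torusInt_sinMode (k : Fin d → ℤ) : torusInt (sinMode k).1 = 0 := by
  by_cases h : k = 0
  · subst h
    rw [sinMode_zero]
    exact torusInt_const (0 : ℝ)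
  · obtain ⟨j, hj⟩ := Function.ne_iff.mp h
    have h1 := torusInt_partialD j (cosMode k)
    rw [partialD_cosMode, torusInt_smul'] at h1
    have : (k j : ℝ) ≠ 0 := by exact_mod_cast hj
    simpa [this, Real.pi_ne_zero] using h1

/-- Two indicators occur because `k` and `-k` give the same cosine. The modes are kept overcomplete,
with each pair counted twice and weight `1/2`; sums over all of `ℤ^d` then need neither a choice of
half-lattice nor a special normalization at `k = 0`. -/
lemma ip_cosMode_cosMode (k l : Fin d → ℤ) :
    ip (cosMode k) (cosMode l) = ((if k = l then 1 else 0) + if k = -l then 1 else 0) / 2 := by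
  have e : ip (cosMode k) (cosMode l)
      = torusInt fun x => (1 / 2 : ℝ) * ((cosMode (k - l)).1 x + (cosMode (k + l)).1 x) := by
    simp only [ip]; congr 1; funext x
    change Real.cos (phase k x) * Real.cos (phase l x)
      = 1 / 2 * (Real.cos (phase (k - l) x) + Real.cos (phase (k + l) x))
    rw [phase_sub, phase_add, Real.cos_sub, Real.cos_add]; ring
  rw [e, torusInt_const_mul, torusInt_add (continuous_testFun _) (continuous_testFun _),
    torusInt_cosMode, torusInt_cosMode]
  simp only [sub_eq_zero, add_eq_zero_iff_eq_neg]
  ring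

lemma ip_sinMode_sinMode (k l : Fin d → ℤ) :
    ip (sinMode k) (sinMode l) = ((if k = l then 1 else 0) - if k = -l then 1 else 0) / 2 := by
  have e : ip (sinMode k) (sinMode l)
      = torusInt fun x => (1 / 2 : ℝ) * ((cosMode (k - l)).1 x + (-1) * (cosMode (k + l)).1 x) := by
    simp only [ip]; congr 1; funext x
    change Real.sin (phase k x) * Real.sin (phase l x)
      = 1 / 2 * (Real.cos (phase (k - l) x) + (-1) * Real.cos (phase (k + l) x))
    rw [phase_sub, phase_add, Real.cos_sub, Real.cos_add]; ring
  rw [e, torusInt_const_mul,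
    torusInt_add (continuous_testFun _) ((continuous_testFun _).const_mul _), torusInt_const_mul, torusInt_cosMode, torusInt_cosMode]
  simp only [sub_eq_zero, add_eq_zero_iff_eq_neg]
  ring

lemma ip_cosMode_sinMode (k l : Fin d → ℤ) : ip (cosMode k) (sinMode l) = 0 := by
  have e : ip (cosMode k) (sinMode l)
      = torusInt fun x => (1 / 2 : ℝ) * ((sinMode (k + l)).1 x + (-1) * (sinMode (k - l)).1 x) := by
    simp only [ip]; congr 1; funext x
    change Real.cos (phase k x) * Real.sin (phase l x)
      = 1 / 2 * (Real.sin (phase (k + l) x) + (-1) * Real.sin (phase (k - l) x))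
    rw [phase_sub, phase_add, Real.sin_sub, Real.sin_add]; ring
  rw [e, torusInt_const_mul,
    torusInt_add (continuous_testFun _) ((continuous_testFun _).const_mul _), torusInt_const_mul, torusInt_sinMode, torusInt_sinMode]
  simp

/-! ### Real Fourier coefficients -/

/-- The real Fourier coefficients of a test function. -/
def coef (φ : TestFun d) (m : Mode d) : ℝ := ip (mode m) φ

lemma coef_add (φ ψ : TestFun d) (m : Mode d) : coef (φ + ψ) m = coef φ m + coef ψ m :=
  ip_add_right _ _ _

lemma coef_smul (c : ℝ) (φ : TestFun d) (m : Mode d) : coef (c • φ) m = c * coef φ m :=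
  ip_smul_right _ _ _

lemma coef_sub (φ ψ : TestFun d) (m : Mode d) : coef (φ - ψ) m = coef φ m - coef ψ m :=
  (ipₗ (mode m)).map_sub φ ψ

lemma coef_sum {ι : Type*} (S : Finset ι) (φ : ι → TestFun d) (m : Mode d) :
    coef (∑ i ∈ S, φ i) m = ∑ i ∈ S, coef (φ i) m :=
  map_sum (ipₗ (mode m)) φ S

lemma ip_neg_left (φ ψ : TestFun d) : ip (-φ) ψ = -ip φ ψ := by
  rw [ip_comm, ip_comm φ]; exact (ipₗ ψ).map_neg φ

lemma coef_neg_cos (φ : TestFun d) (k : Fin d → ℤ) : coef φ (-k, false) = coef φ (k, false) := by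
  simp only [coef, mode, cosMode_neg]

lemma coef_neg_sin (φ : TestFun d) (k : Fin d → ℤ) : coef φ (-k, true) = -coef φ (k, true) := by
  simp only [coef, mode, sinMode_neg, ip_neg_left]

lemma coef_partialD_cos (j : Fin d) (φ : TestFun d) (k : Fin d → ℤ) :
    coef (partialD j φ) (k, false) = 2 * Real.pi * k j * coef φ (k, true) := by
  simp only [coef, mode]
  rw [ip_partialD, partialD_cosMode, ip_comm, ip_smul_right, ip_comm]
  ring

lemma coef_partialD_sin (j : Fin d) (φ : TestFun d) (k : Fin d → ℤ) :
    coef (partialD j φ) (k, true) = -(2 * Real.pi * k j * coef φ (k, false)) := by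
  simp only [coef, mode]
  rw [ip_partialD, partialD_sinMode, ip_comm, ip_smul_right, ip_comm]

lemma coef_partialD_partialD (j : Fin d) (φ : TestFun d) (m : Mode d) :
    coef (partialD j (partialD j φ)) m = -(2 * Real.pi * m.1 j) ^ 2 * coef φ m := by
  obtain ⟨k, _ | _⟩ := m
  · rw [coef_partialD_cos, coef_partialD_sin]; ring
  · rw [coef_partialD_sin, coef_partialD_cos]; ring

/-- The eigenvalue `4π²|k|²` of `-Δ`. -/
def eigen (m : Mode d) : ℝ := ∑ j, (2 * Real.pi * m.1 j) ^ 2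

lemma eigen_nonneg (m : Mode d) : 0 ≤ eigen m := Finset.sum_nonneg fun _ _ => sq_nonneg _

lemma coef_laplacian (φ : TestFun d) (m : Mode d) :
    coef (laplacian φ) m = -eigen m * coef φ m := by
  rw [laplacian, coef_sum]
  simp only [coef_partialD_partialD, eigen]
  rw [← Finset.sum_mul, Finset.sum_neg_distrib]

lemma laplacian_mode (m : Mode d) : laplacian (mode m) = (-eigen m) • mode m := by
  have h : ∀ j, partialD j (partialD j (mode m)) = (-(2 * Real.pi * m.1 j) ^ 2) • mode m := by
    intro j
    obtain ⟨k, _ | _⟩ := m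
    · simp only [mode]
      rw [partialD_cosMode, partialD_smul, partialD_sinMode, smul_smul]
      congr 1; ring
    · simp only [mode]
      rw [partialD_sinMode, partialD_smul, partialD_cosMode, smul_smul]
      congr 1; ring
  simp only [laplacian, h, eigen]
  rw [← Finset.sum_smul, Finset.sum_neg_distrib]

lemma laplacian_add (φ ψ : TestFun d) : laplacian (φ + ψ) = laplacian φ + laplacian ψ := by
  simp only [laplacian, partialD_add, Finset.sum_add_distrib]

lemma laplacian_smul (c : ℝ) (φ : TestFun d) : laplacian (c • φ) = c • laplacian φ := by
  simp only [laplacian, partialD_smul, Finset.smul_sum]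

lemma fourierCoef_eq (φ : TestFun d) (k : Fin d → ℤ) :
    fourierCoef φ k = (coef φ (k, false) : ℂ) - Complex.I * (coef φ (k, true) : ℂ) := by
  have e : ∀ x : Fin d → ℝ,
      Complex.exp (-(2 * Real.pi * Complex.I * ((∑ i, (k i : ℝ) * x i : ℝ) : ℂ))) * (φ.1 x : ℂ)
      = (((cosMode k).1 x * φ.1 x : ℝ) : ℂ) + (-Complex.I) * (((sinMode k).1 x * φ.1 x : ℝ) : ℂ) := by
    intro x
    have : -(2 * Real.pi * Complex.I * ((∑ i, (k i : ℝ) * x i : ℝ) : ℂ))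
        = ((-phase k x : ℝ) : ℂ) * Complex.I := by
      simp only [phase]; push_cast; ring
    rw [this, Complex.exp_mul_I, ← Complex.ofReal_cos, ← Complex.ofReal_sin, Real.cos_neg,
      Real.sin_neg]
    change ((Real.cos (phase k x) : ℂ) + _) * _ = ((Real.cos (phase k x) * φ.1 x : ℝ) : ℂ)
      + _ * ((Real.sin (phase k x) * φ.1 x : ℝ) : ℂ)
    push_cast; ring
  simp only [fourierCoef, e]
  have h1 := continuous_mul_testFun (cosMode k) φ
  have h2 := continuous_mul_testFun (sinMode k) φ
  rw [torusInt_add (by fun_prop) (by fun_prop)]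
  simp only [torusInt, coef, ip, mode]
  rw [integral_const_mul, integral_complex_ofReal, integral_complex_ofReal]
  ring

lemma norm_fourierCoef_sq (φ : TestFun d) (k : Fin d → ℤ) :
    ‖fourierCoef φ k‖ ^ 2 = coef φ (k, false) ^ 2 + coef φ (k, true) ^ 2 := by
  rw [fourierCoef_eq, Complex.sq_norm, Complex.normSq_apply]
  simp
  ring

end AbelianYM

end

noncomputable section

namespace AbelianYM

variable {d : ℕ}

/-! ### Weighted sums over the lattice -/

/-- The weight `1 + |k|²`. -/
def wt (k : Fin d → ℤ) : ℝ := 1 + ∑ i, (k i : ℝ) ^ 2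

lemma one_le_wt (k : Fin d → ℤ) : 1 ≤ wt k :=
  le_add_of_nonneg_right (Finset.sum_nonneg fun _ _ => sq_nonneg _)

lemma wt_pos (k : Fin d → ℤ) : 0 < wt k := one_pos.trans_le (one_le_wt k)

lemma summable_one_add_sq_rpow {q : ℝ} (hq : q < -(1 / 2)) :
    Summable fun k : ℤ => (1 + (k : ℝ) ^ 2) ^ q := by
  have h : Summable fun k : ℤ => |(k : ℝ)| ^ (-(-(2 * q))) :=
    Real.summable_abs_int_rpow (by linarith)
  refine Summable.of_norm_bounded_eventually h ?_
  filter_upwards [(Set.finite_singleton (0 : ℤ)).compl_mem_cofinite] with k hk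
  have hk' : 0 < |(k : ℝ)| := abs_pos.mpr (by exact_mod_cast hk)
  rw [Real.norm_of_nonneg (by positivity), neg_neg, Real.rpow_mul hk'.le]
  refine Real.rpow_le_rpow_of_nonpos (by positivity) ?_ (by linarith)
  rw [Real.rpow_two, sq_abs]; linarith

lemma summable_pi_prod {g : ℤ → ℝ} (hg : Summable g) (h0 : ∀ k, 0 ≤ g k) :
    Summable fun k : Fin d → ℤ => ∏ i, g (k i) := by
  refine summable_of_sum_le (c := (∑' k, g k) ^ d)
    (fun k => Finset.prod_nonneg fun i _ => h0 _) fun S => ?_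
  classical
  let T : Fin d → Finset ℤ := fun i => S.image fun k => k i
  calc ∑ k ∈ S, ∏ i, g (k i) ≤ ∑ k ∈ Fintype.piFinset T, ∏ i, g (k i) := by
        refine Finset.sum_le_sum_of_subset_of_nonneg (fun k hk => ?_)
          fun k _ _ => Finset.prod_nonneg fun i _ => h0 _
        exact Fintype.mem_piFinset.mpr fun i => Finset.mem_image_of_mem _ hk
    _ = ∏ i, ∑ n ∈ T i, g n := (Finset.prod_univ_sum T fun _ n => g n).symm
    _ ≤ ∏ _i : Fin d, ∑' k, g k := Finset.prod_le_prod
        (fun i _ => Finset.sum_nonneg fun n _ => h0 n)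
        fun i _ => hg.sum_le_tsum _ fun n _ => h0 n
    _ = (∑' k, g k) ^ d := by simp

/-- Since `∏ (1 + k_i²) ≤ wt k ^ d` and `r` is negative, `wt k ^ r` is at most a product of
one-dimensional terms with exponent `r / d < -1/2`, whose sum over the lattice factorizes. -/
lemma summable_wt_rpow {r : ℝ} (hr : r < -((d : ℝ) / 2)) :
    Summable fun k : Fin d → ℤ => wt k ^ r := by
  rcases Nat.eq_zero_or_pos d with rfl | hd
  · exact Summable.of_finite
  have hd' : (0 : ℝ) < d := by exact_mod_cast hd
  have hq : r / d < -(1 / 2) := by rw [div_lt_iff₀ hd']; linarith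
  refine Summable.of_nonneg_of_le (fun k => Real.rpow_nonneg (wt_pos k).le _) (fun k => ?_)
    (summable_pi_prod (summable_one_add_sq_rpow hq) fun k => by positivity)
  have h1 : ∏ i, (1 + (k i : ℝ) ^ 2) ≤ wt k ^ d := by
    calc ∏ i, (1 + (k i : ℝ) ^ 2) ≤ ∏ _i : Fin d, wt k :=
          Finset.prod_le_prod (fun i _ => by positivity) fun i _ => by
            unfold wt
            gcongr
            exact Finset.single_le_sum (f := fun i => (k i : ℝ) ^ 2)
              (fun _ _ => sq_nonneg _) (Finset.mem_univ i)
      _ = wt k ^ d := by simp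
  calc wt k ^ r = (wt k ^ d) ^ (r / d) := by
        rw [← Real.rpow_natCast, ← Real.rpow_mul (wt_pos k).le]; congr 1; field_simp
    _ ≤ (∏ i, (1 + (k i : ℝ) ^ 2)) ^ (r / d) :=
        Real.rpow_le_rpow_of_nonpos (Finset.prod_pos fun i _ => by positivity) h1 (by linarith)
    _ = ∏ i, (1 + (k i : ℝ) ^ 2) ^ (r / d) :=
        (Real.finsetProd_rpow _ _ (fun i _ => by positivity) _).symm

lemma summable_mode_iff {f : Mode d → ℝ} (h0 : ∀ m, 0 ≤ f m) :
    Summable f ↔ Summable fun k => f (k, false) + f (k, true) := by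
  rw [summable_prod_of_nonneg h0]
  simp only [tsum_fintype, Fintype.sum_bool, add_comm (f (_, true))]
  exact ⟨fun h => h.2, fun h => ⟨fun _ => Summable.of_finite, h⟩⟩

lemma tsum_mode {f : Mode d → ℝ} (h : Summable f) :
    ∑' m, f m = ∑' k, (f (k, false) + f (k, true)) := by
  rw [h.tsum_prod]
  simp only [tsum_fintype, Fintype.sum_bool, add_comm (f (_, true))]

/-! ### Decay of Fourier coefficients -/

lemma abs_ip_mode_le {φ : TestFun d} {K : ℝ} (h : ∀ x, |φ.1 x| ≤ K) (m : Mode d) :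
    |coef φ m| ≤ K := by
  refine abs_torusInt_le fun x => ?_
  rw [abs_mul]
  exact (mul_le_of_le_one_left (abs_nonneg _) (abs_mode_le m x)).trans (h x)

/-- One factor `wt = 1 + ∑ k_j²` splits into `d + 1` terms, and multiplication by `k_j²` is
dominated by the effect of `∂_j²` on coefficients. So each power of the weight costs two derivatives
and a factor `d + 1`. -/
lemma wt_pow_mul_abs_coef_le (m : Mode d) (p : ℕ) : ∀ (φ : TestFun d) (K : ℝ),
    (∀ l : List (Fin d), l.length ≤ 2 * p → ∀ x, |(l.foldr partialD φ).1 x| ≤ K) →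
      wt m.1 ^ p * |coef φ m| ≤ (d + 1) ^ p * K := by
  induction p with
  | zero =>
    intro φ K h
    simpa using abs_ip_mode_le (fun x => h [] (by simp) x) m
  | succ p ih =>
    intro φ K h
    have h1 := ih φ K fun l hl => h l (by omega)
    have h2 : ∀ j, wt m.1 ^ p * |coef (partialD j (partialD j φ)) m| ≤ (d + 1) ^ p * K := by
      intro j
      refine ih _ K fun l hl x => ?_
      have := h (l ++ [j, j]) (by simp; omega) x
      simpa using this
    have h3 : ∀ j, wt m.1 ^ p * ((m.1 j : ℝ) ^ 2 * |coef φ m|) ≤ (d + 1) ^ p * K := by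
      intro j
      refine le_trans ?_ (h2 j)
      rw [coef_partialD_partialD, abs_mul, abs_of_nonpos (neg_nonpos.mpr (sq_nonneg _)), neg_neg]
      have hpi : (1 : ℝ) ≤ (2 * Real.pi) ^ 2 := by nlinarith [Real.pi_gt_three]
      have := (wt_pos m.1).le
      refine mul_le_mul_of_nonneg_left (mul_le_mul_of_nonneg_right ?_ (abs_nonneg _))
        (pow_nonneg this p)
      rw [mul_pow]
      exact le_mul_of_one_le_left (sq_nonneg _) hpi
    calc wt m.1 ^ (p + 1) * |coef φ m|
        = wt m.1 ^ p * |coef φ m| + ∑ j, wt m.1 ^ p * ((m.1 j : ℝ) ^ 2 * |coef φ m|) := by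
          rw [← Finset.mul_sum, ← Finset.sum_mul, pow_succ, wt]; ring
      _ ≤ (d + 1) ^ p * K + ∑ _j : Fin d, (d + 1) ^ p * K :=
          add_le_add h1 (Finset.sum_le_sum fun j _ => h3 j)
      _ = (d + 1) ^ (p + 1) * K := by simp; ring

lemma exists_bound (φ : TestFun d) : ∃ K, ∀ x, |φ.1 x| ≤ K := by
  obtain ⟨K, hK⟩ := (isCompact_Icc (a := (0 : Fin d → ℝ)) (b := 1)).exists_bound_of_continuousOn
    (continuous_testFun φ).continuousOn
  refine ⟨K, fun x => ?_⟩
  have h := φ.2.2 (fun i => ⌊x i⌋) (fun i => Int.fract (x i))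
  have e : (fun i => Int.fract (x i)) + (fun i => ((⌊x i⌋ : ℤ) : ℝ)) = x := by
    funext i; exact Int.fract_add_floor _
  rw [e] at h
  rw [h]
  exact hK _ ⟨fun i => Int.fract_nonneg _, fun i => (Int.fract_lt_one _).le⟩

lemma exists_bound_derivs (φ : TestFun d) (n : ℕ) :
    ∃ K, ∀ l : List (Fin d), l.length ≤ n → ∀ x, |(l.foldr partialD φ).1 x| ≤ K := by
  choose K hK using fun l : List (Fin d) => exists_bound (l.foldr partialD φ)
  obtain ⟨M, hM⟩ := ((List.finite_length_le (Fin d) n).image K).bddAbove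
  exact ⟨M, fun l hl x => (hK l x).trans (hM (Set.mem_image_of_mem K hl))⟩

lemma wt_rpow_mul_coef_sq_le (s : ℝ) (p : ℕ) {φ : TestFun d} {K : ℝ}
    (h : ∀ l : List (Fin d), l.length ≤ 2 * p → ∀ x, |(l.foldr partialD φ).1 x| ≤ K)
    (m : Mode d) :
    wt m.1 ^ s * coef φ m ^ 2 ≤ ((d + 1) ^ p * K) ^ 2 * wt m.1 ^ (s - 2 * p) := by
  have h1 := wt_pow_mul_abs_coef_le m p φ K h
  have hw := wt_pos m.1
  have h2 : (wt m.1 ^ p * |coef φ m|) ^ 2 ≤ ((d + 1) ^ p * K) ^ 2 := by gcongr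
  have h3 : wt m.1 ^ s * coef φ m ^ 2
      = (wt m.1 ^ p * |coef φ m|) ^ 2 * wt m.1 ^ (s - 2 * p) := by
    rw [mul_pow, sq_abs, ← pow_mul, mul_right_comm, ← Real.rpow_natCast (wt m.1),
      ← Real.rpow_add hw]
    congr 2; push_cast; ring
  rw [h3]
  gcongr

lemma summable_wt_mode {r : ℝ} (hr : r < -((d : ℝ) / 2)) :
    Summable fun m : Mode d => wt m.1 ^ r :=
  (summable_mode_iff fun _ => Real.rpow_nonneg (wt_pos _).le _).mpr
    ((summable_wt_rpow hr).add (summable_wt_rpow hr))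

lemma exists_decay_order (d : ℕ) (s : ℝ) : ∃ p : ℕ, s - 2 * p < -((d : ℝ) / 2) := by
  obtain ⟨p, hp⟩ := exists_nat_gt (s + d)
  refine ⟨p, ?_⟩
  have hd : (0 : ℝ) ≤ d := Nat.cast_nonneg d
  have hp0 : (0 : ℝ) ≤ p := Nat.cast_nonneg p
  linarith

lemma summable_coef_sq (s : ℝ) (φ : TestFun d) :
    Summable fun m => wt m.1 ^ s * coef φ m ^ 2 := by
  obtain ⟨p, hp⟩ := exists_decay_order d s
  obtain ⟨K, hK⟩ := exists_bound_derivs φ (2 * p)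
  exact Summable.of_nonneg_of_le
    (fun m => mul_nonneg (Real.rpow_nonneg (wt_pos _).le _) (sq_nonneg _))
    (wt_rpow_mul_coef_sq_le s p hK) ((summable_wt_mode hp).mul_left _)

/-- The square of the `H^s` norm. -/
def hsq (s : ℝ) (φ : TestFun d) : ℝ := ∑' m, wt m.1 ^ s * coef φ m ^ 2

lemma hsq_nonneg (s : ℝ) (φ : TestFun d) : 0 ≤ hsq s φ :=
  tsum_nonneg fun _ => mul_nonneg (Real.rpow_nonneg (wt_pos _).le _) (sq_nonneg _)

lemma sobolevNorm_eq (s : ℝ) (φ : TestFun d) :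
    sobolevNorm s φ = ENNReal.ofReal (√(hsq s φ)) := by
  have h0 : ∀ m : Mode d, 0 ≤ wt m.1 ^ s * coef φ m ^ 2 := fun m =>
    mul_nonneg (Real.rpow_nonneg (wt_pos _).le _) (sq_nonneg _)
  have h1 : ∀ k : Fin d → ℤ,
      ENNReal.ofReal ((1 + ∑ i, (k i : ℝ) ^ 2) ^ s) * ‖fourierCoef φ k‖ₑ ^ 2
      = ENNReal.ofReal (wt k ^ s * coef φ (k, false) ^ 2 + wt k ^ s * coef φ (k, true) ^ 2) := by
    intro k
    rw [← ofReal_norm, ← ENNReal.ofReal_pow (norm_nonneg _), norm_fourierCoef_sq,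
      ← mul_add, ENNReal.ofReal_mul (Real.rpow_nonneg (wt_pos k).le _)]
    rfl
  rw [sobolevNorm, hsq, tsum_mode (summable_coef_sq s φ), Real.sqrt_eq_rpow,
    ← ENNReal.ofReal_rpow_of_nonneg (tsum_nonneg fun k => add_nonneg (h0 _) (h0 _)) (by norm_num),
    ENNReal.ofReal_tsum_of_nonneg (fun k => add_nonneg (h0 _) (h0 _))
      ((summable_mode_iff h0).mp (summable_coef_sq s φ))]
  simp only [h1]

/-- Finitely many sup norms of derivatives control the `H^s` norm. This makes every element of
`H^{-s}` a distribution, hence admissible as the singular part of a gauge transformation. -/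
lemma exists_hsq_le (d : ℕ) (s : ℝ) : ∃ (n : ℕ) (M : ℝ), 0 ≤ M ∧ ∀ (φ : TestFun d) (K : ℝ),
    (∀ l : List (Fin d), l.length ≤ n → ∀ x, |(l.foldr partialD φ).1 x| ≤ K) →
      √(hsq s φ) ≤ M * K := by
  obtain ⟨p, hp⟩ := exists_decay_order d s
  refine ⟨2 * p, (d + 1) ^ p * √(∑' m : Mode d, wt m.1 ^ (s - 2 * p)), by positivity,
    fun φ K hK => ?_⟩
  have hK0 : 0 ≤ K := (abs_nonneg _).trans (hK [] (by simp) 0)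
  have hw := summable_wt_mode hp
  have : hsq s φ ≤ ((d + 1) ^ p * K) ^ 2 * ∑' m : Mode d, wt m.1 ^ (s - 2 * p) := by
    rw [← tsum_mul_left]
    exact (summable_coef_sq s φ).tsum_le_tsum (wt_rpow_mul_coef_sq_le s p hK) (hw.mul_left _)
  calc √(hsq s φ) ≤ √(((d + 1) ^ p * K) ^ 2 * ∑' m : Mode d, wt m.1 ^ (s - 2 * p)) :=
        Real.sqrt_le_sqrt this
    _ = _ := by
        rw [Real.sqrt_mul (sq_nonneg _), Real.sqrt_sq (by positivity)]; ring

/-! ### Partial Fourier sums -/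

/-- The box `[-N, N]^d` of frequencies. -/
def box (d N : ℕ) : Finset (Fin d → ℤ) := Finset.Icc (fun _ => -(N : ℤ)) fun _ => (N : ℤ)

lemma neg_mem_box {N : ℕ} {k : Fin d → ℤ} : -k ∈ box d N ↔ k ∈ box d N := by
  simp only [box, Finset.mem_Icc, Pi.le_def, Pi.neg_apply]
  constructor <;> rintro ⟨h1, h2⟩ <;> constructor <;> intro i <;> have := h1 i <;> have := h2 i <;>
    omega

/-- The trigonometric polynomial with coefficients `y` restricted to a box. -/
def trigPoly (N : ℕ) (y : Mode d → ℝ) : TestFun d :=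
  ∑ m ∈ box d N ×ˢ Finset.univ, y m • mode m

lemma tendsto_box : Tendsto (fun N => box d N ×ˢ (Finset.univ : Finset Bool)) atTop atTop := by
  refine tendsto_atTop_finset_of_monotone (fun N M h => ?_) fun m => ?_
  · refine Finset.product_subset_product_left (Finset.Icc_subset_Icc ?_ ?_) <;> intro i <;>
      simp [h]
  · refine ⟨∑ i, (m.1 i).natAbs, Finset.mem_product.mpr ⟨?_, Finset.mem_univ _⟩⟩
    have : ∀ i, (m.1 i).natAbs ≤ ∑ i, (m.1 i).natAbs := fun i =>
      Finset.single_le_sum (f := fun i => (m.1 i).natAbs) (fun _ _ => Nat.zero_le _)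
        (Finset.mem_univ i)
    refine Finset.mem_Icc.mpr ⟨fun i => ?_, fun i => ?_⟩ <;> have := this i <;> dsimp only <;> omega

/-- Coefficient `n` collects half of `y` at `n` and half of it (up to sign) at the opposite
frequency. The symmetry hypotheses make the two halves agree; they hold for the values of any
functional on the modes. -/
lemma coef_trigPoly {y : Mode d → ℝ} (hc : ∀ k, y (-k, false) = y (k, false))
    (hs : ∀ k, y (-k, true) = -y (k, true)) (N : ℕ) (n : Mode d) :
    coef (trigPoly N y) n = if n.1 ∈ box d N then y n else 0 := by
  have key : ∀ (f : (Fin d → ℤ) → ℝ) (k : Fin d → ℤ),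
      ∑ l ∈ box d N, f l * (if k = l then 1 else 0) = if k ∈ box d N then f k else 0 := by
    intro f k
    simp
  have key' : ∀ (f : (Fin d → ℤ) → ℝ) (k : Fin d → ℤ),
      ∑ l ∈ box d N, f l * (if k = -l then 1 else 0) = if k ∈ box d N then f (-k) else 0 := by
    intro f k
    have := key f (-k)
    simp only [neg_mem_box] at this
    rw [← this]
    simp only [neg_eq_iff_eq_neg]
  rw [trigPoly, coef_sum]
  simp only [coef_smul]
  rw [Finset.sum_product]
  simp only [Fintype.sum_bool, coef]
  obtain ⟨k, _ | _⟩ := n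
  · have : ∀ l, y (l, true) * ip (mode (k, false)) (mode (l, true))
        + y (l, false) * ip (mode (k, false)) (mode (l, false))
        = (y (l, false) * (if k = l then 1 else 0)
          + y (l, false) * (if k = -l then 1 else 0)) / 2 := by
      intro l
      simp only [mode, ip_cosMode_sinMode, ip_cosMode_cosMode]; ring
    rw [Finset.sum_congr rfl fun l _ => this l, ← Finset.sum_div, Finset.sum_add_distrib,
      key fun l => y (l, false), key' fun l => y (l, false), hc]
    split_ifs <;> ring
  · have : ∀ l, y (l, true) * ip (mode (k, true)) (mode (l, true))
        + y (l, false) * ip (mode (k, true)) (mode (l, false))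
        = (y (l, true) * (if k = l then 1 else 0)
          - y (l, true) * (if k = -l then 1 else 0)) / 2 := by
      intro l
      simp only [mode, ip_sinMode_sinMode, ip_comm (sinMode k) (cosMode l), ip_cosMode_sinMode]
      ring
    rw [Finset.sum_congr rfl fun l _ => this l, ← Finset.sum_div, Finset.sum_sub_distrib,
      key fun l => y (l, true), key' fun l => y (l, true), hs]
    split_ifs <;> ring

/-- The partial sums of the Fourier series of `φ`. -/
def fourierSum (N : ℕ) (φ : TestFun d) : TestFun d := trigPoly N (coef φ)

lemma coef_fourierSum (N : ℕ) (φ : TestFun d) (n : Mode d) :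
    coef (fourierSum N φ) n = if n.1 ∈ box d N then coef φ n else 0 :=
  coef_trigPoly (coef_neg_cos φ) (coef_neg_sin φ) N n

/-- Dominated convergence, valid for every real `s`: trigonometric polynomials approximate a test
function in all Sobolev norms, so an element of `H^{-s}` is determined by its modes. -/
lemma tendsto_hsq_sub_fourierSum (s : ℝ) (φ : TestFun d) :
    Tendsto (fun N => hsq s (φ - fourierSum N φ)) atTop (𝓝 0) := by
  have h0 : ∀ m : Mode d, 0 ≤ wt m.1 ^ s := fun m => Real.rpow_nonneg (wt_pos _).le _
  have hc : ∀ N n, coef (φ - fourierSum N φ) n = if n.1 ∈ box d N then 0 else coef φ n := by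
    intro N n
    rw [coef_sub, coef_fourierSum]
    split_ifs <;> simp
  have : Tendsto (fun N => ∑' m, wt m.1 ^ s * coef (φ - fourierSum N φ) m ^ 2) atTop
      (𝓝 (∑' _m : Mode d, (0 : ℝ))) := by
    refine tendsto_tsum_of_dominated_convergence (summable_coef_sq s φ) (fun m => ?_) ?_
    · refine tendsto_const_nhds.congr' ?_
      filter_upwards [tendsto_box.eventually_ge_atTop {m}] with N hN
      have : m.1 ∈ box d N := (Finset.mem_product.mp (hN (Finset.mem_singleton_self m))).1
      simp [hc, this]
    · refine Eventually.of_forall fun N m => ?_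
      rw [Real.norm_of_nonneg (mul_nonneg (h0 m) (sq_nonneg _)), hc]
      split_ifs
      · simpa using mul_nonneg (h0 m) (sq_nonneg _)
      · exact le_rfl
  simpa [hsq] using this

/-! ### Completeness of the trigonometric system -/

lemma summable_abs_coef (φ : TestFun d) : Summable fun m => |coef φ m| := by
  -- With `s = 0` the summable weight is `wt ^ (-2p)`, so the coefficients must decay to order `2p`
  -- in the weight, which costs `4p` derivatives.
  obtain ⟨p, hp⟩ := exists_decay_order d 0
  obtain ⟨K, hK⟩ := exists_bound_derivs φ (2 * (2 * p))
  refine Summable.of_nonneg_of_le (fun m => abs_nonneg _) (fun m => ?_)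
    ((summable_wt_mode hp).mul_left (((d : ℝ) + 1) ^ (2 * p) * K))
  have h1 := wt_pow_mul_abs_coef_le m (2 * p) φ K hK
  have hw := wt_pos m.1
  have e : wt m.1 ^ ((0 : ℝ) - 2 * p) = (wt m.1 ^ (2 * p))⁻¹ := by
    rw [zero_sub, Real.rpow_neg hw.le]
    congr 1
    rw [← Real.rpow_natCast]; push_cast; rfl
  rw [e, ← div_eq_mul_inv, le_div_iff₀ (by positivity), mul_comm]
  exact h1

lemma exists_out_eq (x : Fin d → ℝ) : ∃ n : Fin d → ℤ,
    (fun i => Quotient.out ((x i : ℝ) : UnitAddCircle)) = x + fun i => (n i : ℝ) := by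
  have h : ∀ i, ∃ n : ℤ, Quotient.out ((x i : ℝ) : UnitAddCircle) = x i + n := by
    intro i
    have h1 : ((Quotient.out ((x i : ℝ) : UnitAddCircle) : ℝ) : UnitAddCircle) = (x i : ℝ) :=
      Quotient.out_eq _
    obtain ⟨n, hn⟩ := AddSubgroup.mem_zmultiples_iff.mp (QuotientAddGroup.eq.mp h1.symm)
    refine ⟨n, ?_⟩
    rw [zsmul_one] at hn
    linarith
  choose n hn using h
  exact ⟨n, funext hn⟩

/-- The function on the standard torus induced by a test function. -/
def toTorus (φ : TestFun d) : C(UnitAddTorus (Fin d), ℂ) where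
  toFun y := (φ.1 (fun i => Quotient.out (y i)) : ℂ)
  continuous_toFun := by
    -- The section `Quotient.out` is not continuous. Continuity is tested after composition with the
    -- open quotient map `ℝ^d → T^d`, where periodicity turns the composite into `φ` itself.
    have hq : IsOpenQuotientMap
        (Pi.map fun _ : Fin d => ((↑) : ℝ → UnitAddCircle)) :=
      IsOpenQuotientMap.piMap fun _ => QuotientAddGroup.isOpenQuotientMap_mk
    rw [← hq.continuous_comp_iff]
    have : ((fun y : UnitAddTorus (Fin d) => (φ.1 (fun i => Quotient.out (y i)) : ℂ)) ∘
        Pi.map fun _ : Fin d => ((↑) : ℝ → UnitAddCircle)) = fun x => (φ.1 x : ℂ) := by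
      funext x
      obtain ⟨n, e⟩ := exists_out_eq x
      simp only [Function.comp_apply, Pi.map_apply, e, φ.2.2]
    rw [this]
    exact Complex.continuous_ofReal.comp (continuous_testFun φ)

lemma toTorus_apply (φ : TestFun d) (x : Fin d → ℝ) :
    toTorus φ (fun i => (x i : UnitAddCircle)) = (φ.1 x : ℂ) := by
  obtain ⟨n, e⟩ := exists_out_eq x
  change ((φ.1 (fun i => Quotient.out ((x i : ℝ) : UnitAddCircle)) : ℝ) : ℂ) = _
  rw [e, φ.2.2]

lemma mFourier_coe (k : Fin d → ℤ) (x : Fin d → ℝ) :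
    UnitAddTorus.mFourier k (fun i => (x i : UnitAddCircle))
      = Complex.exp (phase k x * Complex.I) := by
  simp only [UnitAddTorus.mFourier, ContinuousMap.coe_mk, fourier_coe_apply]
  rw [← Complex.exp_sum]
  congr 1
  simp only [phase, Finset.mul_sum]
  push_cast
  rw [Finset.sum_mul]
  refine Finset.sum_congr rfl fun i _ => ?_
  ring

lemma mFourierCoeff_toTorus (φ : TestFun d) (k : Fin d → ℤ) :
    UnitAddTorus.mFourierCoeff (toTorus φ) k = fourierCoef φ k := by
  rw [UnitAddTorus.mFourierCoeff_eq_integral _ _ 0]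
  have hset : ({x : Fin d → ℝ | ∀ i, x i ∈ Set.Ioc ((0 : Fin d → ℝ) i) ((0 : Fin d → ℝ) i + 1)})
      =ᵐ[volume] Set.Icc (0 : Fin d → ℝ) 1 := by
    have := Measure.univ_pi_Ioc_ae_eq_Icc (μ := fun _ : Fin d => (volume : Measure ℝ))
      (f := 0) (g := 1)
    rw [← volume_pi] at this
    have e : {x : Fin d → ℝ | ∀ i, x i ∈ Set.Ioc ((0 : Fin d → ℝ) i) ((0 : Fin d → ℝ) i + 1)}
        = Set.univ.pi fun i => Set.Ioc ((0 : Fin d → ℝ) i) ((1 : Fin d → ℝ) i) := by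
      ext x
      simp
    rw [e]
    exact this
  rw [setIntegral_congr_set hset, fourierCoef, torusInt]
  congr 1
  funext x
  rw [mFourier_coe, toTorus_apply, smul_eq_mul, phase_neg]
  congr 2
  simp only [phase]; push_cast; ring

lemma hasSum_mode_of_summable {f : Mode d → ℝ} (h : Summable f) {S : ℝ}
    (hS : HasSum (fun k => f (k, false) + f (k, true)) S) : HasSum f S := by
  rw [← hS.tsum_eq, ← tsum_mode h]
  exact h.hasSum

/-- The Fourier series of a test function converges to it. -/
lemma hasSum_coef_mul_mode (φ : TestFun d) (x : Fin d → ℝ) :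
    HasSum (fun m => coef φ m * (mode m).1 x) (φ.1 x) := by
  have hsum : Summable (UnitAddTorus.mFourierCoeff (toTorus φ)) := by
    have h1 := (summable_mode_iff fun m => abs_nonneg _).mp (summable_abs_coef φ)
    refine Summable.of_norm_bounded h1 fun k => ?_
    rw [mFourierCoeff_toTorus, fourierCoef_eq]
    refine (norm_sub_le _ _).trans ?_
    simp
  have h := UnitAddTorus.hasSum_mFourier_series_apply_of_summable hsum
    (fun i => (x i : UnitAddCircle))
  have h2 := Complex.hasSum_re h
  rw [toTorus_apply, Complex.ofReal_re] at h2
  have hs : Summable fun m => coef φ m * (mode m).1 x := by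
    refine Summable.of_norm_bounded (summable_abs_coef φ) fun m => ?_
    rw [norm_mul, Real.norm_eq_abs, Real.norm_eq_abs]
    exact mul_le_of_le_one_right (abs_nonneg _) (abs_mode_le m x)
  refine hasSum_mode_of_summable hs (h2.congr_fun fun k => ?_)
  rw [mFourierCoeff_toTorus, mFourier_coe, fourierCoef_eq, Complex.exp_mul_I,
    ← Complex.ofReal_cos, ← Complex.ofReal_sin]
  simp [mode, cosMode, sinMode, -Complex.ofReal_cos, -Complex.ofReal_sin]

/-- **Parseval's identity** for real Fourier coefficients. -/
lemma ip_self_eq_hsq (φ : TestFun d) : ip φ φ = hsq 0 φ := by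
  have hint : ∀ m : Mode d, Integrable (fun x => coef φ m * ((mode m).1 x * φ.1 x))
      ((volume : Measure (Fin d → ℝ)).restrict (Set.Icc 0 1)) := fun m =>
    integrableOn_cell (continuous_const.mul (continuous_mul_testFun _ _))
  obtain ⟨K, hK⟩ := exists_bound φ
  have h := hasSum_integral_of_summable_integral_norm hint (by
    refine Summable.of_nonneg_of_le (fun m => integral_nonneg fun x => norm_nonneg _)
      (fun m => ?_) ((summable_abs_coef φ).mul_right K)
    refine (le_abs_self _).trans (abs_torusInt_le fun x => ?_)
    rw [abs_norm, Real.norm_eq_abs, abs_mul, abs_mul]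
    gcongr
    exact (mul_le_of_le_one_left (abs_nonneg _) (abs_mode_le m x)).trans (hK x))
  have e : ∀ x, ∑' m, coef φ m * ((mode m).1 x * φ.1 x) = φ.1 x * φ.1 x := by
    intro x
    rw [← ((hasSum_coef_mul_mode φ x).mul_right (φ.1 x)).tsum_eq]
    simp only [mul_assoc]
  simp only [e] at h
  change ∫ x in Set.Icc (0 : Fin d → ℝ) 1, φ.1 x * φ.1 x = _
  rw [← h.tsum_eq, hsq]
  refine tsum_congr fun m => ?_
  rw [integral_const_mul, Real.rpow_zero, one_mul, sq]
  rfl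

end AbelianYM

end

noncomputable section

namespace AbelianYM

variable {d : ℕ} {s : ℝ}

/-! ### The space `H^{-s}` in Fourier coordinates -/

lemma sub_val (a b : NegSobolev d s) (φ : TestFun d) : (a - b).1 φ = a.1 φ - b.1 φ := rfl

lemma abs_tsum_le {ι : Type*} {f : ι → ℝ} (h : Summable fun i => |f i|) :
    |∑' i, f i| ≤ ∑' i, |f i| :=
  norm_tsum_le_tsum_norm (f := f) h

/-- The weight is split as `wt ^ (s/2) * wt ^ (-s/2) = 1`. This is the duality between `H^s` and
weighted `ℓ²` sequences of modes. -/
lemma cauchy_schwarz {y : Mode d → ℝ} (hy : Summable fun m => wt m.1 ^ (-s) * y m ^ 2)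
    (φ : TestFun d) : Summable (fun m => |coef φ m * y m|) ∧
      ∑' m, |coef φ m * y m| ≤ √(hsq s φ) * √(∑' m, wt m.1 ^ (-s) * y m ^ 2) := by
  have e1 : ∀ m : Mode d, (wt m.1 ^ (s / 2) * |coef φ m|) ^ (2 : ℝ)
      = wt m.1 ^ s * coef φ m ^ 2 := by
    intro m
    rw [Real.rpow_two, mul_pow, sq_abs, ← Real.rpow_natCast (wt m.1 ^ (s / 2)),
      ← Real.rpow_mul (wt_pos m.1).le]
    congr 2; push_cast; ring
  have e2 : ∀ m : Mode d, (wt m.1 ^ (-s / 2) * |y m|) ^ (2 : ℝ) = wt m.1 ^ (-s) * y m ^ 2 := by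
    intro m
    rw [Real.rpow_two, mul_pow, sq_abs, ← Real.rpow_natCast (wt m.1 ^ (-s / 2)),
      ← Real.rpow_mul (wt_pos m.1).le]
    congr 2; push_cast; ring
  have e3 : ∀ m : Mode d, wt m.1 ^ (s / 2) * |coef φ m| * (wt m.1 ^ (-s / 2) * |y m|)
      = |coef φ m * y m| := by
    intro m
    have : wt m.1 ^ (s / 2) * wt m.1 ^ (-s / 2) = 1 := by
      rw [← Real.rpow_add (wt_pos m.1)]
      have : s / 2 + -s / 2 = 0 := by ring
      rw [this, Real.rpow_zero]
    rw [abs_mul]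
    linear_combination (|coef φ m| * |y m|) * this
  have h := Real.summable_and_inner_le_Lp_mul_Lq_tsum_of_nonneg (p := 2) (q := 2)
    Real.HolderConjugate.two_two
    (f := fun m : Mode d => wt m.1 ^ (s / 2) * |coef φ m|)
    (g := fun m : Mode d => wt m.1 ^ (-s / 2) * |y m|)
    (fun m => mul_nonneg (Real.rpow_nonneg (wt_pos _).le _) (abs_nonneg _))
    (fun m => mul_nonneg (Real.rpow_nonneg (wt_pos _).le _) (abs_nonneg _))
    (by simp only [e1]; exact summable_coef_sq s φ) (by simp only [e2]; exact hy)
  simp only [e1, e2, e3] at h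
  rw [Real.sqrt_eq_rpow, Real.sqrt_eq_rpow]
  exact h

lemma abs_apply_le_of_enorm_le {a : Module.Dual ℝ (TestFun d)} {M : ℝ≥0} {φ : TestFun d}
    (h : ‖a φ‖ₑ ≤ M * sobolevNorm s φ) : |a φ| ≤ M * √(hsq s φ) := by
  rw [sobolevNorm_eq, ← ofReal_norm, ← ENNReal.ofReal_coe_nnreal,
    ← ENNReal.ofReal_mul (NNReal.coe_nonneg M)] at h
  exact (ENNReal.ofReal_le_ofReal_iff (by positivity)).mp h

lemma hsq_smul (c : ℝ) (φ : TestFun d) : hsq s (c • φ) = c ^ 2 * hsq s φ := by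
  simp only [hsq, coef_smul]
  rw [← tsum_mul_left]
  congr 1; funext m; ring

lemma abs_apply_le (a : NegSobolev d s) (φ : TestFun d) : |a.1 φ| ≤ ‖a‖ * √(hsq s φ) := by
  rcases (Real.sqrt_nonneg (hsq s φ)).eq_or_lt with h0 | h0
  -- A test function of zero `H^s` norm cannot be normalized into the unit ball; there the
  -- boundedness of `a` by some constant already forces `a φ = 0`.
  · obtain ⟨M, hM⟩ := a.2
    have := abs_apply_le_of_enorm_le (hM φ)
    rw [← h0] at this ⊢
    simpa using this
  · have hball : (√(hsq s φ))⁻¹ • φ ∈ sobolevBall d s := by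
      change sobolevNorm s _ ≤ 1
      rw [sobolevNorm_eq, hsq_smul, inv_pow, Real.sq_sqrt (hsq_nonneg s φ),
        inv_mul_cancel₀ (Real.sqrt_pos.mp h0).ne']
      simp
    have h1 : ‖(toBounded d s a) ⟨_, hball⟩‖ ≤ ‖toBounded d s a‖ :=
      lp.norm_apply_le_norm (by simp) _ _
    have h2 : |a.1 ((√(hsq s φ))⁻¹ • φ)| ≤ ‖a‖ := h1
    rw [map_smul, smul_eq_mul, abs_mul, abs_of_pos (inv_pos.mpr h0), inv_mul_le_iff₀ h0] at h2
    linarith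

lemma norm_le_of_abs_apply_le (a : NegSobolev d s) {K : ℝ} (hK : 0 ≤ K)
    (h : ∀ φ, |a.1 φ| ≤ K * √(hsq s φ)) : ‖a‖ ≤ K := by
  change ‖toBounded d s a‖ ≤ K
  refine lp.norm_le_of_forall_le hK fun φ => ?_
  refine (h φ.1).trans ?_
  have h1 : sobolevNorm s φ.1 ≤ 1 := φ.2
  rw [sobolevNorm_eq, ← ENNReal.ofReal_one, ENNReal.ofReal_le_ofReal_iff zero_le_one] at h1
  exact mul_le_of_le_one_right hK h1

lemma continuous_apply (φ : TestFun d) : Continuous fun a : NegSobolev d s => a.1 φ := by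
  refine continuous_iff_continuousAt.mpr fun a => ?_
  refine tendsto_iff_norm_sub_tendsto_zero.mpr ?_
  have h : Tendsto (fun b : NegSobolev d s => ‖b - a‖ * √(hsq s φ)) (𝓝 a) (𝓝 0) := by
    have := (tendsto_iff_norm_sub_tendsto_zero.mp (tendsto_id (x := 𝓝 a))).mul_const (√(hsq s φ))
    simpa using this
  exact squeeze_zero (fun b => norm_nonneg _) (fun b => abs_apply_le (b - a) φ) h

lemma apply_trigPoly (a : Module.Dual ℝ (TestFun d)) (N : ℕ) (y : Mode d → ℝ) :
    a (trigPoly N y) = ∑ m ∈ box d N ×ˢ Finset.univ, y m * a (mode m) := by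
  simp [trigPoly, map_sum]

lemma apply_mode_neg_cos (a : Module.Dual ℝ (TestFun d)) (k : Fin d → ℤ) :
    a (mode (-k, false)) = a (mode (k, false)) := by
  simp only [mode, cosMode_neg]

lemma apply_mode_neg_sin (a : Module.Dual ℝ (TestFun d)) (k : Fin d → ℤ) :
    a (mode (-k, true)) = -a (mode (k, true)) := by
  simp only [mode, sinMode_neg, map_neg]

lemma wt_neg (k : Fin d → ℤ) : wt (-k) = wt k := by simp [wt]

lemma exists_box_subset (S : Finset (Mode d)) : ∃ N, S ⊆ box d N ×ˢ Finset.univ :=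
  (tendsto_box.eventually_ge_atTop S).exists

/-- Duality: `a` is tested on the trigonometric polynomial with coefficients `wt ^ (-s) * a (mode
m)`. Both its image under `a` and its squared `H^s` norm equal the partial sum `T`, so `T ≤ ‖a‖ √T`.
-/
lemma sum_sq_modes_le (a : NegSobolev d s) (S : Finset (Mode d)) :
    ∑ m ∈ S, wt m.1 ^ (-s) * a.1 (mode m) ^ 2 ≤ ‖a‖ ^ 2 := by
  have h0 : ∀ m : Mode d, 0 ≤ wt m.1 ^ (-s) * a.1 (mode m) ^ 2 := fun m =>
    mul_nonneg (Real.rpow_nonneg (wt_pos _).le _) (sq_nonneg _)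
  obtain ⟨N, hN⟩ := exists_box_subset S
  refine (Finset.sum_le_sum_of_subset_of_nonneg hN fun m _ _ => h0 m).trans ?_
  set T := ∑ m ∈ box d N ×ˢ Finset.univ, wt m.1 ^ (-s) * a.1 (mode m) ^ 2 with hT
  have hT0 : 0 ≤ T := Finset.sum_nonneg fun m _ => h0 m
  let y : Mode d → ℝ := fun m => wt m.1 ^ (-s) * a.1 (mode m)
  have h1 : a.1 (trigPoly N y) = T := by
    rw [apply_trigPoly, hT]
    refine Finset.sum_congr rfl fun m _ => ?_
    simp only [y]; ring
  have h2 : hsq s (trigPoly N y) = T := by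
    have hc : ∀ m : Mode d, wt m.1 ^ s * coef (trigPoly N y) m ^ 2
        = if m ∈ box d N ×ˢ Finset.univ then wt m.1 ^ (-s) * a.1 (mode m) ^ 2 else 0 := by
      intro m
      rw [coef_trigPoly (fun k => by simp only [y, wt_neg, apply_mode_neg_cos])
        (fun k => by simp only [y, wt_neg, apply_mode_neg_sin]; ring)]
      simp only [Finset.mem_product, Finset.mem_univ, and_true]
      split_ifs
      · have : wt m.1 ^ s * wt m.1 ^ (-s) = 1 := by
          rw [← Real.rpow_add (wt_pos m.1), add_neg_cancel, Real.rpow_zero]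
        simp only [y]
        linear_combination (wt m.1 ^ (-s) * a.1 (mode m) ^ 2) * this
      · simp
    rw [hsq, hT, tsum_congr hc, tsum_eq_sum (s := box d N ×ˢ Finset.univ)]
    · exact Finset.sum_congr rfl fun m hm => by simp only [hm, if_true]
    · intro m hm; simp only [hm, if_false]
  have h3 := abs_apply_le a (trigPoly N y)
  rw [h1, h2, abs_of_nonneg hT0] at h3
  have h4 : √T ≤ ‖a‖ := by
    rcases (Real.sqrt_nonneg T).eq_or_lt with h | h
    · rw [← h]; exact norm_nonneg _
    · nlinarith [Real.sq_sqrt hT0]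
  calc T = √T ^ 2 := (Real.sq_sqrt hT0).symm
    _ ≤ ‖a‖ ^ 2 := by gcongr

lemma summable_sq_modes (a : NegSobolev d s) :
    Summable fun m : Mode d => wt m.1 ^ (-s) * a.1 (mode m) ^ 2 :=
  summable_of_sum_le (fun _ => mul_nonneg (Real.rpow_nonneg (wt_pos _).le _) (sq_nonneg _))
    (sum_sq_modes_le a)

lemma tendsto_apply_fourierSum (a : NegSobolev d s) (φ : TestFun d) :
    Tendsto (fun N => a.1 (fourierSum N φ)) atTop (𝓝 (a.1 φ)) := by
  refine tendsto_iff_norm_sub_tendsto_zero.mpr ?_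
  have h : Tendsto (fun N => ‖a‖ * √(hsq s (φ - fourierSum N φ))) atTop (𝓝 0) := by
    have := ((tendsto_hsq_sub_fourierSum s φ).sqrt).const_mul ‖a‖
    simpa using this
  refine squeeze_zero (fun _ => norm_nonneg _) (fun N => ?_) h
  rw [norm_sub_rev, ← map_sub]
  exact abs_apply_le a _

/-- Cauchy–Schwarz gives absolute convergence, and the limit along boxes, known from the density of
trigonometric polynomials, identifies the sum. -/
lemma hasSum_apply (a : NegSobolev d s) (φ : TestFun d) :
    HasSum (fun m => coef φ m * a.1 (mode m)) (a.1 φ) := by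
  have h1 := (cauchy_schwarz (summable_sq_modes a) φ).1.of_abs.hasSum
  have h2 := h1.comp tendsto_box
  have h3 := tendsto_apply_fourierSum a φ
  simp only [fourierSum, apply_trigPoly] at h3
  rwa [tendsto_nhds_unique h3 h2]

/-- The distribution with given values on the trigonometric modes. -/
def dualOfModes {y : Mode d → ℝ} (hy : Summable fun m => wt m.1 ^ (-s) * y m ^ 2) :
    Module.Dual ℝ (TestFun d) where
  toFun := fun φ => ∑' m, coef φ m * y m
  map_add' := fun φ ψ => by
    simp only [coef_add, add_mul]
    exact (cauchy_schwarz hy φ).1.of_abs.tsum_add (cauchy_schwarz hy ψ).1.of_abs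
  map_smul' := fun c φ => by
    simp only [coef_smul, mul_assoc, RingHom.id_apply, smul_eq_mul]
    exact tsum_mul_left

lemma dualOfModes_mem {y : Mode d → ℝ} (hy : Summable fun m => wt m.1 ^ (-s) * y m ^ 2) :
    dualOfModes hy ∈ negSobolevSubmodule d s := by
  refine ⟨(√(∑' m, wt m.1 ^ (-s) * y m ^ 2)).toNNReal, fun φ => ?_⟩
  have h := cauchy_schwarz hy φ
  have h2 : |dualOfModes hy φ| ≤ ∑' m, |coef φ m * y m| := abs_tsum_le h.1
  rw [sobolevNorm_eq, ← ENNReal.ofReal_coe_nnreal, Real.coe_toNNReal _ (Real.sqrt_nonneg _),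
    ← ENNReal.ofReal_mul (Real.sqrt_nonneg _), ← ofReal_norm]
  refine ENNReal.ofReal_le_ofReal ?_
  rw [mul_comm]
  exact h2.trans h.2

/-- A bounded functional as an element of `H^{-s}`. -/
def mkNegSobolev (a : Module.Dual ℝ (TestFun d)) (ha : a ∈ negSobolevSubmodule d s) :
    NegSobolev d s := ⟨a, ha⟩

open Classical in
/-- The element of `H^{-s}` with given values on the trigonometric modes. -/
def ofModes (s : ℝ) (y : Mode d → ℝ) : NegSobolev d s :=
  if hy : Summable fun m => wt m.1 ^ (-s) * y m ^ 2 then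
    mkNegSobolev (dualOfModes hy) (dualOfModes_mem hy)
  else 0

lemma ofModes_apply {y : Mode d → ℝ} (hy : Summable fun m => wt m.1 ^ (-s) * y m ^ 2)
    (φ : TestFun d) : (ofModes s y).1 φ = ∑' m, coef φ m * y m := by
  rw [ofModes, dif_pos hy]
  rfl

lemma hasSum_ofModes {y : Mode d → ℝ} (hy : Summable fun m => wt m.1 ^ (-s) * y m ^ 2)
    (φ : TestFun d) : HasSum (fun m => coef φ m * y m) ((ofModes s y).1 φ) := by
  rw [ofModes_apply hy]
  exact (cauchy_schwarz hy φ).1.of_abs.hasSum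

lemma summable_sq_sub {w y z : Mode d → ℝ} (hw : ∀ m, 0 ≤ w m)
    (hy : Summable fun m => w m * y m ^ 2)
    (hz : Summable fun m => w m * z m ^ 2) :
    Summable fun m => w m * (y m - z m) ^ 2 := by
  refine Summable.of_nonneg_of_le (fun m => mul_nonneg (hw m) (sq_nonneg _))
    (fun m => ?_) ((hy.mul_left 2).add (hz.mul_left 2))
  have := mul_nonneg (hw m) (sq_nonneg (y m + z m))
  nlinarith

lemma norm_ofModes_sub_le {y z : Mode d → ℝ} (hy : Summable fun m => wt m.1 ^ (-s) * y m ^ 2)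
    (hz : Summable fun m => wt m.1 ^ (-s) * z m ^ 2) :
    ‖ofModes s y - ofModes s z‖ ≤ √(∑' m, wt m.1 ^ (-s) * (y m - z m) ^ 2) := by
  refine norm_le_of_abs_apply_le _ (Real.sqrt_nonneg _) fun φ => ?_
  have h := cauchy_schwarz
    (summable_sq_sub (fun m => Real.rpow_nonneg (wt_pos m.1).le _) hy hz) φ
  have e : (ofModes s y - ofModes s z).1 φ = ∑' m, coef φ m * (y m - z m) := by
    rw [sub_val, ← (hasSum_ofModes hy φ).tsum_eq, ← (hasSum_ofModes hz φ).tsum_eq,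
      ← (hasSum_ofModes hy φ).summable.tsum_sub (hasSum_ofModes hz φ).summable]
    simp only [mul_sub]
  rw [e, mul_comm]
  exact (abs_tsum_le h.1).trans h.2

/-- A curve in `H^{-s}` is continuous if its modes are continuous and locally uniformly dominated
by a square summable sequence. -/
lemma continuous_ofModes {y : ℝ≥0 → Mode d → ℝ} (hc : ∀ m, Continuous fun t => y t m)
    (hb : ∀ N : ℕ, ∃ b : Mode d → ℝ, (Summable fun m => wt m.1 ^ (-s) * b m ^ 2) ∧
      ∀ t : ℝ≥0, t ≤ N → ∀ m, |y t m| ≤ b m) :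
    (∀ t, Summable fun m => wt m.1 ^ (-s) * y t m ^ 2) ∧
      Continuous fun t => ofModes s (y t) := by
  have hw : ∀ m : Mode d, 0 ≤ wt m.1 ^ (-s) := fun m => Real.rpow_nonneg (wt_pos m.1).le _
  have hsum : ∀ t, Summable fun m => wt m.1 ^ (-s) * y t m ^ 2 := by
    intro t
    obtain ⟨N, hN⟩ := exists_nat_ge t
    obtain ⟨b, hb, hyb⟩ := hb N
    refine Summable.of_nonneg_of_le (fun m => mul_nonneg (hw m) (sq_nonneg _)) (fun m => ?_) hb
    exact mul_le_mul_of_nonneg_left (sq_le_sq' (abs_le.mp (hyb t hN m)).1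
      (abs_le.mp (hyb t hN m)).2) (hw m)
  refine ⟨hsum, continuous_iff_continuousAt.mpr fun t => ?_⟩
  obtain ⟨N, hN⟩ := exists_nat_gt t
  obtain ⟨b, hb, hyb⟩ := hb N
  refine tendsto_iff_norm_sub_tendsto_zero.mpr ?_
  have h : Tendsto (fun u => √(∑' m, wt m.1 ^ (-s) * (y u m - y t m) ^ 2)) (𝓝 t) (𝓝 0) := by
    have : Tendsto (fun u => ∑' m, wt m.1 ^ (-s) * (y u m - y t m) ^ 2) (𝓝 t)
        (𝓝 (∑' _m : Mode d, (0 : ℝ))) := by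
      refine tendsto_tsum_of_dominated_convergence (hb.mul_left 4) (fun m => ?_) ?_
      · have := ((((hc m).tendsto t).sub_const (y t m)).pow 2).const_mul (wt m.1 ^ (-s))
        simpa using this
      · filter_upwards [Iio_mem_nhds hN] with u hu m
        rw [Real.norm_of_nonneg (mul_nonneg (hw m) (sq_nonneg _)), mul_left_comm]
        refine mul_le_mul_of_nonneg_left ?_ (hw m)
        have h1 := abs_le.mp (hyb u hu.le m)
        have h2 := abs_le.mp (hyb t hN.le m)
        nlinarith
    have := this.sqrt
    simpa using this
  exact squeeze_zero (fun _ => norm_nonneg _) (fun u => norm_ofModes_sub_le (hsum u) (hsum t)) h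

/-! ### Measurability -/

lemma measurable_apply (φ : TestFun d) : Measurable fun a : NegSobolev d s => a.1 φ :=
  (measurable_pi_apply φ).comp (comap_measurable _)

/-- Evaluation at a test function is the pointwise limit of evaluations at its Fourier sums, so the
countably many modes already generate the σ-algebra. -/
lemma measurable_negSobolev_iff {Ω : Type*} {mΩ : MeasurableSpace Ω} {f : Ω → NegSobolev d s} :
    Measurable f ↔ ∀ m, Measurable fun ω => (f ω).1 (mode m) := by
  refine ⟨fun hf m => (measurable_apply _).comp hf, fun h => ?_⟩
  refine measurable_comap_iff.mpr (measurable_pi_iff.mpr fun φ => ?_)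
  refine measurable_of_tendsto_metrizable (f := fun N ω => (f ω).1 (fourierSum N φ)) (fun N => ?_)
    (tendsto_pi_nhds.mpr fun ω => tendsto_apply_fourierSum _ _)
  simp only [fourierSum, apply_trigPoly]
  exact Finset.measurable_fun_sum _ fun m _ => (h m).const_mul _

/-- The values of a `1`-form on the trigonometric modes of its components. -/
def formModes (a : OneForm d s) (i : Fin d × Mode d) : ℝ := (a i.1).1 (mode i.2)

lemma measurable_oneForm_iff {Ω : Type*} {mΩ : MeasurableSpace Ω} {f : Ω → OneForm d s} :
    Measurable f ↔ ∀ i, Measurable fun ω => formModes (f ω) i := by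
  rw [measurable_pi_iff]
  simp only [measurable_negSobolev_iff, formModes]
  exact ⟨fun h i => h i.1 i.2, fun h j m => h (j, m)⟩

lemma continuous_formModes (i : Fin d × Mode d) :
    Continuous fun a : OneForm d s => formModes a i :=
  (continuous_apply _).comp (_root_.continuous_apply i.1)

lemma negSobolev_isDistribution (a : NegSobolev d s) : IsDistribution a.1 := by
  obtain ⟨n, M, hM, h⟩ := exists_hsq_le d s
  refine ⟨n, ‖a‖ * M, fun φ K hK => (abs_apply_le a φ).trans ?_⟩
  rw [mul_assoc]
  exact mul_le_mul_of_nonneg_left (h φ K hK) (norm_nonneg _)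

end AbelianYM

end

noncomputable section

namespace AbelianYM

variable {d : ℕ} {s : ℝ}

/-! ### Gauge equivalence in Fourier coordinates -/

/-- The modes of a pure gauge `1`-form: vanishing curl, and holonomies in `2πℤ`. -/
def GaugeTrivial (z : Fin d × Mode d → ℝ) : Prop :=
  (∀ j, ∃ n : ℤ, z (j, (0, false)) = 2 * Real.pi * n) ∧
    ∀ i j (m : Mode d), (m.1 i : ℝ) * z (j, m) = m.1 j * z (i, m)

/-- The increment lies in `2πℤ` and depends continuously on `x`; on a connected space it is
constant. -/
lemma periodic_increment {θ : (Fin d → ℝ) → ℝ} (hθ : Continuous θ)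
    (hp : ∀ (k : Fin d → ℤ) (x : Fin d → ℝ),
      Complex.exp (Complex.I * θ (x + fun i => (k i : ℝ))) = Complex.exp (Complex.I * θ x))
    (k : Fin d → ℤ) : ∃ n : ℤ, ∀ x, θ (x + fun i => (k i : ℝ)) = θ x + 2 * Real.pi * n := by
  have h : ∀ x, ∃ n : ℤ, θ (x + fun i => (k i : ℝ)) = θ x + 2 * Real.pi * n := by
    intro x
    obtain ⟨n, hn⟩ := Complex.exp_eq_exp_iff_exists_int.mp (hp k x)
    refine ⟨n, ?_⟩
    have : Complex.I * ((θ (x + fun i => (k i : ℝ)) : ℝ) : ℂ)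
        = Complex.I * ((θ x + 2 * Real.pi * n : ℝ) : ℂ) := by
      rw [hn]; push_cast; ring
    exact_mod_cast mul_left_cancel₀ Complex.I_ne_zero this
  choose n hn using h
  have hc : Continuous n := by
    rw [Int.isClosedEmbedding_coe_real.isInducing.continuous_iff]
    have : ((↑) : ℤ → ℝ) ∘ n = fun x => (θ (x + fun i => (k i : ℝ)) - θ x) / (2 * Real.pi) := by
      funext x
      have := hn x
      simp only [Function.comp_apply]
      field_simp
      linarith
    rw [this]
    fun_prop
  refine ⟨n 0, fun x => ?_⟩
  rw [hn x, PreconnectedSpace.constant inferInstance hc (x := x) (y := 0)]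

/-- A gauge transformation is the sum of a linear function and of a periodic one. -/
lemma exists_periodic_part {θ : (Fin d → ℝ) → ℝ} (hθ : ContDiff ℝ (⊤ : ℕ∞) θ)
    (hp : ∀ (k : Fin d → ℤ) (x : Fin d → ℝ),
      Complex.exp (Complex.I * θ (x + fun i => (k i : ℝ))) = Complex.exp (Complex.I * θ x)) :
    ∃ (n : Fin d → ℤ) (ψ : TestFun d), ∀ x, θ x = ψ.1 x + phase n x := by
  choose n hn using periodic_increment hθ.continuous hp
  have hadd : ∀ k l, n (k + l) = n k + n l := by
    intro k l
    have h1 := hn (k + l) 0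
    have h2 := hn k 0
    have h3 := hn l (0 + fun i => (k i : ℝ))
    have e : (0 : Fin d → ℝ) + (fun i => (k i : ℝ)) + (fun i => (l i : ℝ))
        = 0 + fun i => (((k + l) i : ℤ) : ℝ) := by
      funext i; simp
    rw [e, h1, h2] at h3
    have : (2 * Real.pi) * (n (k + l) : ℝ) = (2 * Real.pi) * ((n k : ℝ) + n l) := by linarith
    exact_mod_cast mul_left_cancel₀ Real.two_pi_pos.ne' this
  -- The winding number is additive in the lattice vector, hence given by its values on the unit
  -- vectors. Subtracting the linear phase with these values leaves a periodic function.
  let f : (Fin d → ℤ) →+ ℤ := AddMonoidHom.mk' n hadd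
  have hf : ∀ k, n k = ∑ j, n (Pi.single j 1) * k j := by
    intro k
    have h1 : f k = ∑ j, f (Pi.single j (k j)) := by
      rw [← map_sum, Finset.univ_sum_single]
    have h2 : ∀ j, f (Pi.single j (k j)) = f (Pi.single j 1) * k j := by
      intro j
      have : (Pi.single j (k j) : Fin d → ℤ) = (k j) • Pi.single j 1 := by
        rw [← Pi.single_smul]; simp
      rw [this, map_zsmul, smul_eq_mul, mul_comm]
    exact h1.trans (Finset.sum_congr rfl fun j _ => h2 j)
  refine ⟨fun j => n (Pi.single j 1), ⟨fun x => θ x - phase (fun j => n (Pi.single j 1)) x,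
    hθ.sub (contDiff_phase _), fun k x => ?_⟩, fun x => by simp⟩
  beta_reduce
  rw [hn, phase_add_int, ← hf]
  ring

lemma coef_zero (φ : TestFun d) : coef φ (0, false) = torusInt φ.1 := by
  simp only [coef, ip, mode, cosMode_zero]
  congr 1; funext x; exact one_mul _

lemma partialD_one (j : Fin d) : partialD j (TestFun.one d) = 0 := by
  rw [← cosMode_zero, partialD_cosMode]
  simp

/-- The difference is the constant form `2πn` plus the differential of a periodic distribution. The
mean of the latter vanishes, and at frequency `k` its `j`-th component is `k j` times a quantity
independent of `j`, so its curl is zero. -/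
lemma gaugeTrivial_of_gaugeEquiv {a b : OneForm d s} (h : GaugeEquiv a b) :
    GaugeTrivial fun i => formModes a i - formModes b i := by
  obtain ⟨θ, hθ, hp, η, -, h⟩ := h
  obtain ⟨n, ψ, hψ⟩ := exists_periodic_part hθ hp
  have hfd : ∀ j x, fderiv ℝ θ x (Pi.single j 1)
      = (partialD j ψ).1 x + 2 * Real.pi * n j := by
    intro j x
    have : θ = fun x => ψ.1 x + phase n x := funext hψ
    rw [this, fderiv_fun_add (differentiable_testFun ψ x)
      ((contDiff_phase n).differentiable (by simp) x), add_apply, hasFDerivAt_phase]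
    rfl
  -- The smooth periodic part `ψ` of the gauge transformation is absorbed into the distribution,
  -- acting through the `L²` product; only the winding remains separate.
  have key : ∀ j φ, (a j).1 φ - (b j).1 φ
      = 2 * Real.pi * n j * coef φ (0, false) - (ipₗ ψ + η) (partialD j φ) := by
    intro j φ
    rw [h j φ, coef_zero]
    simp only [hfd, add_mul]
    rw [torusInt_add (continuous_mul_testFun _ _)
      ((continuous_testFun φ).const_mul _), torusInt_const_mul]
    have : (torusInt fun x => (partialD j ψ).1 x * φ.1 x) = -ip ψ (partialD j φ) := by
      rw [ip_partialD, neg_neg]; rfl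
    rw [this, LinearMap.add_apply]
    change _ = _ - (ip ψ (partialD j φ) + _)
    ring
  refine ⟨fun j => ⟨n j, ?_⟩, fun i j m => ?_⟩
  · change (a j).1 (mode (0, false)) - (b j).1 (mode (0, false)) = _
    rw [key]
    have : mode (0, false) = TestFun.one d := cosMode_zero
    rw [this, partialD_one, map_zero, coef_zero]
    have : torusInt (TestFun.one d).1 = 1 := torusInt_const (1 : ℝ)
    rw [this]; ring
  · change (m.1 i : ℝ) * ((a j).1 (mode m) - (b j).1 (mode m))
      = m.1 j * ((a i).1 (mode m) - (b i).1 (mode m))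
    rw [key, key]
    obtain ⟨k, _ | _⟩ := m
    · simp only [mode, partialD_cosMode, map_smul, smul_eq_mul]
      have : coef (cosMode k) (0, false) = if k = 0 then 1 else 0 := by
        rw [coef_zero, torusInt_cosMode]
      rw [this]
      split_ifs with hk
      · subst hk; simp
      · ring
    · simp only [mode, partialD_sinMode, map_smul, smul_eq_mul]
      have : coef (sinMode k) (0, false) = 0 := by
        rw [coef_zero, torusInt_sinMode]
      rw [this]
      ring

/-- The square `|k|²` of a frequency. -/
def freqSq (k : Fin d → ℤ) : ℝ := ∑ j, (k j : ℝ) ^ 2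

lemma one_le_freqSq {k : Fin d → ℤ} (hk : k ≠ 0) : 1 ≤ freqSq k := by
  obtain ⟨j, hj⟩ := Function.ne_iff.mp hk
  have h1 : (1 : ℝ) ≤ (k j : ℝ) ^ 2 := by
    have : (1 : ℤ) ≤ k j ^ 2 := by
      have hj' : k j ≠ 0 := hj
      have : 0 < k j ^ 2 := by positivity
      omega
    exact_mod_cast this
  exact h1.trans (Finset.single_le_sum (f := fun j => (k j : ℝ) ^ 2) (fun _ _ => sq_nonneg _)
    (Finset.mem_univ j))

/-- The modes of a potential of the curl-free form with modes `z`. -/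
def potential (z : Fin d × Mode d → ℝ) : Mode d → ℝ
  | (k, false) => -(∑ j, (k j : ℝ) * z (j, (k, true))) / (2 * Real.pi * freqSq k)
  | (k, true) => (∑ j, (k j : ℝ) * z (j, (k, false))) / (2 * Real.pi * freqSq k)

/-- By Cauchy–Schwarz `|k·z| / |k|² ≤ |z| / |k|`, so the potential is no rougher than the form. At
`k = 0` the quotient is `0` by the convention for division. -/
lemma sq_div_freqSq_le (k : Fin d → ℤ) (z : Fin d → ℝ) :
    ((∑ j, (k j : ℝ) * z j) / (2 * Real.pi * freqSq k)) ^ 2 ≤ ∑ j, z j ^ 2 := by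
  by_cases hk : k = 0
  · subst hk
    simpa using Finset.sum_nonneg fun j _ => sq_nonneg (z j)
  · have h1 := one_le_freqSq hk
    have h2 : (∑ j, (k j : ℝ) * z j) ^ 2 ≤ freqSq k * ∑ j, z j ^ 2 :=
      Finset.sum_mul_sq_le_sq_mul_sq _ _ _
    have h3 : 0 ≤ ∑ j, z j ^ 2 := Finset.sum_nonneg fun j _ => sq_nonneg (z j)
    have hpi : 1 ≤ 2 * Real.pi := by linarith [Real.pi_gt_three]
    rw [div_pow, div_le_iff₀ (by positivity)]
    refine h2.trans ?_
    rw [mul_comm]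
    refine mul_le_mul_of_nonneg_left ?_ h3
    have : freqSq k ≤ 2 * Real.pi * freqSq k := le_mul_of_one_le_left (by linarith) hpi
    nlinarith

lemma summable_potential {z : Fin d × Mode d → ℝ}
    (hz : ∀ j, Summable fun m : Mode d => wt m.1 ^ (-s) * z (j, m) ^ 2) :
    Summable fun m : Mode d => wt m.1 ^ (-s) * potential z m ^ 2 := by
  have hw : ∀ k : Fin d → ℤ, 0 ≤ wt k ^ (-s) := fun k => Real.rpow_nonneg (wt_pos k).le _
  have h1 : Summable fun m : Mode d => ∑ j, wt m.1 ^ (-s) * z (j, m) ^ 2 :=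
    summable_sum fun j _ => hz j
  have h2 := (summable_mode_iff fun m =>
    Finset.sum_nonneg fun j _ => mul_nonneg (hw m.1) (sq_nonneg _)).mp h1
  refine (summable_mode_iff fun m => mul_nonneg (hw m.1) (sq_nonneg _)).mpr
    (Summable.of_nonneg_of_le (fun k => ?_) (fun k => ?_) h2)
  · exact add_nonneg (mul_nonneg (hw k) (sq_nonneg _)) (mul_nonneg (hw k) (sq_nonneg _))
  · rw [add_comm (∑ j, _)]
    simp only [← Finset.mul_sum]
    refine add_le_add (mul_le_mul_of_nonneg_left ?_ (hw k)) (mul_le_mul_of_nonneg_left ?_ (hw k))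
    · simp only [potential, neg_div, neg_sq]
      exact sq_div_freqSq_le k _
    · exact sq_div_freqSq_le k _

/-- Hodge theory on the torus: the linear phase with winding `n` accounts for the mean, and the
potential for all other frequencies, because vanishing curl gives `k_j (k·z) = |k|² z_j`. -/
lemma gaugeEquiv_of_gaugeTrivial {a b : OneForm d s}
    (h : GaugeTrivial fun i => formModes a i - formModes b i) : GaugeEquiv a b := by
  obtain ⟨hn, hcurl⟩ := h
  choose n hn using hn
  set z : Fin d × Mode d → ℝ := fun i => formModes a i - formModes b i with hzdef
  have hz : ∀ j, Summable fun m : Mode d => wt m.1 ^ (-s) * z (j, m) ^ 2 := fun j =>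
    summable_sq_modes (a j - b j)
  have hpot := summable_potential hz
  refine ⟨phase n, contDiff_phase n, fun k x => ?_, (ofModes s (potential z)).1,
    negSobolev_isDistribution _, fun j φ => ?_⟩
  · rw [phase_add_int]
    refine Complex.exp_eq_exp_iff_exists_int.mpr ⟨∑ i, n i * k i, ?_⟩
    push_cast
    ring
  · have h1 : HasSum (fun m => coef φ m * z (j, m)) ((a j - b j).1 φ) := hasSum_apply (a j - b j) φ
    have h2 := hasSum_ofModes hpot (partialD j φ)
    have h3 := h1.add h2
    have h4 : (torusInt fun x => fderiv ℝ (phase n) x (Pi.single j 1) * φ.1 x)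
        = z (j, (0, false)) * coef φ (0, false) := by
      simp only [hasFDerivAt_phase]
      rw [torusInt_const_mul, coef_zero, hn j]
    have h5 : (a j - b j).1 φ + (ofModes s (potential z)).1 (partialD j φ)
        = z (j, (0, false)) * coef φ (0, false) := by
      -- At each nonzero frequency the sine and cosine terms of the potential cancel those of `a j -
      -- b j`; only the mean survives.
      rw [← h3.tsum_eq, tsum_mode h3.summable, tsum_eq_single 0]
      · have h0 : z (j, (0, true)) = 0 := by
          simp only [hzdef, formModes, mode, sinMode_zero, map_zero, sub_zero]
        rw [h0, coef_partialD_cos, coef_partialD_sin]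
        simp only [Pi.zero_apply, Int.cast_zero]
        ring
      · intro k hk
        have hk1 := one_le_freqSq hk
        have hc : ∀ b, (k j : ℝ) * ∑ i, (k i : ℝ) * z (i, (k, b)) = freqSq k * z (j, (k, b)) := by
          intro b
          rw [freqSq, Finset.mul_sum, Finset.sum_mul]
          refine Finset.sum_congr rfl fun i _ => ?_
          have := hcurl i j (k, b)
          dsimp only at this
          linear_combination (-(k i : ℝ)) * this
        have e1 : 2 * Real.pi * k j * potential z (k, false) = -z (j, (k, true)) := by
          simp only [potential]
          rw [mul_div_assoc', div_eq_iff (by positivity)]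
          linear_combination (-(2 * Real.pi)) * hc true
        have e2 : 2 * Real.pi * k j * potential z (k, true) = z (j, (k, false)) := by
          simp only [potential]
          rw [mul_div_assoc', div_eq_iff (by positivity)]
          linear_combination (2 * Real.pi) * hc false
        rw [coef_partialD_cos, coef_partialD_sin]
        linear_combination coef φ (k, true) * e1 - coef φ (k, false) * e2
    rw [h4]
    rw [sub_val] at h5
    linarith

lemma gaugeEquiv_iff {a b : OneForm d s} :
    GaugeEquiv a b ↔ GaugeTrivial fun i => formModes a i - formModes b i :=
  ⟨gaugeTrivial_of_gaugeEquiv, gaugeEquiv_of_gaugeTrivial⟩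

/-- The set `2πℤ` is closed and the curl condition is linear, so convergence of each mode suffices.
This carries gauge equivalence to left limits at jump times. -/
lemma GaugeTrivial.of_tendsto {ι : Type*} {l : Filter ι} [l.NeBot] {z : ι → Fin d × Mode d → ℝ}
    {w : Fin d × Mode d → ℝ} (hz : ∀ᶠ t in l, GaugeTrivial (z t))
    (h : ∀ i, Tendsto (fun t => z t i) l (𝓝 (w i))) : GaugeTrivial w := by
  refine ⟨fun j => ?_, fun i j m => ?_⟩
  · have hcl : IsClosed (Set.range fun n : ℤ => 2 * Real.pi * (n : ℝ)) := by
      have : Topology.IsClosedEmbedding fun n : ℤ => 2 * Real.pi * (n : ℝ) :=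
        (Homeomorph.mulLeft₀ _ Real.two_pi_pos.ne').isClosedEmbedding.comp
          Int.isClosedEmbedding_coe_real
      exact this.isClosed_range
    obtain ⟨n, hn⟩ := hcl.mem_of_tendsto (h (j, (0, false))) (by
      filter_upwards [hz] with t ht
      obtain ⟨n, hn⟩ := ht.1 j
      exact ⟨n, hn.symm⟩)
    exact ⟨n, hn.symm⟩
  · refine tendsto_nhds_unique ((h (j, m)).const_mul _) (((h (i, m)).const_mul _).congr' ?_)
    filter_upwards [hz] with t ht
    exact (ht.2 i j m).symm

lemma eigen_zero (b : Bool) : eigen ((0, b) : Mode d) = 0 := by simp [eigen]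

/-- The factor depends on the frequency but not on the component, so the curl condition survives; it
is `1` at frequency zero, so the holonomies are unchanged. The second point is what a nonzero mass
destroys. -/
lemma GaugeTrivial.heat {z : Fin d × Mode d → ℝ} (hz : GaugeTrivial z) (t : ℝ) :
    GaugeTrivial fun i => Real.exp (-eigen i.2 * t) * z i := by
  refine ⟨fun j => ?_, fun i j m => ?_⟩
  · obtain ⟨n, hn⟩ := hz.1 j
    exact ⟨n, by simp [eigen_zero, hn]⟩
  · have := hz.2 i j m
    dsimp only
    linear_combination Real.exp (-eigen m * t) * this

lemma observable_eq [NeZero d] {a b : OneForm d s} (h : GaugeEquiv a b) :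
    observable a = observable b := by
  obtain ⟨n, hn⟩ := (gaugeTrivial_of_gaugeEquiv h).1 0
  simp only [formModes, mode, cosMode_zero] at hn
  refine Complex.exp_eq_exp_iff_exists_int.mpr ⟨n, ?_⟩
  have : (a 0).1 (TestFun.one d) = (b 0).1 (TestFun.one d) + 2 * Real.pi * n := by linarith
  rw [this]; push_cast; ring

lemma formModes_constForm (c : Fin d → ℝ) (j : Fin d) (m : Mode d) :
    formModes (constForm d s c) (j, m) = c j * torusInt (mode m).1 :=
  torusInt_const_mul (c j) (mode m).1

lemma formModes_zero (i : Fin d × Mode d) : formModes (0 : OneForm d s) i = 0 := rfl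

lemma gaugeEquiv_zero_constForm [NeZero d] :
    GaugeEquiv (0 : OneForm d s) (constForm d s (Pi.single 0 (2 * Real.pi))) := by
  refine gaugeEquiv_of_gaugeTrivial ⟨fun j => ?_, fun i j m => ?_⟩
  · simp only [formModes_constForm, formModes_zero, mode, torusInt_cosMode, if_true]
    by_cases hj : j = 0
    · subst hj; exact ⟨-1, by simp⟩
    · exact ⟨0, by simp [hj]⟩
  · simp only [formModes_constForm, formModes_zero]
    obtain ⟨k, _ | _⟩ := m
    · simp only [mode, torusInt_cosMode]
      split_ifs with hk
      · subst hk; simp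
      · simp
    · simp only [mode, torusInt_sinMode]; simp

end AbelianYM

end

noncomputable section

namespace AbelianYM

/-! ### Linear equations with additive noise -/

/-- Multiplied by `exp (-κ t)`, the right-hand side has zero right derivative. Only integrability of
`f` is assumed, since the lemma is applied to differences involving càdlàg paths; the equation
itself then yields continuity. -/
lemma exp_of_integral_eq {f : ℝ → ℝ} {u T c κ : ℝ} (huT : u ≤ T)
    (hf : IntervalIntegrable f volume u T)
    (h : ∀ t ∈ Set.Icc u T, f t = c + κ * ∫ r in u..t, f r) :
    ∀ t ∈ Set.Icc u T, f t = c * Real.exp (κ * (t - u)) := by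
  have hF : ContinuousOn (fun t => ∫ r in u..t, f r) (Set.Icc u T) := by
    rw [← Set.uIcc_of_le huT]
    exact intervalIntegral.continuousOn_primitive_interval'
      hf Set.left_mem_uIcc
  have hfc : ContinuousOn f (Set.Icc u T) :=
    (continuousOn_const.add (continuousOn_const.mul hF)).congr h
  let G : ℝ → ℝ := fun t => Real.exp (-κ * t) * (c + κ * ∫ r in u..t, f r)
  have hG : ∀ t ∈ Set.Icc u T, G t = G u := by
    refine constant_of_has_deriv_right_zero ?_ fun x hx => ?_
    · exact (by fun_prop : Continuous fun t => Real.exp (-κ * t)).continuousOn.mul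
        (continuousOn_const.add (continuousOn_const.mul hF))
    · have hx' : x ∈ Set.Icc u T := ⟨hx.1, hx.2.le⟩
      have hux : IntervalIntegrable f volume u x :=
        hf.mono_set (by
          rw [Set.uIcc_of_le hx.1, Set.uIcc_of_le huT]
          exact Set.Icc_subset_Icc_right hx.2.le)
      have hnhds : Set.Icc u T ∈ 𝓝[>] x :=
        mem_of_superset (Ioo_mem_nhdsGT hx.2)
          fun z hz => ⟨hx.1.trans hz.1.le, hz.2.le⟩
      have hnhds' : Set.Icc u T ∈ 𝓝[≥] x :=
        mem_of_superset (Ico_mem_nhdsGE hx.2)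
          fun z hz => ⟨hx.1.trans hz.1, hz.2.le⟩
      have h1 : HasDerivWithinAt (fun t => ∫ r in u..t, f r) (f x) (Set.Ici x) x := by
        refine intervalIntegral.integral_hasDerivWithinAt_right hux
          ⟨Set.Icc u T, hnhds, hfc.aestronglyMeasurable measurableSet_Icc⟩ ?_
        exact ((hfc x hx').mono_of_mem_nhdsWithin hnhds').mono Set.Ioi_subset_Ici_self
      have h2 : HasDerivWithinAt (fun t => Real.exp (-κ * t)) (Real.exp (-κ * x) * (-κ * 1))
          (Set.Ici x) x := (((hasDerivAt_id x).const_mul (-κ)).exp).hasDerivWithinAt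
      have h3 := h2.mul ((h1.const_mul κ).const_add c)
      refine h3.congr_deriv ?_
      rw [h x hx']
      ring
  intro t ht
  have h1 := hG t ht
  simp only [G, intervalIntegral.integral_same, mul_zero, add_zero] at h1
  rw [← h t ht] at h1
  have h2 : Real.exp (κ * t) * Real.exp (-κ * t) = 1 := by
    rw [← Real.exp_add]; simp
  have h3 : Real.exp (κ * t) * Real.exp (-κ * u) = Real.exp (κ * (t - u)) := by
    rw [← Real.exp_add]; congr 1; ring
  rw [← h3]
  linear_combination Real.exp (κ * t) * h1 - f t * h2

/-- A version of the path `w` stopped at `t` that is jointly measurable, as it depends on `w` only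
through the values at rational times; it agrees with `w` on `[0, t]` if `w` is continuous. -/
def regPath (t : ℝ≥0) (w : ℝ≥0 → ℝ) (r : ℝ) : ℝ :=
  limsup (fun n : ℕ => w (min ((⌊(n : ℝ) * r⌋₊ : ℝ≥0) / n) t)) atTop

/-- The solution of `y(t) = y₀ - μ ∫₀ᵗ y + w(t)`. -/
def ou (μ y₀ : ℝ) (w : ℝ≥0 → ℝ) (t : ℝ≥0) : ℝ :=
  w t + Real.exp (-μ * t) * (y₀ - μ * ∫ r in (0 : ℝ)..t, Real.exp (μ * r) * regPath t w r)

lemma regPath_eq {w : ℝ≥0 → ℝ} (hw : Continuous w) {t : ℝ≥0} {r : ℝ} (hr : r ∈ Set.Icc (0 : ℝ) t) :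
    regPath t w r = w r.toNNReal := by
  refine Tendsto.limsup_eq ?_
  have h1 : Tendsto (fun n : ℕ => (⌊(n : ℝ) * r⌋₊ : ℝ≥0) / n) atTop (𝓝 r.toNNReal) := by
    rw [← NNReal.tendsto_coe]
    have := (tendsto_nat_floor_mul_div_atTop hr.1).comp tendsto_natCast_atTop_atTop
    rw [Real.coe_toNNReal _ hr.1]
    refine this.congr fun n => ?_
    simp [mul_comm]
  have h2 : min r.toNNReal t = r.toNNReal := min_eq_left (Real.toNNReal_le_iff_le_coe.mpr hr.2)
  have h3 := h1.min (tendsto_const_nhds (x := t))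
  rw [h2] at h3
  exact (hw.tendsto _).comp h3

lemma ou_eq_of_continuous {w : ℝ≥0 → ℝ} (hw : Continuous w) (μ y₀ : ℝ) (t : ℝ≥0) :
    ou μ y₀ w t = w t + Real.exp (-μ * t) *
      (y₀ - μ * ∫ r in (0 : ℝ)..t, Real.exp (μ * r) * w r.toNNReal) := by
  rw [ou]
  congr 4
  refine intervalIntegral.integral_congr fun r hr => ?_
  rw [Set.uIcc_of_le t.coe_nonneg] at hr
  simp only [regPath_eq hw hr]

lemma ou_add (μ y₀ : ℝ) (w : ℝ≥0 → ℝ) (t : ℝ≥0) :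
    ou μ y₀ w t = Real.exp (-μ * t) * y₀ + ou μ 0 w t := by
  simp only [ou]; ring

/-- Measurability is required only at times up to `t`, so the lemma also yields adaptedness when
`mΩ` is the σ-algebra of the past. Joint measurability in time and `ω` holds because the
approximations in `regPath` factor through an integer. -/
lemma measurable_ou {Ω : Type*} {mΩ : MeasurableSpace Ω} {w : ℝ≥0 → Ω → ℝ} {t : ℝ≥0}
    (hw : ∀ r ≤ t, Measurable (w r)) (μ y₀ : ℝ) :
    Measurable fun ω => ou μ y₀ (fun r => w r ω) t := by
  have hreg : Measurable fun p : ℝ × Ω => regPath t (fun r => w r p.2) p.1 := by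
    refine Measurable.limsup fun n => ?_
    let g : ℕ × Ω → ℝ := fun q => w (min ((q.1 : ℝ≥0) / n) t) q.2
    have h1 : Measurable g := by
      refine measurable_from_prod_countable_right fun k => ?_
      exact hw (min ((k : ℝ≥0) / n) t) (min_le_right _ _)
    have h2 : Measurable fun p : ℝ × Ω => (⌊(n : ℝ) * p.1⌋₊, p.2) :=
      (Nat.measurable_floor.comp (measurable_fst.const_mul _)).prodMk measurable_snd
    change Measurable (g ∘ fun p : ℝ × Ω => (⌊(n : ℝ) * p.1⌋₊, p.2))
    exact h1.comp h2
  have hint : Measurable fun ω => ∫ r in (0 : ℝ)..t,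
      Real.exp (μ * r) * regPath t (fun r => w r ω) r := by
    have h3 : StronglyMeasurable fun p : Ω × ℝ =>
        Real.exp (μ * p.2) * regPath t (fun r => w r p.1) p.2 :=
      ((by fun_prop : Measurable fun p : Ω × ℝ => Real.exp (μ * p.2)).mul
        (hreg.comp measurable_swap)).stronglyMeasurable
    simp only [intervalIntegral.integral_of_le t.coe_nonneg]
    exact (h3.integral_prod_right (ν := volume.restrict (Set.Ioc (0 : ℝ) t))).measurable
  exact (hw t le_rfl).add (((hint.const_mul μ).const_sub y₀).const_mul _)

lemma continuous_ou {w : ℝ≥0 → ℝ} (hw : Continuous w) (μ y₀ : ℝ) : Continuous (ou μ y₀ w) := by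
  have h : ou μ y₀ w = fun t : ℝ≥0 => w t + Real.exp (-μ * t) *
      (y₀ - μ * ∫ r in (0 : ℝ)..t, Real.exp (μ * r) * w r.toNNReal) :=
    funext (ou_eq_of_continuous hw μ y₀)
  have hc : Continuous fun r : ℝ => Real.exp (μ * r) * w r.toNNReal :=
    (by fun_prop : Continuous fun r : ℝ => Real.exp (μ * r)).mul
      (hw.comp continuous_real_toNNReal)
  have h1 : Continuous fun t : ℝ => ∫ r in (0 : ℝ)..t, Real.exp (μ * r) * w r.toNNReal :=
    intervalIntegral.continuous_primitive (fun a b => hc.intervalIntegrable a b) 0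
  rw [h]
  have h2 : Continuous fun t : ℝ≥0 => ∫ r in (0 : ℝ)..t, Real.exp (μ * r) * w r.toNNReal :=
    h1.comp NNReal.continuous_coe
  fun_prop

/-- The difference `v = ou - w` satisfies the classical equation `v' = -μ (w + v)`. The noise is
never differentiated and no stochastic integral is needed. -/
lemma ou_equation {w : ℝ≥0 → ℝ} (hw : Continuous w) (μ y₀ : ℝ) (t : ℝ≥0) :
    ou μ y₀ w t = y₀ + (∫ r in (0 : ℝ)..t, -μ * ou μ y₀ w r.toNNReal) + w t := by
  let W : ℝ → ℝ := fun r => w r.toNNReal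
  have hW : Continuous W := hw.comp continuous_real_toNNReal
  have hc : Continuous fun r : ℝ => Real.exp (μ * r) * W r :=
    (by fun_prop : Continuous fun r : ℝ => Real.exp (μ * r)).mul hW
  let v : ℝ → ℝ := fun t => Real.exp (-μ * t) * (y₀ - μ * ∫ r in (0 : ℝ)..t, Real.exp (μ * r) * W r)
  have hv : ∀ r, HasDerivAt v (-μ * (W r + v r)) r := by
    intro r
    have h1 : HasDerivAt (fun t => ∫ r in (0 : ℝ)..t, Real.exp (μ * r) * W r)
        (Real.exp (μ * r) * W r) r :=
      (hc.integral_hasStrictDerivAt 0 r).hasDerivAt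
    have h2 : HasDerivAt (fun t => Real.exp (-μ * t)) (Real.exp (-μ * r) * (-μ * 1)) r :=
      ((hasDerivAt_id r).const_mul (-μ)).exp
    have h3 := h2.mul ((h1.const_mul μ).const_sub y₀)
    refine h3.congr_deriv ?_
    have h4 : Real.exp (-μ * r) * Real.exp (μ * r) = 1 := by
      rw [← Real.exp_add]; simp
    simp only [v]
    linear_combination (-(μ * W r)) * h4
  have hou : ∀ r : ℝ, 0 ≤ r → ou μ y₀ w r.toNNReal = W r + v r := by
    intro r hr
    rw [ou_eq_of_continuous hw]
    simp only [W, v, Real.coe_toNNReal r hr]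
  have hvc : Continuous v := continuous_iff_continuousAt.mpr fun r => (hv r).continuousAt
  have h5 : ∫ r in (0 : ℝ)..t, -μ * ou μ y₀ w r.toNNReal = v t - v 0 := by
    rw [← intervalIntegral.integral_eq_sub_of_hasDerivAt (fun r _ => hv r)
      ((continuous_const.mul (hW.add hvc)).intervalIntegrable _ _)]
    refine intervalIntegral.integral_congr fun r hr => ?_
    rw [Set.uIcc_of_le t.coe_nonneg] at hr
    simp only [hou r hr.1]
  have h6 := hou t t.coe_nonneg
  rw [Real.toNNReal_coe] at h6
  rw [h5, h6]
  simp [v, W]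
  ring

/-- Uniqueness for the equation solved by `ou`. -/
lemma eq_ou_of_equation {w y : ℝ≥0 → ℝ} (hw : Continuous w) (hy : Continuous y) {μ y₀ : ℝ}
    (h : ∀ t : ℝ≥0, y t = y₀ + (∫ r in (0 : ℝ)..t, -μ * y r.toNNReal) + w t) (t : ℝ≥0) :
    y t = ou μ y₀ w t := by
  let D : ℝ → ℝ := fun r => y r.toNNReal - ou μ y₀ w r.toNNReal
  have hyc : Continuous fun r : ℝ => y r.toNNReal := hy.comp continuous_real_toNNReal
  have hoc : Continuous fun r : ℝ => ou μ y₀ w r.toNNReal :=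
    (continuous_ou hw μ y₀).comp continuous_real_toNNReal
  have hD : Continuous D := hyc.sub hoc
  have key := exp_of_integral_eq (f := D) (u := 0) (T := t) (c := 0) (κ := -μ) t.coe_nonneg
    (hD.intervalIntegrable _ _) (fun r hr => by
      have h1 := h r.toNNReal
      have h2 := ou_equation hw μ y₀ r.toNNReal
      rw [Real.coe_toNNReal r hr.1] at h1 h2
      simp only [D]
      rw [intervalIntegral.integral_sub (hyc.intervalIntegrable _ _)
        (hoc.intervalIntegrable _ _)]
      rw [intervalIntegral.integral_const_mul] at h1 h2
      linarith) t ⟨t.coe_nonneg, le_rfl⟩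
  simp only [D, Real.toNNReal_coe, zero_mul] at key
  linarith

/-- The flow property. -/
lemma ou_add_time {w : ℝ≥0 → ℝ} (hw : Continuous w) (μ y₀ : ℝ) (t u : ℝ≥0) :
    ou μ y₀ w (t + u) = ou μ (ou μ y₀ w t) (fun r => w (t + r) - w t) u := by
  have hc := continuous_ou hw μ y₀
  refine eq_ou_of_equation (y := fun u => ou μ y₀ w (t + u)) (by fun_prop) (by fun_prop)
    (fun u => ?_) u
  have h1 := ou_equation hw μ y₀ (t + u)
  have h2 := ou_equation hw μ y₀ t
  have hcR : Continuous fun r : ℝ => -μ * ou μ y₀ w r.toNNReal :=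
    continuous_const.mul (hc.comp continuous_real_toNNReal)
  have h3 : ∫ r in (0 : ℝ)..u, -μ * ou μ y₀ w (t + r.toNNReal)
      = ∫ r in (t : ℝ)..(t + u : ℝ), -μ * ou μ y₀ w r.toNNReal := by
    have := intervalIntegral.integral_comp_add_left
      (a := 0) (b := (u : ℝ)) (fun r : ℝ => -μ * ou μ y₀ w r.toNNReal) (t : ℝ)
    rw [add_zero] at this
    rw [← this]
    refine intervalIntegral.integral_congr fun r hr => ?_
    rw [Set.uIcc_of_le u.coe_nonneg] at hr
    rw [Real.toNNReal_add t.coe_nonneg hr.1, Real.toNNReal_coe]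
  have h4 := intervalIntegral.integral_add_adjacent_intervals (μ := volume)
    (hcR.intervalIntegrable 0 (t : ℝ)) (hcR.intervalIntegrable (t : ℝ) (t + u : ℝ))
  push_cast at h1
  rw [h3, h1, h2, ← h4]
  ring

/-! ### Smallness of strongly damped solutions -/

lemma rpow_le_mul_one_add {κ γ u : ℝ} (hκ : 0 < κ) (h0 : 0 < γ) (h1 : γ ≤ 1) (hu : 0 ≤ u) :
    u ^ γ ≤ κ ^ (-γ) * (1 + κ * u) := by
  have hx : 0 ≤ κ * u := by positivity
  have h2 : (κ * u) ^ γ ≤ 1 + κ * u := by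
    rcases le_total (κ * u) 1 with h | h
    · exact (Real.rpow_le_one hx h h0.le).trans (by linarith)
    · calc (κ * u) ^ γ ≤ (κ * u) ^ (1 : ℝ) := Real.rpow_le_rpow_of_exponent_le h h1
        _ ≤ 1 + κ * u := by rw [Real.rpow_one]; linarith
  have h3 : u ^ γ = κ ^ (-γ) * (κ * u) ^ γ := by
    rw [Real.mul_rpow hκ.le hu, ← mul_assoc, ← Real.rpow_add hκ, neg_add_cancel, Real.rpow_zero,
      one_mul]
  rw [h3]
  gcongr

/-- An explicit antiderivative takes the value `2` at the upper end and a nonnegative value at the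
lower end; the bound is uniform in the damping rate. -/
lemma integral_exp_mul_one_add_le {κ t : ℝ} (hκ : 0 < κ) (ht : 0 ≤ t) :
    ∫ r in (0 : ℝ)..t, κ * (Real.exp (-κ * (t - r)) * (1 + κ * (t - r))) ≤ 2 := by
  have hd : ∀ r, HasDerivAt (fun r => Real.exp (-κ * (t - r)) * (2 + κ * (t - r)))
      (κ * (Real.exp (-κ * (t - r)) * (1 + κ * (t - r)))) r := by
    intro r
    have h1 : HasDerivAt (fun r => t - r) (-1) r := by
      simpa using (hasDerivAt_id r).const_sub t
    have h2 := ((h1.const_mul (-κ)).exp).mul ((h1.const_mul κ).const_add 2)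
    refine h2.congr_deriv ?_
    ring
  rw [intervalIntegral.integral_eq_sub_of_hasDerivAt (fun r _ => hd r)
    (Continuous.intervalIntegrable (by fun_prop) _ _)]
  simp only [sub_self, mul_zero, Real.exp_zero, sub_zero, add_zero, one_mul]
  have : 0 ≤ Real.exp (-κ * t) * (2 + κ * t) := by positivity
  linarith

/-- If the driving path is Hölder continuous then the solution with strong damping is small. -/
lemma abs_ou_le {w : ℝ≥0 → ℝ} (hw : Continuous w) (hw0 : w 0 = 0) {T : ℝ≥0} {γ K : ℝ}
    (hγ0 : 0 < γ) (hγ1 : γ ≤ 1) (hK0 : 0 ≤ K)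
    (hK : ∀ r t : ℝ≥0, r ≤ t → t ≤ T → |w t - w r| ≤ K * (t - r : ℝ) ^ γ)
    {κ C : ℝ} (hκ : 1 ≤ κ) {t : ℝ≥0} (ht : t ≤ T) :
    |ou (κ - 1 - C) 0 w t|
      ≤ Real.exp ((1 + |C|) * T) * (5 + 2 * |C|) * K * κ ^ (-γ) := by
  set μ := κ - 1 - C with hμ
  set E := Real.exp ((1 + |C|) * T) with hE
  have hκ0 : 0 < κ := by linarith
  have hKγ : 0 < κ ^ (-γ) := Real.rpow_pos_of_pos hκ0 _
  have hEp : 0 < E := Real.exp_pos _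
  have htT : (t : ℝ) ≤ T := by exact_mod_cast ht
  -- The actual rate is `κ - 1 - C`, possibly negative. Up to time `T` its exponential is compared
  -- with that of `κ ≥ 1` at the cost of the factor `E`.
  have hexp : ∀ u : ℝ, 0 ≤ u → u ≤ t → Real.exp (-μ * u) ≤ E * Real.exp (-κ * u) := by
    intro u hu hut
    rw [hE, ← Real.exp_add]
    refine Real.exp_le_exp.mpr ?_
    have h1 : (1 + C) * u ≤ (1 + |C|) * T :=
      mul_le_mul (by linarith [le_abs_self C]) (hut.trans htT) hu (by positivity)
    rw [hμ]; linarith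
  have hw' : ∀ r : ℝ, r ∈ Set.Icc (0 : ℝ) t →
      |w t - w r.toNNReal| ≤ K * (κ ^ (-γ) * (1 + κ * (t - r))) := by
    intro r hr
    have h1 := hK r.toNNReal t (Real.toNNReal_le_iff_le_coe.mpr hr.2) ht
    rw [Real.coe_toNNReal _ hr.1] at h1
    exact h1.trans (mul_le_mul_of_nonneg_left
      (rpow_le_mul_one_add hκ0 hγ0 hγ1 (by linarith [hr.2])) hK0)
  have hwc : Continuous fun r : ℝ => w r.toNNReal := hw.comp continuous_real_toNNReal
  have hI : ∫ r in (0 : ℝ)..t, μ * Real.exp (-μ * (t - r)) = 1 - Real.exp (-μ * t) := by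
    have hd : ∀ r, HasDerivAt (fun r => Real.exp (-μ * (t - r)))
        (μ * Real.exp (-μ * (t - r))) r := by
      intro r
      have h1 : HasDerivAt (fun r => (t : ℝ) - r) (-1) r := by
        simpa using (hasDerivAt_id r).const_sub (t : ℝ)
      refine (h1.const_mul (-μ)).exp.congr_deriv ?_
      ring
    rw [intervalIntegral.integral_eq_sub_of_hasDerivAt (fun r _ => hd r)
      (Continuous.intervalIntegrable (by fun_prop) _ _)]
    simp
  -- Only increments of `w` from time `t` enter the convolution. The kernel has width about `1 / κ`,
  -- so Hölder continuity yields the gain `κ ^ (-γ)`. The final constant is `1 + 2 (2 + |C|)`, from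
  -- the boundary term and the integral.
  have hou : ou μ 0 w t = Real.exp (-μ * t) * w t
      + ∫ r in (0 : ℝ)..t, μ * Real.exp (-μ * (t - r)) * (w t - w r.toNNReal) := by
    rw [ou_eq_of_continuous hw]
    have h3 : ∀ r : ℝ, μ * Real.exp (-μ * (t - r)) * (w t - w r.toNNReal)
        = μ * Real.exp (-μ * (t - r)) * w t - μ * Real.exp (-μ * (t - r)) * w r.toNNReal :=
      fun r => mul_sub _ _ _
    simp only [h3]
    rw [intervalIntegral.integral_sub (Continuous.intervalIntegrable (by fun_prop) _ _)
      (Continuous.intervalIntegrable (by fun_prop) _ _), intervalIntegral.integral_mul_const, hI]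
    have h2 : ∫ r in (0 : ℝ)..t, μ * Real.exp (-μ * (t - r)) * w r.toNNReal
        = Real.exp (-μ * t) * (μ * ∫ r in (0 : ℝ)..t, Real.exp (μ * r) * w r.toNNReal) := by
      rw [← intervalIntegral.integral_const_mul, ← intervalIntegral.integral_const_mul]
      refine intervalIntegral.integral_congr fun r _ => ?_
      rw [show -μ * (t - r) = -μ * t + μ * r by ring, Real.exp_add]
      ring
    rw [h2]
    ring
  have hμκ : |μ| ≤ (2 + |C|) * κ := by
    have h1 : |μ| ≤ (κ - 1) + |C| := by
      rw [hμ]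
      refine (abs_sub _ _).trans ?_
      rw [abs_of_nonneg (by linarith : (0 : ℝ) ≤ κ - 1)]
    nlinarith [abs_nonneg C]
  have h1 : |Real.exp (-μ * t) * w t| ≤ E * K * κ ^ (-γ) := by
    have h2 := hw' 0 ⟨le_rfl, t.coe_nonneg⟩
    rw [Real.toNNReal_zero, hw0, sub_zero, sub_zero] at h2
    have h3 := hexp t t.coe_nonneg le_rfl
    have h4 : Real.exp (-κ * t) * (1 + κ * t) ≤ 1 := by
      have h5 : 1 + κ * t ≤ Real.exp (κ * t) := by linarith [Real.add_one_le_exp (κ * t)]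
      calc Real.exp (-κ * t) * (1 + κ * t) ≤ Real.exp (-κ * t) * Real.exp (κ * t) := by gcongr
        _ = 1 := by rw [← Real.exp_add]; simp
    rw [abs_mul, Real.abs_exp]
    calc Real.exp (-μ * t) * |w t|
        ≤ (E * Real.exp (-κ * t)) * (K * (κ ^ (-γ) * (1 + κ * t))) := by gcongr
      _ = E * K * κ ^ (-γ) * (Real.exp (-κ * t) * (1 + κ * t)) := by ring
      _ ≤ E * K * κ ^ (-γ) * 1 := by gcongr
      _ = _ := by ring
  have h2 : |∫ r in (0 : ℝ)..t, μ * Real.exp (-μ * (t - r)) * (w t - w r.toNNReal)|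
      ≤ (2 + |C|) * E * K * κ ^ (-γ) * 2 := by
    calc |∫ r in (0 : ℝ)..t, μ * Real.exp (-μ * (t - r)) * (w t - w r.toNNReal)|
        ≤ ∫ r in (0 : ℝ)..t, |μ * Real.exp (-μ * (t - r)) * (w t - w r.toNNReal)| :=
          intervalIntegral.abs_integral_le_integral_abs t.coe_nonneg
      _ ≤ ∫ r in (0 : ℝ)..t, (2 + |C|) * E * K * κ ^ (-γ) *
            (κ * (Real.exp (-κ * (t - r)) * (1 + κ * (t - r)))) := by
          refine intervalIntegral.integral_mono_on t.coe_nonneg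
            (Continuous.intervalIntegrable (by fun_prop) _ _)
            (Continuous.intervalIntegrable (by fun_prop) _ _) fun r hr => ?_
          rw [abs_mul, abs_mul, Real.abs_exp]
          have h3 := hexp (t - r) (by linarith [hr.2]) (by linarith [hr.1])
          calc |μ| * Real.exp (-μ * (t - r)) * |w t - w r.toNNReal|
              ≤ ((2 + |C|) * κ) * (E * Real.exp (-κ * (t - r)))
                  * (K * (κ ^ (-γ) * (1 + κ * (t - r)))) := by
                gcongr
                exact hw' r hr
            _ = _ := by ring
      _ = (2 + |C|) * E * K * κ ^ (-γ) *
            ∫ r in (0 : ℝ)..t, κ * (Real.exp (-κ * (t - r)) * (1 + κ * (t - r))) := by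
          rw [intervalIntegral.integral_const_mul]
      _ ≤ _ := by
          gcongr
          exact integral_exp_mul_one_add_le hκ0 t.coe_nonneg
  rw [hou]
  calc |Real.exp (-μ * t) * w t
        + ∫ r in (0 : ℝ)..t, μ * Real.exp (-μ * (t - r)) * (w t - w r.toNNReal)|
      ≤ E * K * κ ^ (-γ) + (2 + |C|) * E * K * κ ^ (-γ) * 2 := (abs_add_le _ _).trans (add_le_add h1 h2)
    _ = _ := by ring

end AbelianYM

end

noncomputable section

namespace AbelianYM

/-! ### Hölder continuity of processes with Gaussian increments -/

/-- The dyadic point `i / 2^n`. -/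
def dyadic (n i : ℕ) : ℝ≥0 := i / 2 ^ n

/-- The largest dyadic point of level `n` that does not exceed `t`. -/
def dyadicFloor (n : ℕ) (t : ℝ≥0) : ℝ≥0 := dyadic n ⌊(2 : ℝ≥0) ^ n * t⌋₊

lemma dyadicFloor_le (n : ℕ) (t : ℝ≥0) : dyadicFloor n t ≤ t := by
  rw [dyadicFloor, dyadic, div_le_iff₀ (by positivity), mul_comm]
  exact Nat.floor_le (by positivity)

lemma lt_dyadicFloor_add (n : ℕ) (t : ℝ≥0) : t < dyadicFloor n t + (1 / 2 ^ n : ℝ≥0) := by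
  rw [dyadicFloor, dyadic, ← add_div, lt_div_iff₀ (by positivity), mul_comm]
  exact Nat.lt_floor_add_one _

lemma tendsto_dyadicFloor (t : ℝ≥0) : Tendsto (fun n => dyadicFloor n t) atTop (𝓝 t) := by
  rw [← NNReal.tendsto_coe]
  have h : Tendsto (fun n : ℕ => (t : ℝ) - (1 / 2) ^ n) atTop (𝓝 t) := by
    simpa using (tendsto_pow_atTop_nhds_zero_of_lt_one (by norm_num : (0 : ℝ) ≤ 1 / 2)
      (by norm_num)).const_sub (t : ℝ)
  refine tendsto_of_tendsto_of_tendsto_of_le_of_le h tendsto_const_nhds (fun n => ?_) fun n => ?_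
  · have h1 : (t : ℝ) < dyadicFloor n t + 1 / 2 ^ n := by exact_mod_cast lt_dyadicFloor_add n t
    simp only [one_div, inv_pow] at h1 ⊢
    linarith
  · exact_mod_cast dyadicFloor_le n t

lemma floor_succ (n : ℕ) (t : ℝ≥0) :
    ⌊(2 : ℝ≥0) ^ (n + 1) * t⌋₊ = 2 * ⌊(2 : ℝ≥0) ^ n * t⌋₊ ∨
      ⌊(2 : ℝ≥0) ^ (n + 1) * t⌋₊ = 2 * ⌊(2 : ℝ≥0) ^ n * t⌋₊ + 1 := by
  set k := ⌊(2 : ℝ≥0) ^ n * t⌋₊ with hk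
  have h1 : (k : ℝ≥0) ≤ 2 ^ n * t := Nat.floor_le (by positivity)
  have h2 : (2 : ℝ≥0) ^ n * t < k + 1 := Nat.lt_floor_add_one _
  have h3 : (2 : ℝ≥0) ^ (n + 1) * t = 2 * (2 ^ n * t) := by ring
  have h4 : 2 * k ≤ ⌊(2 : ℝ≥0) ^ (n + 1) * t⌋₊ := by
    rw [Nat.le_floor_iff (by positivity), h3]
    push_cast
    gcongr
  have h5 : ⌊(2 : ℝ≥0) ^ (n + 1) * t⌋₊ < 2 * k + 2 := by
    rw [Nat.floor_lt (by positivity), h3]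
    push_cast
    calc (2 : ℝ≥0) * (2 ^ n * t) < 2 * (k + 1) := by gcongr
      _ = 2 * k + 2 := by ring
  omega

/-- Dyadic increments of `f` on `[0, N]` at level `n` are at most `K ρ^n`. -/
def DyadicBound (f : ℝ≥0 → ℝ) (N : ℕ) (K ρ : ℝ) : Prop :=
  ∀ n i : ℕ, i < N * 2 ^ n → |f (dyadic n (i + 1)) - f (dyadic n i)| ≤ K * ρ ^ n

lemma floor_le_of_le {t : ℝ≥0} {N : ℕ} (ht : t ≤ N) (n : ℕ) : ⌊(2 : ℝ≥0) ^ n * t⌋₊ ≤ N * 2 ^ n := by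
  refine Nat.floor_le_of_le ?_
  push_cast
  rw [mul_comm]
  gcongr

/-- Two consecutive dyadic approximations of `t` coincide or are neighbours at the finer level, so
at most one dyadic increment is used per level. -/
lemma DyadicBound.floor_succ_sub_le {f : ℝ≥0 → ℝ} {N : ℕ} {K ρ : ℝ} (h : DyadicBound f N K ρ)
    (hK : 0 ≤ K) (hρ0 : 0 ≤ ρ) (hρ : ρ ≤ 1) {t : ℝ≥0} (ht : t ≤ N) (n : ℕ) :
    dist (f (dyadicFloor n t)) (f (dyadicFloor (n + 1) t)) ≤ K * ρ ^ n := by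
  have h0 : dyadicFloor n t = dyadic (n + 1) (2 * ⌊(2 : ℝ≥0) ^ n * t⌋₊) := by
    rw [dyadicFloor, dyadic, dyadic, pow_succ]
    push_cast
    field_simp
  rcases floor_succ n t with h1 | h1
  · rw [h0, dyadicFloor, h1, dist_self]
    positivity
  · have h2 := floor_le_of_le ht (n + 1)
    rw [h1] at h2
    rw [h0, dyadicFloor, h1, dist_comm, Real.dist_eq]
    refine (h (n + 1) _ (by omega)).trans ?_
    exact mul_le_mul_of_nonneg_left (pow_le_pow_of_le_one hρ0 hρ (Nat.le_succ n)) hK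

lemma DyadicBound.exists_tendsto {f : ℝ≥0 → ℝ} {N : ℕ} {K ρ : ℝ} (h : DyadicBound f N K ρ)
    (hK : 0 ≤ K) (hρ0 : 0 ≤ ρ) (hρ : ρ < 1) {t : ℝ≥0} (ht : t ≤ N) :
    ∃ l, Tendsto (fun n => f (dyadicFloor n t)) atTop (𝓝 l) :=
  cauchySeq_tendsto_of_complete
    (cauchySeq_of_le_geometric ρ K hρ fun n => h.floor_succ_sub_le hK hρ0 hρ.le ht n)

lemma DyadicBound.abs_sub_le_steps {f : ℝ≥0 → ℝ} {N : ℕ} {K ρ : ℝ} (h : DyadicBound f N K ρ)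
    (n i k : ℕ) (hik : i + k ≤ N * 2 ^ n) :
    |f (dyadic n (i + k)) - f (dyadic n i)| ≤ k * (K * ρ ^ n) := by
  induction k with
  | zero => simp
  | succ k ih =>
    have h1 := ih (by omega)
    have h2 := h n (i + k) (by omega)
    calc |f (dyadic n (i + (k + 1))) - f (dyadic n i)|
        ≤ |f (dyadic n (i + k + 1)) - f (dyadic n (i + k))|
          + |f (dyadic n (i + k)) - f (dyadic n i)| := abs_sub_le _ _ _
      _ ≤ K * ρ ^ n + k * (K * ρ ^ n) := add_le_add h2 h1
      _ = _ := by push_cast; ring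

/-- Chaining: each endpoint is joined to its level-`n` approximation by a geometric series, and the
two approximations are at most `k + 1` dyadic steps apart. -/
lemma DyadicBound.abs_sub_le_level {f g : ℝ≥0 → ℝ} {N : ℕ} {K ρ : ℝ} (h : DyadicBound f N K ρ)
    (hK : 0 ≤ K) (hρ0 : 0 ≤ ρ) (hρ : ρ < 1)
    (hg : ∀ t ≤ (N : ℝ≥0), Tendsto (fun n => f (dyadicFloor n t)) atTop (𝓝 (g t)))
    {r t : ℝ≥0} (hrt : r ≤ t) (ht : t ≤ N) (n k : ℕ) (hk : 2 ^ n * (t - r : ℝ) ≤ k) :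
    |g t - g r| ≤ (k + 1 + 2 / (1 - ρ)) * K * ρ ^ n := by
  have h1 := dist_le_of_le_geometric_of_tendsto ρ K hρ
    (fun n => h.floor_succ_sub_le hK hρ0 hρ.le ht n) (hg t ht) n
  have h2 := dist_le_of_le_geometric_of_tendsto ρ K hρ
    (fun n => h.floor_succ_sub_le hK hρ0 hρ.le (hrt.trans ht) n) (hg r (hrt.trans ht)) n
  set i := ⌊(2 : ℝ≥0) ^ n * r⌋₊
  set j := ⌊(2 : ℝ≥0) ^ n * t⌋₊
  have hij : i ≤ j := Nat.floor_mono (by gcongr)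
  have hj : (j : ℝ) ≤ 2 ^ n * t := by
    have h : (j : ℝ≥0) ≤ 2 ^ n * t := Nat.floor_le (by positivity)
    exact_mod_cast h
  have hi : (2 : ℝ) ^ n * r < i + 1 := by
    have h : (2 : ℝ≥0) ^ n * r < i + 1 := Nat.lt_floor_add_one _
    exact_mod_cast h
  have hjk : j - i ≤ k + 1 := by
    have : (j : ℝ) < i + (k + 1) := by linarith
    have : j < i + (k + 1) := by exact_mod_cast this
    omega
  have h3 := h.abs_sub_le_steps n i (j - i) (by
    rw [Nat.add_sub_cancel' hij]; exact floor_le_of_le ht n)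
  rw [Nat.add_sub_cancel' hij] at h3
  have h4 : |f (dyadicFloor n t) - f (dyadicFloor n r)| ≤ (k + 1) * (K * ρ ^ n) := by
    refine h3.trans (mul_le_mul_of_nonneg_right (by exact_mod_cast hjk) (by positivity))
  rw [Real.dist_eq] at h1 h2
  rw [abs_sub_comm] at h1
  calc |g t - g r| ≤ |g t - f (dyadicFloor n t)| + |f (dyadicFloor n t) - f (dyadicFloor n r)|
        + |f (dyadicFloor n r) - g r| := by
        have := abs_add_three (g t - f (dyadicFloor n t))
          (f (dyadicFloor n t) - f (dyadicFloor n r)) (f (dyadicFloor n r) - g r)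
        refine le_trans (le_of_eq ?_) this
        congr 1; ring
    _ ≤ K * ρ ^ n / (1 - ρ) + (k + 1) * (K * ρ ^ n) + K * ρ ^ n / (1 - ρ) :=
        add_le_add (add_le_add h1 h4) h2
    _ = _ := by
        have : 1 - ρ ≠ 0 := by linarith
        field_simp
        ring

/-- The constant of the chaining estimate. -/
def holderFactor (γ : ℝ) (N : ℕ) : ℝ := 2 * (N + 2 + 2 / (1 - (2 : ℝ) ^ (-γ)))

lemma two_rpow_neg_lt_one {γ : ℝ} (hγ : 0 < γ) : (2 : ℝ) ^ (-γ) < 1 :=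
  Real.rpow_lt_one_of_one_lt_of_neg (by norm_num) (by linarith)

lemma holderFactor_nonneg {γ : ℝ} (hγ : 0 < γ) (N : ℕ) : 0 ≤ holderFactor γ N := by
  have := two_rpow_neg_lt_one hγ
  have : 0 < 1 - (2 : ℝ) ^ (-γ) := by linarith
  unfold holderFactor
  positivity

/-- For increments of length at most `1`, the level is chosen by `2^(-n-1) < t - r ≤ 2^(-n)`; the
factor `2` in `holderFactor` comes from `2^(-γ n) ≤ 2 (t - r)^γ`, which uses `γ ≤ 1`. For longer
increments level `0` and `N` unit steps suffice, whence the dependence on `N`. -/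
lemma DyadicBound.holder {f g : ℝ≥0 → ℝ} {N : ℕ} {K γ : ℝ} (hγ0 : 0 < γ) (hγ1 : γ ≤ 1)
    (h : DyadicBound f N K (2 ^ (-γ))) (hK : 0 ≤ K)
    (hg : ∀ t ≤ (N : ℝ≥0), Tendsto (fun n => f (dyadicFloor n t)) atTop (𝓝 (g t)))
    {r t : ℝ≥0} (hrt : r ≤ t) (ht : t ≤ N) :
    |g t - g r| ≤ holderFactor γ N * K * (t - r : ℝ) ^ γ := by
  have hρ := two_rpow_neg_lt_one hγ0
  have hρ0 : (0 : ℝ) ≤ 2 ^ (-γ) := by positivity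
  have hρ1 : 0 < 1 - (2 : ℝ) ^ (-γ) := by linarith
  rcases hrt.eq_or_lt with rfl | hlt
  · have : (0 : ℝ) ≤ ((r : ℝ) - r) ^ γ := by simp [Real.zero_rpow hγ0.ne']
    have h2 := holderFactor_nonneg hγ0 N
    simp only [sub_self, abs_zero]
    positivity
  have hpos : (0 : ℝ) < t - r := by
    have : (r : ℝ) < t := by exact_mod_cast hlt
    linarith
  rcases le_or_gt (t - r : ℝ) 1 with h1 | h1
  · obtain ⟨n, hn1, hn2⟩ := exists_nat_pow_near_of_lt_one hpos h1 (by norm_num : (0 : ℝ) < 1 / 2)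
      (by norm_num)
    have h2 := h.abs_sub_le_level hK hρ0 hρ hg hrt ht n 1 (by
      have : (2 : ℝ) ^ n * (1 / 2) ^ n = 1 := by rw [← mul_pow]; norm_num
      calc (2 : ℝ) ^ n * (t - r) ≤ 2 ^ n * (1 / 2) ^ n := by gcongr
        _ = ((1 : ℕ) : ℝ) := by rw [this]; norm_num)
    have h3 : ((2 : ℝ) ^ (-γ)) ^ n ≤ 2 * (t - r : ℝ) ^ γ := by
      have h4 : ((1 / 2 : ℝ) ^ (n + 1)) ^ γ ≤ (t - r : ℝ) ^ γ :=
        Real.rpow_le_rpow (by positivity) hn1.le hγ0.le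
      have h5 : ((1 / 2 : ℝ) ^ (n + 1)) ^ γ = ((2 : ℝ) ^ (-γ)) ^ (n + 1) := by
        rw [← Real.rpow_natCast, ← Real.rpow_natCast, ← Real.rpow_mul (by norm_num),
          ← Real.rpow_mul (by norm_num), one_div, Real.inv_rpow (by norm_num),
          ← Real.rpow_neg (by norm_num)]
        congr 1; ring
      have h6 : (1 : ℝ) ≤ 2 * 2 ^ (-γ) := by
        have : (2 : ℝ) * 2 ^ (-γ) = 2 ^ (1 - γ) := by
          rw [sub_eq_add_neg, Real.rpow_add (by norm_num), Real.rpow_one]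
        rw [this]
        exact Real.one_le_rpow (by norm_num) (by linarith)
      rw [h5, pow_succ] at h4
      have h7 : 0 ≤ ((2 : ℝ) ^ (-γ)) ^ n := by positivity
      nlinarith
    refine h2.trans ?_
    have h8 : (0 : ℝ) ≤ (t - r : ℝ) ^ γ := by positivity
    calc (((1 : ℕ) : ℝ) + 1 + 2 / (1 - 2 ^ (-γ))) * K * ((2 : ℝ) ^ (-γ)) ^ n
        ≤ ((1 : ℕ) + 1 + 2 / (1 - 2 ^ (-γ))) * K * (2 * (t - r : ℝ) ^ γ) := by gcongr
      _ = (2 * (2 + 2 / (1 - 2 ^ (-γ)))) * K * (t - r : ℝ) ^ γ := by push_cast; ring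
      _ ≤ holderFactor γ N * K * (t - r : ℝ) ^ γ := by
          unfold holderFactor
          gcongr
          linarith [(Nat.cast_nonneg N : (0 : ℝ) ≤ N)]
  · have h2 := h.abs_sub_le_level hK hρ0 hρ hg hrt ht 0 N (by
      have : (t : ℝ) ≤ N := by exact_mod_cast ht
      rw [pow_zero, one_mul]
      linarith [r.coe_nonneg])
    have h3 : 1 ≤ (t - r : ℝ) ^ γ := Real.one_le_rpow h1.le hγ0.le
    have h4 : 0 ≤ ((N : ℝ) + 1 + 2 / (1 - 2 ^ (-γ))) * K := by positivity
    rw [pow_zero, mul_one] at h2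
    refine h2.trans ?_
    calc ((N : ℝ) + 1 + 2 / (1 - 2 ^ (-γ))) * K
        ≤ ((N : ℝ) + 1 + 2 / (1 - 2 ^ (-γ))) * K * (t - r : ℝ) ^ γ := le_mul_of_one_le_right h4 h3
      _ ≤ holderFactor γ N * K * (t - r : ℝ) ^ γ := by
          have : 0 ≤ (2 : ℝ) / (1 - 2 ^ (-γ)) := by positivity
          unfold holderFactor
          gcongr
          linarith [(Nat.cast_nonneg N : (0 : ℝ) ≤ N)]

/-! ### Moments of the dyadic constant of Gaussian paths -/

/-- The best constant in the dyadic estimate with exponent `γ` on `[0, N]`. -/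
def dyadicConst (γ : ℝ) (N : ℕ) (f : ℝ≥0 → ℝ) : ℝ≥0∞ :=
  ⨆ (n : ℕ) (i : Fin (N * 2 ^ n)),
    ENNReal.ofReal (2 ^ (γ * n)) * ‖f (dyadic n (i + 1)) - f (dyadic n i)‖ₑ

lemma dyadicBound_of_dyadicConst_ne_top {γ : ℝ} {N : ℕ} {f : ℝ≥0 → ℝ} (h : dyadicConst γ N f ≠ ∞) :
    DyadicBound f N (dyadicConst γ N f).toReal (2 ^ (-γ)) := by
  intro n i hi
  have h1 : ENNReal.ofReal (2 ^ (γ * n)) * ‖f (dyadic n (i + 1)) - f (dyadic n i)‖ₑ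
      ≤ dyadicConst γ N f :=
    le_iSup₂_of_le n (⟨i, hi⟩ : Fin (N * 2 ^ n)) le_rfl
  have h2 := ENNReal.toReal_mono h h1
  rw [ENNReal.toReal_mul, ENNReal.toReal_ofReal (by positivity), toReal_enorm, Real.norm_eq_abs]
    at h2
  have h3 : ((2 : ℝ) ^ (-γ)) ^ n = (2 ^ (γ * n))⁻¹ := by
    rw [← Real.rpow_natCast, ← Real.rpow_mul (by norm_num), ← Real.rpow_neg (by norm_num)]
    congr 1; ring
  rw [h3, ← div_eq_mul_inv, le_div_iff₀ (by positivity), mul_comm]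
  exact h2

/-- Increments are centred Gaussian variables whose variance is at most `c` times the length of
the time interval. -/
def HasGaussianIncrements {Ω : Type*} {mΩ : MeasurableSpace Ω} (P : Measure Ω) (c : ℝ≥0)
    (B : ℝ≥0 → Ω → ℝ) : Prop :=
  ∀ t u, t ≤ u → ∃ v : ℝ≥0, v ≤ c * (u - t) ∧ HasLaw (fun ω => B u ω - B t ω) (gaussianReal 0 v) P

/-- The `p`-th moment of the standard normal law. -/
def gaussianMoment (p : ℕ) : ℝ≥0∞ := ∫⁻ x, ‖x‖ₑ ^ p ∂(gaussianReal 0 1)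

lemma gaussianMoment_ne_top (p : ℕ) : gaussianMoment p ≠ ∞ := by
  rcases Nat.eq_zero_or_pos p with rfl | hp
  · simp [gaussianMoment]
  · have h := memLp_id_gaussianReal (μ := 0) (v := 1) (p : ℝ≥0)
    have h1 := lintegral_rpow_enorm_lt_top_of_eLpNorm_lt_top (by simpa using hp.ne') (by simp) h.2
    simpa [gaussianMoment] using h1.ne

lemma lintegral_enorm_pow_gaussianReal (v : ℝ≥0) (p : ℕ) :
    ∫⁻ x, ‖x‖ₑ ^ p ∂(gaussianReal 0 v) = (NNReal.sqrt v : ℝ≥0∞) ^ p * gaussianMoment p := by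
  have h : gaussianReal 0 v = (gaussianReal 0 1).map (fun x => (NNReal.sqrt v : ℝ) * x) := by
    rw [gaussianReal_map_const_mul]
    congr 1
    · simp
    · ext; simp
  rw [h, lintegral_map (by fun_prop) (by fun_prop), gaussianMoment,
    ← lintegral_const_mul _ (by fun_prop)]
  refine lintegral_congr fun x => ?_
  rw [enorm_mul, mul_pow, Real.enorm_eq_ofReal (NNReal.coe_nonneg _), ENNReal.ofReal_coe_nnreal]

lemma HasGaussianIncrements.lintegral_pow_le {Ω : Type*} {mΩ : MeasurableSpace Ω} {P : Measure Ω}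
    {c : ℝ≥0} {B : ℝ≥0 → Ω → ℝ} (hB : HasGaussianIncrements P c B) (p : ℕ) {t u : ℝ≥0}
    (htu : t ≤ u) :
    ∫⁻ ω, ‖B u ω - B t ω‖ₑ ^ p ∂P ≤ (NNReal.sqrt (c * (u - t)) : ℝ≥0∞) ^ p * gaussianMoment p := by
  obtain ⟨v, hv, hl⟩ := hB t u htu
  have h1 : ∫⁻ ω, ‖B u ω - B t ω‖ₑ ^ p ∂P = ∫⁻ x, ‖x‖ₑ ^ p ∂(gaussianReal 0 v) := by
    rw [← hl.map_eq, lintegral_map' (by fun_prop) hl.aemeasurable]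
  rw [h1, lintegral_enorm_pow_gaussianReal]
  gcongr

lemma dyadic_mono {n i j : ℕ} (h : i ≤ j) : dyadic n i ≤ dyadic n j := by
  unfold dyadic; gcongr

lemma dyadic_succ_sub (n i : ℕ) : dyadic n (i + 1) - dyadic n i = 1 / 2 ^ n := by
  refine tsub_eq_of_eq_add ?_
  unfold dyadic
  push_cast
  ring

lemma HasGaussianIncrements.aemeasurable {Ω : Type*} {mΩ : MeasurableSpace Ω} {P : Measure Ω}
    {c : ℝ≥0} {B : ℝ≥0 → Ω → ℝ} (hB : HasGaussianIncrements P c B) {t u : ℝ≥0}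
    (htu : t ≤ u) : AEMeasurable (fun ω => B u ω - B t ω) P := by
  obtain ⟨v, -, hl⟩ := hB t u htu
  exact hl.aemeasurable

/-- From `x² ≤ 1 + x^p` for `p ≥ 2`, the supremum is dominated by a series of `p`-th powers. Only
second moments are needed later, but summation over dyadic levels requires a high moment. -/
lemma dyadicConst_sq_le (γ : ℝ) (N : ℕ) (f : ℝ≥0 → ℝ) {p : ℕ} (hp : 2 ≤ p) :
    dyadicConst γ N f ^ 2 ≤ 1 + ∑' n : ℕ, ∑ i : Fin (N * 2 ^ n),
      ENNReal.ofReal (2 ^ (γ * n)) ^ p * ‖f (dyadic n (i + 1)) - f (dyadic n i)‖ₑ ^ p := by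
  set R := 1 + ∑' n : ℕ, ∑ i : Fin (N * 2 ^ n),
      ENNReal.ofReal (2 ^ (γ * n)) ^ p * ‖f (dyadic n (i + 1)) - f (dyadic n i)‖ₑ ^ p with hR
  have h1 : dyadicConst γ N f ≤ R ^ (1 / 2 : ℝ) := by
    refine iSup₂_le fun n i => ?_
    set x := ENNReal.ofReal (2 ^ (γ * n)) * ‖f (dyadic n (i + 1)) - f (dyadic n i)‖ₑ with hx
    have h2 : x ^ p ≤ ∑' n : ℕ, ∑ i : Fin (N * 2 ^ n),
        ENNReal.ofReal (2 ^ (γ * n)) ^ p * ‖f (dyadic n (i + 1)) - f (dyadic n i)‖ₑ ^ p := by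
      refine le_trans ?_ (ENNReal.le_tsum n)
      rw [hx, mul_pow]
      exact Finset.single_le_sum (f := fun i : Fin (N * 2 ^ n) =>
        ENNReal.ofReal (2 ^ (γ * n)) ^ p * ‖f (dyadic n (i + 1)) - f (dyadic n i)‖ₑ ^ p)
        (fun _ _ => zero_le) (Finset.mem_univ i)
    have h3 : x ^ 2 ≤ R := by
      rcases le_total x 1 with h | h
      · exact (pow_le_one₀ zero_le h).trans le_self_add
      · exact ((pow_le_pow_right₀ h hp).trans h2).trans le_add_self
    have h4 := ENNReal.rpow_le_rpow h3 (show (0 : ℝ) ≤ 1 / 2 by norm_num)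
    rwa [← ENNReal.rpow_natCast, ← ENNReal.rpow_mul, show ((2 : ℕ) : ℝ) * (1 / 2) = 1 by norm_num,
      ENNReal.rpow_one] at h4
  calc dyadicConst γ N f ^ 2 ≤ (R ^ (1 / 2 : ℝ)) ^ 2 := by gcongr
    _ = R := by
      rw [← ENNReal.rpow_natCast, ← ENNReal.rpow_mul]
      norm_num

/-- The second moment of the dyadic constant is bounded uniformly over all processes. -/
lemma exists_lintegral_dyadicConst_sq_le {γ : ℝ} (hγ : γ < 1 / 2) (c : ℝ≥0) (N : ℕ) :
    ∃ M : ℝ≥0∞, M ≠ ∞ ∧ ∀ (Ω : Type) (_mΩ : MeasurableSpace Ω) (P : Measure Ω) (B : ℝ≥0 → Ω → ℝ),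
      IsProbabilityMeasure P → HasGaussianIncrements P c B →
        ∫⁻ ω, dyadicConst γ N (fun t => B t ω) ^ 2 ∂P ≤ M := by
  -- At level `n` there are `N 2^n` increments with `p`-th moment of order `2^(-np/2)` and weight
  -- `2^(γnp)`. The series is geometric with ratio `2^(1 - p(1/2 - γ))`, below `1` for this `p`.
  obtain ⟨p, hp⟩ := exists_nat_gt (max 2 (1 / (1 / 2 - γ)))
  have hp2 : 2 ≤ p := by exact_mod_cast (lt_of_le_of_lt (le_max_left _ _) hp).le
  have hpγ : 1 < p * (1 / 2 - γ) := by
    have := lt_of_le_of_lt (le_max_right _ _) hp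
    rwa [div_lt_iff₀ (by linarith)] at this
  let b : ℕ → ℝ≥0∞ := fun n => (N * 2 ^ n : ℕ) *
    (ENNReal.ofReal (2 ^ (γ * n)) ^ p * ((NNReal.sqrt (c * (1 / 2 ^ n)) : ℝ≥0∞) ^ p * gaussianMoment p))
  let ρ : ℝ := 2 ^ (1 - p * (1 / 2 - γ))
  have hρ0 : 0 < ρ := by positivity
  have hρ : ρ < 1 := Real.rpow_lt_one_of_one_lt_of_neg (by norm_num) (by linarith)
  have hb : ∀ n, b n = ENNReal.ofReal ρ ^ n * (N * (NNReal.sqrt c : ℝ≥0∞) ^ p * gaussianMoment p) := by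
    intro n
    have h1 : (NNReal.sqrt (c * (1 / 2 ^ n)) : ℝ≥0∞)
        = NNReal.sqrt c * ENNReal.ofReal (2 ^ (-(n : ℝ) / 2)) := by
      rw [NNReal.sqrt_mul, ENNReal.coe_mul]
      congr 1
      rw [← ENNReal.ofReal_coe_nnreal]
      congr 1
      rw [Real.coe_sqrt, Real.sqrt_eq_rpow]
      push_cast
      rw [one_div, ← Real.rpow_natCast, ← Real.rpow_neg (by norm_num), ← Real.rpow_mul (by norm_num)]
      congr 1; ring
    have h2 : ((2 : ℕ) : ℝ≥0∞) ^ n = ENNReal.ofReal (2 ^ (n : ℝ)) := by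
      rw [Real.rpow_natCast, ENNReal.ofReal_pow (by norm_num)]
      norm_num
    have h3 : ENNReal.ofReal ρ ^ n = ENNReal.ofReal (2 ^ (n : ℝ)) * (ENNReal.ofReal (2 ^ (γ * n)) ^ p
        * ENNReal.ofReal (2 ^ (-(n : ℝ) / 2)) ^ p) := by
      rw [← ENNReal.ofReal_pow (by positivity), ← ENNReal.ofReal_pow (by positivity),
        ← ENNReal.ofReal_pow (by positivity), ← ENNReal.ofReal_mul (by positivity),
        ← ENNReal.ofReal_mul (by positivity)]
      congr 1
      simp only [ρ]
      rw [← Real.rpow_natCast (2 ^ _) n, ← Real.rpow_natCast (2 ^ (γ * n)) p,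
        ← Real.rpow_natCast (2 ^ (-(n : ℝ) / 2)) p, ← Real.rpow_mul (by norm_num),
        ← Real.rpow_mul (by norm_num), ← Real.rpow_mul (by norm_num), ← Real.rpow_add (by norm_num),
        ← Real.rpow_add (by norm_num)]
      congr 1; ring
    simp only [b]
    rw [h1, Nat.cast_mul, Nat.cast_pow, h2, h3, mul_pow]
    ring
  refine ⟨1 + ∑' n, b n, ?_, fun Ω mΩ P B hP hB => ?_⟩
  · refine ENNReal.add_ne_top.mpr ⟨ENNReal.one_ne_top, ?_⟩
    simp_rw [hb]
    rw [ENNReal.tsum_mul_right]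
    refine ENNReal.mul_ne_top ?_ ?_
    · rw [ENNReal.tsum_geometric]
      refine ENNReal.inv_ne_top.mpr ?_
      rw [ne_eq, tsub_eq_zero_iff_le, not_le]
      exact ENNReal.ofReal_lt_one.mpr hρ
    · exact ENNReal.mul_ne_top (ENNReal.mul_ne_top (by simp) (ENNReal.pow_ne_top (by simp)))
        (gaussianMoment_ne_top p)
  · have hm : ∀ (n i : ℕ), AEMeasurable (fun ω => ENNReal.ofReal (2 ^ (γ * n)) ^ p *
        ‖B (dyadic n (i + 1)) ω - B (dyadic n i) ω‖ₑ ^ p) P := fun n i =>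
      ((hB.aemeasurable (dyadic_mono (Nat.le_succ i))).enorm.pow_const p).const_mul _
    calc ∫⁻ ω, dyadicConst γ N (fun t => B t ω) ^ 2 ∂P
        ≤ ∫⁻ ω, (1 + ∑' n : ℕ, ∑ i : Fin (N * 2 ^ n), ENNReal.ofReal (2 ^ (γ * n)) ^ p *
            ‖B (dyadic n (i + 1)) ω - B (dyadic n i) ω‖ₑ ^ p) ∂P :=
          lintegral_mono fun ω => dyadicConst_sq_le γ N _ hp2
      _ = 1 + ∑' n : ℕ, ∑ i : Fin (N * 2 ^ n), ∫⁻ ω, ENNReal.ofReal (2 ^ (γ * n)) ^ p *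
            ‖B (dyadic n (i + 1)) ω - B (dyadic n i) ω‖ₑ ^ p ∂P := by
          have hm2 : ∀ n, AEMeasurable (fun ω => ∑ i : Fin (N * 2 ^ n),
              ENNReal.ofReal (2 ^ (γ * n)) ^ p *
                ‖B (dyadic n (i + 1)) ω - B (dyadic n i) ω‖ₑ ^ p) P := fun n =>
            Finset.aemeasurable_fun_sum _ fun i _ => hm n i
          rw [lintegral_add_left measurable_const, lintegral_tsum hm2]
          simp only [lintegral_one, measure_univ]
          congr 2; funext n
          rw [lintegral_finsetSum' _ fun (i : Fin (N * 2 ^ n)) _ => hm n i]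
      _ ≤ 1 + ∑' n, b n := by
          gcongr with n
          refine (Finset.sum_le_card_nsmul _ _ (ENNReal.ofReal (2 ^ (γ * n)) ^ p *
            ((NNReal.sqrt (c * (1 / 2 ^ n)) : ℝ≥0∞) ^ p * gaussianMoment p)) fun i _ => ?_).trans ?_
          · rw [lintegral_const_mul' _ _ (ENNReal.pow_ne_top ENNReal.ofReal_ne_top)]
            gcongr
            have := hB.lintegral_pow_le p (dyadic_mono (n := n) (Nat.le_succ i))
            rwa [Nat.succ_eq_add_one, dyadic_succ_sub] at this
          · simp [b]

lemma HasGaussianIncrements.aemeasurable_dyadicConst {Ω : Type*} {mΩ : MeasurableSpace Ω}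
    {P : Measure Ω} {c : ℝ≥0} {B : ℝ≥0 → Ω → ℝ} (hB : HasGaussianIncrements P c B) {γ : ℝ} {N : ℕ} :
    AEMeasurable (fun ω => dyadicConst γ N (fun t => B t ω)) P := by
  refine AEMeasurable.iSup fun n => AEMeasurable.iSup fun i => ?_
  exact (hB.aemeasurable (dyadic_mono (Nat.le_succ i))).enorm.const_mul _

lemma HasGaussianIncrements.congr {Ω : Type*} {mΩ : MeasurableSpace Ω}
    {P : Measure Ω} {c : ℝ≥0} {B B' : ℝ≥0 → Ω → ℝ} (hB : HasGaussianIncrements P c B)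
    (h : ∀ t, B' t =ᵐ[P] B t) : HasGaussianIncrements P c B' := by
  intro t u htu
  obtain ⟨v, hv, hl⟩ := hB t u htu
  exact ⟨v, hv, hl.congr ((h u).sub (h t))⟩

lemma HasGaussianIncrements.ae_dyadicConst_ne_top {Ω : Type} {mΩ : MeasurableSpace Ω}
    {P : Measure Ω} [IsProbabilityMeasure P] {c : ℝ≥0} {B : ℝ≥0 → Ω → ℝ}
    (hB : HasGaussianIncrements P c B) {γ : ℝ} (hγ : γ < 1 / 2) (N : ℕ) :
    ∀ᵐ ω ∂P, dyadicConst γ N (fun t => B t ω) ≠ ∞ := by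
  obtain ⟨M, hM, h⟩ := exists_lintegral_dyadicConst_sq_le hγ c N
  have h1 := ae_lt_top' (hB.aemeasurable_dyadicConst.pow_const 2) (lt_of_le_of_lt (h Ω mΩ P B ‹_› hB) hM.lt_top).ne
  filter_upwards [h1] with ω hω h2
  simp [h2] at hω

/-! ### Continuous modifications -/

/-- The continuous modification of a process with Gaussian increments. -/
def contMod (f : ℝ≥0 → ℝ) (t : ℝ≥0) : ℝ :=
  open Classical in
  if ∀ N, dyadicConst (1 / 4) N f ≠ ∞ then limsup (fun n => f (dyadicFloor n t)) atTop else 0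

/-- The exponent `1/4` is arbitrary in `(0, 1/2)`: positive for the chaining bound, and below `1/2`
for the dyadic constants to be almost surely finite. -/
lemma tendsto_contMod {f : ℝ≥0 → ℝ} (h : ∀ N, dyadicConst (1 / 4) N f ≠ ∞) (t : ℝ≥0) :
    Tendsto (fun n => f (dyadicFloor n t)) atTop (𝓝 (contMod f t)) := by
  obtain ⟨N, hN⟩ := exists_nat_ge t
  obtain ⟨l, hl⟩ := (dyadicBound_of_dyadicConst_ne_top (h N)).exists_tendsto ENNReal.toReal_nonneg
    (by positivity) (two_rpow_neg_lt_one (by norm_num)) hN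
  rwa [contMod, if_pos h, hl.limsup_eq]

lemma measurable_dyadicConst {Ω : Type*} {mΩ : MeasurableSpace Ω} {B : ℝ≥0 → Ω → ℝ}
    (hB : ∀ t, Measurable (B t)) (γ : ℝ) (N : ℕ) :
    Measurable fun ω => dyadicConst γ N (fun t => B t ω) := by
  refine Measurable.iSup fun n => Measurable.iSup fun i => ?_
  exact ((hB _).sub (hB _)).enorm.const_mul _

lemma measurable_contMod {Ω : Type*} {mΩ : MeasurableSpace Ω} {B : ℝ≥0 → Ω → ℝ}
    (hB : ∀ t, Measurable (B t)) (t : ℝ≥0) :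
    Measurable fun ω => contMod (fun r => B r ω) t := by
  classical
  refine Measurable.ite ?_ (Measurable.limsup fun n => hB _) measurable_const
  simp only [Set.ofPred_forall]
  refine MeasurableSet.iInter fun N => ?_
  exact (measurable_dyadicConst hB _ N) (measurableSet_singleton ∞).compl

lemma contMod_eq_of_continuous {f : ℝ≥0 → ℝ} (hf : Continuous f)
    (h : ∀ N, dyadicConst (1 / 4) N f ≠ ∞) : contMod f = f := by
  funext t
  exact tendsto_nhds_unique (tendsto_contMod h t) ((hf.tendsto t).comp (tendsto_dyadicFloor t))

lemma continuous_of_holder {g : ℝ≥0 → ℝ} {γ : ℝ} (hγ : 0 < γ)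
    (h : ∀ N : ℕ, ∃ K : ℝ, ∀ r t : ℝ≥0, r ≤ t → t ≤ N → |g t - g r| ≤ K * (t - r : ℝ) ^ γ) :
    Continuous g := by
  refine continuous_iff_continuousAt.mpr fun t => ?_
  obtain ⟨N, hN⟩ := exists_nat_gt t
  obtain ⟨K, hK⟩ := h N
  have h1 : ∀ r ≤ (N : ℝ≥0), |g r - g t| ≤ K * |(r : ℝ) - t| ^ γ := by
    intro r hr
    rcases le_total r t with hrt | hrt
    · have := hK r t hrt hN.le
      rw [abs_sub_comm, abs_sub_comm (r : ℝ), abs_of_nonneg (a := (t : ℝ) - r) (by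
        have : (r : ℝ) ≤ t := by exact_mod_cast hrt
        linarith)]
      exact this
    · have := hK t r hrt hr
      rw [abs_of_nonneg (a := (r : ℝ) - t) (by
        have : (t : ℝ) ≤ r := by exact_mod_cast hrt
        linarith)]
      exact this
  have h2 : Tendsto (fun r : ℝ≥0 => K * |(r : ℝ) - t| ^ γ) (𝓝 t) (𝓝 0) := by
    have : Continuous fun r : ℝ≥0 => K * |(r : ℝ) - t| ^ γ := by
      refine continuous_const.mul (Continuous.rpow_const (by fun_prop) fun _ => Or.inr hγ.le)
    have h3 := this.tendsto t
    simpa [Real.zero_rpow hγ.ne'] using h3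
  rw [ContinuousAt, tendsto_iff_dist_tendsto_zero]
  refine squeeze_zero' (Eventually.of_forall fun _ => dist_nonneg) ?_ h2
  filter_upwards [Iic_mem_nhds hN] with r hr
  rw [Real.dist_eq]
  exact h1 r hr

/-- No assumption on `f` is needed, thanks to the default value `0` when a dyadic constant is
infinite. The modified noise is thus continuous for every `ω`. -/
lemma continuous_contMod (f : ℝ≥0 → ℝ) : Continuous (contMod f) := by
  by_cases h : ∀ N, dyadicConst (1 / 4) N f ≠ ∞
  · refine continuous_of_holder (γ := 1 / 4) (by norm_num) fun N => ⟨_, fun r t hrt ht =>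
      (dyadicBound_of_dyadicConst_ne_top (h N)).holder (by norm_num) (by norm_num)
        ENNReal.toReal_nonneg (fun t _ => tendsto_contMod h t) hrt ht⟩
  · have : contMod f = fun _ => 0 := by
      funext t; rw [contMod, if_neg h]
    rw [this]
    exact continuous_const

/-- By Fatou, the expected `liminf` of the squared distances from `B t` to the dyadic approximations
is at most a limit of `c (t - dyadicFloor n t)` times a constant, hence zero; almost surely that
`liminf` is the squared distance from `B t` to the modification. -/
lemma HasGaussianIncrements.contMod_ae_eq {Ω : Type} {mΩ : MeasurableSpace Ω}
    {P : Measure Ω} [IsProbabilityMeasure P] {c : ℝ≥0} {B : ℝ≥0 → Ω → ℝ}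
    (hB : HasGaussianIncrements P c B) (t : ℝ≥0) :
    (fun ω => contMod (fun r => B r ω) t) =ᵐ[P] B t := by
  have h1 : ∀ᵐ ω ∂P, ∀ N, dyadicConst (1 / 4) N (fun r => B r ω) ≠ ∞ :=
    ae_all_iff.mpr fun N => hB.ae_dyadicConst_ne_top (by norm_num) N
  have h2 : ∫⁻ ω, liminf (fun n => ‖B t ω - B (dyadicFloor n t) ω‖ₑ ^ 2) atTop ∂P = 0 := by
    refine le_antisymm ?_ zero_le
    refine (lintegral_liminf_le' fun n =>
      (hB.aemeasurable (dyadicFloor_le n t)).enorm.pow_const 2).trans ?_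
    have h3 : Tendsto (fun n => (NNReal.sqrt (c * (t - dyadicFloor n t)) : ℝ≥0∞) ^ 2
        * gaussianMoment 2) atTop (𝓝 0) := by
      have h4 : Tendsto (fun n => c * (t - dyadicFloor n t)) atTop (𝓝 0) := by
        have := ((tendsto_const_nhds (x := t)).sub (tendsto_dyadicFloor t)).const_mul c
        simpa using this
      have h5 : Tendsto (fun n => (NNReal.sqrt (c * (t - dyadicFloor n t)) : ℝ≥0∞) ^ 2) atTop
          (𝓝 0) := by
        have : ∀ n, (NNReal.sqrt (c * (t - dyadicFloor n t)) : ℝ≥0∞) ^ 2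
            = ((c * (t - dyadicFloor n t) : ℝ≥0) : ℝ≥0∞) := fun n => by
          rw [← ENNReal.coe_pow, NNReal.sq_sqrt]
        simp_rw [this]
        exact ENNReal.tendsto_coe.mpr h4
      have h6 := ENNReal.Tendsto.mul_const h5 (Or.inr (gaussianMoment_ne_top 2))
      simpa using h6
    rw [← h3.liminf_eq]
    exact liminf_le_liminf (Eventually.of_forall fun n =>
      hB.lintegral_pow_le 2 (dyadicFloor_le n t))
  have hm : AEMeasurable (fun ω => liminf (fun n => ‖B t ω - B (dyadicFloor n t) ω‖ₑ ^ 2) atTop) P :=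
    by
    simp only [liminf_eq_iSup_iInf_of_nat]
    exact AEMeasurable.iSup fun n => AEMeasurable.iInf fun i => AEMeasurable.iInf fun _ =>
      (hB.aemeasurable (dyadicFloor_le i t)).enorm.pow_const 2
  filter_upwards [h1, (lintegral_eq_zero_iff' hm).mp h2] with ω h3 h4
  have h5 : Tendsto (fun n => ‖B t ω - B (dyadicFloor n t) ω‖ₑ ^ 2) atTop
      (𝓝 (‖B t ω - contMod (fun r => B r ω) t‖ₑ ^ 2)) :=
    ENNReal.Tendsto.pow ((continuous_enorm.tendsto _).comp
      ((tendsto_contMod h3 t).const_sub (B t ω)))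
  simp only [h5.liminf_eq, Pi.zero_apply, ne_eq, OfNat.ofNat_ne_zero, not_false_eq_true,
    pow_eq_zero_iff, enorm_eq_zero] at h4
  linarith

end AbelianYM

end

noncomputable section

namespace AbelianYM

/-! ### Isonormal Gaussian processes and the existence of white noise -/

/-- A linear isometry from `H` to a space of Gaussian variables. -/
structure IsIsonormal {H : Type*} [NormedAddCommGroup H] [InnerProductSpace ℝ H] {Ω : Type*}
    {mΩ : MeasurableSpace Ω} (P : Measure Ω) (ξ : H → Ω → ℝ) : Prop where
  measurable : ∀ h, Measurable (ξ h)
  gaussian : IsGaussianProcess ξ P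
  mean_zero : ∀ h, ∫ ω, ξ h ω ∂P = 0
  covariance : ∀ h k, ∫ ω, ξ h ω * ξ k ω ∂P = inner ℝ h k

/-- From `|exp (ix) - 1| ≤ |x|` the functional is Lipschitz for the `L¹` norm, and on a probability
space the `L²` norm dominates. -/
lemma continuous_integral_exp {Ω : Type*} {mΩ : MeasurableSpace Ω} (P : Measure Ω)
    [IsProbabilityMeasure P] :
    Continuous fun f : Lp ℝ 2 P => ∫ ω, Complex.exp (Complex.I * (f ω : ℝ)) ∂P := by
  have hint : ∀ f : Lp ℝ 2 P, Integrable (fun ω => Complex.exp (Complex.I * (f ω : ℝ))) P := by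
    intro f
    refine Integrable.of_bound (C := 1) ?_ (ae_of_all _ fun ω => ?_)
    · have hf := (Lp.aestronglyMeasurable f)
      exact (Continuous.comp_aestronglyMeasurable (g := fun x : ℝ => Complex.exp (Complex.I * x))
        (by fun_prop) hf)
    · rw [Complex.norm_exp_I_mul_ofReal]
  have key : ∀ f g : Lp ℝ 2 P, ‖(∫ ω, Complex.exp (Complex.I * (f ω : ℝ)) ∂P)
      - ∫ ω, Complex.exp (Complex.I * (g ω : ℝ)) ∂P‖ ≤ ‖f - g‖ := by
    intro f g
    have hL1 : Integrable (fun ω => (f - g : Lp ℝ 2 P) ω) P :=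
      (Lp.memLp (f - g)).integrable one_le_two
    rw [← integral_sub (hint f) (hint g)]
    calc ‖∫ ω, (Complex.exp (Complex.I * (f ω : ℝ)) - Complex.exp (Complex.I * (g ω : ℝ))) ∂P‖
        ≤ ∫ ω, ‖(f - g : Lp ℝ 2 P) ω‖ ∂P := by
          refine norm_integral_le_of_norm_le hL1.norm ?_
          filter_upwards [Lp.coeFn_sub f g] with ω hω
          rw [hω]
          have h1 : Complex.exp (Complex.I * (f ω : ℝ)) - Complex.exp (Complex.I * (g ω : ℝ))
              = Complex.exp (Complex.I * (g ω : ℝ)) *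
                (Complex.exp (Complex.I * ((f ω - g ω : ℝ))) - 1) := by
            rw [mul_sub, ← Complex.exp_add, mul_one]
            congr 2
            push_cast; ring
          rw [h1, norm_mul, Complex.norm_exp_I_mul_ofReal, one_mul]
          exact Real.norm_exp_I_mul_ofReal_sub_one_le
      _ = (eLpNorm (f - g : Lp ℝ 2 P) 1 P).toReal := by
          rw [integral_norm_eq_lintegral_enorm hL1.aestronglyMeasurable, eLpNorm_one_eq_lintegral_enorm]
      _ ≤ ‖f - g‖ := by
          rw [Lp.norm_def]
          refine ENNReal.toReal_mono (Lp.eLpNorm_ne_top _) ?_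
          exact eLpNorm_le_eLpNorm_of_exponent_le one_le_two (Lp.aestronglyMeasurable _)
  rw [Metric.continuous_iff]
  intro g ε hε
  refine ⟨ε, hε, fun f hf => lt_of_le_of_lt ?_ hf⟩
  rw [dist_eq_norm, dist_eq_norm]
  exact key f g

/-- A linear isometry into `L²` that maps an orthonormal basis to independent normal variables
takes values in the Gaussian variables. -/
lemma integral_exp_isometry {H : Type*} [NormedAddCommGroup H] [InnerProductSpace ℝ H]
    {ι Ω : Type*} {mΩ : MeasurableSpace Ω} {P : Measure Ω} [IsProbabilityMeasure P]
    (b : HilbertBasis ι ℝ H) (T : H →ₗᵢ[ℝ] Lp ℝ 2 P) {X : ι → Ω → ℝ}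
    (hX : ∀ i, HasLaw (X i) (gaussianReal 0 1) P) (hi : iIndepFun X P)
    (hT : ∀ i, (T (b i) : Ω → ℝ) =ᵐ[P] X i) (h : H) :
    ∫ ω, Complex.exp (Complex.I * ((T h : Lp ℝ 2 P) ω : ℝ)) ∂P = Complex.exp (-(‖h‖ ^ 2 / 2 : ℝ)) := by
  -- Both sides are continuous in `h`, so the identity need only be checked on the dense span of the
  -- basis, where `T h` is a finite combination of independent normal variables.
  have hclosed : IsClosed {h : H | ∫ ω, Complex.exp (Complex.I * ((T h : Lp ℝ 2 P) ω : ℝ)) ∂P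
      = Complex.exp (-(‖h‖ ^ 2 / 2 : ℝ))} :=
    isClosed_eq ((continuous_integral_exp P).comp T.continuous) (by fun_prop)
  have hspan : (Submodule.span ℝ (Set.range b) : Set H) ⊆
      {h : H | ∫ ω, Complex.exp (Complex.I * ((T h : Lp ℝ 2 P) ω : ℝ)) ∂P
      = Complex.exp (-(‖h‖ ^ 2 / 2 : ℝ))} := by
    intro h hh
    obtain ⟨c, rfl⟩ := Finsupp.mem_span_range_iff_exists_finsupp.mp hh
    set h := c.sum fun i a => a • b i with hdef
    have h1 : (T h : Ω → ℝ) =ᵐ[P] fun ω => ∑ i ∈ c.support, c i * X i ω := by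
      have h2 : T h = ∑ i ∈ c.support, c i • T (b i) := by
        rw [hdef, Finsupp.sum, map_sum]
        simp
      have h3 : ∀ s : Finset ι, ((∑ i ∈ s, c i • T (b i) : Lp ℝ 2 P) : Ω → ℝ)
          =ᵐ[P] fun ω => ∑ i ∈ s, c i * X i ω := by
        intro s
        classical
        induction s using Finset.induction_on with
        | empty => simp only [Finset.sum_empty]; exact Lp.coeFn_zero ℝ 2 P
        | insert i s hi ih =>
          rw [Finset.sum_insert hi]
          filter_upwards [Lp.coeFn_add (c i • T (b i)) (∑ i ∈ s, c i • T (b i)), ih,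
            Lp.coeFn_smul (c i) (T (b i)), hT i] with ω e1 e2 e3 e4
          rw [e1, Pi.add_apply, e2, e3, Pi.smul_apply, e4, Finset.sum_insert hi, smul_eq_mul]
      rw [h2]
      exact h3 _
    have hG : HasGaussianLaw (T h : Ω → ℝ) P := by
      have h4 : iIndepFun (fun i : c.support => X i) P := hi.precomp Subtype.val_injective
      have h5 := iIndepFun.hasGaussianLaw (fun i : c.support => (hX i).hasGaussianLaw) h4
      have h6 := h5.map (∑ i : c.support, c i • ContinuousLinearMap.proj (R := ℝ) i)
      refine h6.congr ?_
      refine EventuallyEq.trans (Eventually.of_forall fun ω => ?_) h1.symm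
      simp
      exact Finset.sum_attach c.support fun i => c i * X i ω
    have hmean : ∫ ω, (T h : Lp ℝ 2 P) ω ∂P = 0 := by
      rw [integral_congr_ae h1, integral_finsetSum]
      · refine Finset.sum_eq_zero fun i _ => ?_
        rw [integral_const_mul, (hX i).integral_eq]
        simp
      · intro i _
        exact ((hX i).hasGaussianLaw.integrable).const_mul _
    have hvar : Var[(T h : Ω → ℝ); P] = ‖h‖ ^ 2 := by
      rw [variance_eq_integral (Lp.aestronglyMeasurable _).aemeasurable, hmean]
      have h7 := L2.inner_def (𝕜 := ℝ) (T h) (T h)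
      rw [real_inner_self_eq_norm_sq, T.norm_map] at h7
      rw [h7]
      refine integral_congr_ae (ae_of_all _ fun ω => ?_)
      simp [sq]
    have hlaw := hG.map_eq_gaussianReal
    rw [hmean, hvar] at hlaw
    have hc := charFun_gaussianReal (μ := 0) (v := (‖h‖ ^ 2).toNNReal) 1
    rw [← hlaw, charFun_apply_real, integral_map hG.aemeasurable (by fun_prop)] at hc
    simp only [Set.mem_ofPred_eq]
    convert hc using 1
    · refine integral_congr_ae (ae_of_all _ fun ω => ?_)
      simp [mul_comm]
    · rw [Real.coe_toNNReal _ (by positivity)]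
      simp
  have hmem : h ∈ closure (Submodule.span ℝ (Set.range b) : Set H) := by
    rw [← Submodule.topologicalClosure_coe, b.dense_span]
    trivial
  exact (closure_minimal hspan hclosed) hmem

/-- Coordinates of an infinite product of standard normal laws, indexed by a Hilbert basis, are
orthonormal in `L²`, so the basis extends to an isometry into `L²`. Its values are centred Gaussian
by `integral_exp_isometry`. The index set may be uncountable, so no separability is required. -/
theorem exists_isIsonormal (H : Type) [NormedAddCommGroup H] [InnerProductSpace ℝ H]
    [CompleteSpace H] : ∃ (Ω : Type) (_ : MeasurableSpace Ω) (P : Measure Ω) (ξ : H → Ω → ℝ),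
      IsProbabilityMeasure P ∧ IsIsonormal P ξ := by
  classical
  obtain ⟨w, b, -⟩ := exists_hilbertBasis ℝ H
  let P : Measure (w → ℝ) := Measure.infinitePi fun _ => gaussianReal 0 1
  let X : w → (w → ℝ) → ℝ := fun i ω => ω i
  have hX : ∀ i, HasLaw (X i) (gaussianReal 0 1) P := fun i =>
    (measurePreserving_eval_infinitePi (fun _ : w => gaussianReal 0 1) i).hasLaw
  have hi : iIndepFun X P := iIndepFun_infinitePi (X := fun _ x => x) (by fun_prop)
  have hL2 : ∀ i, MemLp (X i) 2 P := fun i => (hX i).hasGaussianLaw.memLp_two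
  let e : w → Lp ℝ 2 P := fun i => (hL2 i).toLp (X i)
  have he : Orthonormal ℝ e := by
    rw [orthonormal_iff_ite]
    intro i j
    have h1 : inner ℝ (e i) (e j) = ∫ ω, X i ω * X j ω ∂P := by
      rw [L2.inner_def]
      refine integral_congr_ae ?_
      filter_upwards [(hL2 i).coeFn_toLp, (hL2 j).coeFn_toLp] with ω h1 h2
      simp only [e, h1, h2]
      simp [mul_comm]
    rw [h1]
    split_ifs with hij
    · subst hij
      have h2 := variance_eq_integral (hX i).aemeasurable
      rw [(hX i).variance_eq, (hX i).integral_eq] at h2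
      simp only [variance_id_gaussianReal, integral_id_gaussianReal, sub_zero, NNReal.coe_one] at h2
      rw [h2]
      simp [sq]
    · rw [(hi.indepFun hij).integral_fun_mul_eq_mul_integral (hX i).aemeasurable.aestronglyMeasurable
        (hX j).aemeasurable.aestronglyMeasurable, (hX i).integral_eq]
      simp
  let T : H →ₗᵢ[ℝ] Lp ℝ 2 P :=
    he.orthogonalFamily.linearIsometry.comp b.repr.toLinearIsometry
  have hT : ∀ i, (T (b i) : (w → ℝ) → ℝ) =ᵐ[P] X i := by
    intro i
    have : T (b i) = e i := by
      change he.orthogonalFamily.linearIsometry (b.repr (b i)) = e i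
      rw [b.repr_self, he.orthogonalFamily.linearIsometry_apply_single]
      simp
    rw [this]
    exact (hL2 i).coeFn_toLp
  have hlaw : ∀ h, HasLaw (T h : (w → ℝ) → ℝ) (gaussianReal 0 (‖h‖ ^ 2).toNNReal) P := by
    intro h
    have hm : AEMeasurable (T h : (w → ℝ) → ℝ) P := (Lp.stronglyMeasurable (T h)).measurable.aemeasurable
    refine ⟨hm, ?_⟩
    have : IsProbabilityMeasure (P.map (T h : (w → ℝ) → ℝ)) := Measure.isProbabilityMeasure_map hm
    refine Measure.ext_of_charFun (funext fun t => ?_)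
    rw [charFun_apply_real, charFun_gaussianReal, integral_map hm (by fun_prop)]
    have h1 := integral_exp_isometry b T hX hi hT (t • h)
    have h2 : ∫ ω, Complex.exp (Complex.I * ((T (t • h) : Lp ℝ 2 P) ω : ℝ)) ∂P
        = ∫ ω, Complex.exp (t * (T h : Lp ℝ 2 P) ω * Complex.I) ∂P := by
      refine integral_congr_ae ?_
      rw [map_smul]
      filter_upwards [Lp.coeFn_smul t (T h)] with ω hω
      rw [hω, Pi.smul_apply, smul_eq_mul]
      push_cast
      congr 1; ring
    rw [← h2, h1, Real.coe_toNNReal _ (by positivity), norm_smul, mul_pow, Real.norm_eq_abs, sq_abs]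
    push_cast
    congr 1; ring
  refine ⟨w → ℝ, inferInstance, P, fun h => T h, inferInstance,
    fun h => (Lp.stronglyMeasurable (T h)).measurable, ⟨fun I => ?_⟩, fun h => ?_, fun h k => ?_⟩
  · have hm : Measurable fun ω => I.restrict fun h => (T h : Lp ℝ 2 P) ω :=
      measurable_pi_lambda _ fun h => (Lp.stronglyMeasurable (T h.1)).measurable
    rw [hasGaussianLaw_iff_charFunDual_map_eq hm.aemeasurable]
    intro L
    let h : H := ∑ i : I, L (Pi.single i 1) • i.1
    -- Joint Gaussianity reduces to single variables: by linearity of `T`, a linear functional of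
    -- finitely many values of `T` is almost surely again a value of `T`.
    have h1 : (L ∘ fun ω => I.restrict fun h => (T h : Lp ℝ 2 P) ω) =ᵐ[P] T h := by
      have h2 : T h = ∑ i : I, L (Pi.single i 1) • T i.1 := by
        simp [h, map_sum]
      have h3 : ∀ s : Finset I, ((∑ i ∈ s, L (Pi.single i 1) • T i.1 : Lp ℝ 2 P) : (w → ℝ) → ℝ)
          =ᵐ[P] fun ω => ∑ i ∈ s, L (Pi.single i 1) * (T i.1 : Lp ℝ 2 P) ω := by
        intro s
        induction s using Finset.induction_on with
        | empty => simp only [Finset.sum_empty]; exact Lp.coeFn_zero ℝ 2 P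
        | insert i s hi ih =>
          rw [Finset.sum_insert hi]
          filter_upwards [Lp.coeFn_add (L (Pi.single i 1) • T i.1)
            (∑ i ∈ s, L (Pi.single i 1) • T i.1), ih,
            Lp.coeFn_smul (L (Pi.single i 1)) (T i.1)] with ω e1 e2 e3
          rw [e1, Pi.add_apply, e2, e3, Pi.smul_apply, Finset.sum_insert hi, smul_eq_mul]
      rw [h2]
      refine EventuallyEq.trans (Eventually.of_forall fun ω => ?_) (h3 Finset.univ).symm
      simp only [Function.comp_apply]
      conv_lhs => rw [← L.coe_coe, LinearMap.pi_apply_eq_sum_univ (L : (I → ℝ) →ₗ[ℝ] ℝ)]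
      refine Finset.sum_congr rfl fun i _ => ?_
      rw [smul_eq_mul, mul_comm]
      congr 1
      simp only [ContinuousLinearMap.coe_coe]
      congr 1
      ext j
      simp [Pi.single_apply, eq_comm]
    rw [charFunDual_apply, integral_map hm.aemeasurable (by fun_prop), integral_congr_ae h1,
      variance_congr h1, (hlaw h).integral_eq, (hlaw h).variance_eq]
    have h4 := integral_exp_isometry b T hX hi hT h
    simp only [integral_id_gaussianReal, variance_id_gaussianReal]
    rw [Real.coe_toNNReal _ (by positivity)]
    convert h4 using 1
    · refine integral_congr_ae ?_
      filter_upwards [h1] with ω hω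
      simp only [Function.comp_apply] at hω
      rw [hω, mul_comm]
    · push_cast
      congr 1; ring
  · rw [(hlaw h).integral_eq]
    simp
  · have h1 := L2.inner_def (𝕜 := ℝ) (T h) (T k)
    rw [T.inner_map_map] at h1
    rw [h1]
    refine integral_congr_ae (ae_of_all _ fun ω => ?_)
    exact mul_comm _ _

end AbelianYM

end

noncomputable section

namespace AbelianYM

/-! ### Gaussian processes with the covariance of white noise -/

/-- The part of the definition of white noise that concerns its law. -/
structure IsWhiteProcess {d : ℕ} {Ω : Type} {mΩ : MeasurableSpace Ω} (P : Measure Ω)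
    (W : ℝ≥0 → TestForm d → Ω → ℝ) : Prop where
  gaussian : IsGaussianProcess (fun (p : ℝ≥0 × TestForm d) => W p.1 p.2) P
  mean_zero : ∀ t φ, ∫ ω, W t φ ω ∂P = 0
  covariance : ∀ (t u : ℝ≥0) (φ ψ : TestForm d),
    ∫ ω, W t φ ω * W u ψ ω ∂P
      = min (t : ℝ) u * torusInt fun x => ∑ j, (φ j).1 x * (ψ j).1 x

lemma IsWhiteNoise.isWhiteProcess {d : ℕ} {Ω : Type} {mΩ : MeasurableSpace Ω} {P : Measure Ω}
    {𝓕 : Filtration ℝ≥0 mΩ} {W : ℝ≥0 → TestForm d → Ω → ℝ} (hW : IsWhiteNoise P 𝓕 W) :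
    IsWhiteProcess P W :=
  ⟨hW.gaussian, hW.mean_zero, hW.covariance⟩

lemma IsWhiteNoise.measurable {d : ℕ} {Ω : Type} {mΩ : MeasurableSpace Ω} {P : Measure Ω}
    {𝓕 : Filtration ℝ≥0 mΩ} {W : ℝ≥0 → TestForm d → Ω → ℝ} (hW : IsWhiteNoise P 𝓕 W)
    (t : ℝ≥0) (φ : TestForm d) : Measurable (W t φ) :=
  (hW.adapted t φ).mono (𝓕.le t) le_rfl

/-- The inner product of `L²(T^d; ℝ^d)`. -/
def ipForm {d : ℕ} (φ ψ : TestForm d) : ℝ := torusInt fun x => ∑ j, (φ j).1 x * (ψ j).1 x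

lemma ipForm_eq_sum {d : ℕ} (φ ψ : TestForm d) : ipForm φ ψ = ∑ j, ip (φ j) (ψ j) := by
  unfold ipForm ip torusInt
  exact integral_finsetSum _ fun j _ => integrableOn_cell (continuous_mul_testFun (φ j) (ψ j))

namespace IsWhiteProcess

variable {d : ℕ} {Ω : Type} {mΩ : MeasurableSpace Ω} {P : Measure Ω}
  {W : ℝ≥0 → TestForm d → Ω → ℝ}

lemma isProbabilityMeasure (hW : IsWhiteProcess P W) : IsProbabilityMeasure P :=
  hW.gaussian.isProbabilityMeasure

lemma hasGaussianLaw (hW : IsWhiteProcess P W) (t : ℝ≥0) (φ : TestForm d) :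
    HasGaussianLaw (W t φ) P :=
  hW.gaussian.hasGaussianLaw_eval (t, φ)

lemma memLp (hW : IsWhiteProcess P W) (t : ℝ≥0) (φ : TestForm d) : MemLp (W t φ) 2 P :=
  (hW.hasGaussianLaw t φ).memLp_two

lemma cov_eq (hW : IsWhiteProcess P W) (t u : ℝ≥0) (φ ψ : TestForm d) :
    cov[W t φ, W u ψ; P] = min (t : ℝ) u * ipForm φ ψ := by
  have := hW.isProbabilityMeasure
  rw [covariance_eq_sub (hW.memLp t φ) (hW.memLp u ψ), hW.mean_zero, hW.mean_zero, mul_zero,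
    sub_zero]
  exact hW.covariance t u φ ψ

lemma hasGaussianIncrements (hW : IsWhiteProcess P W) (φ : TestForm d) {c : ℝ≥0}
    (hc : ipForm φ φ ≤ c) : HasGaussianIncrements P c fun t => W t φ := by
  intro t u htu
  have := hW.isProbabilityMeasure
  have hG : HasGaussianLaw (fun ω => W u φ ω - W t φ ω) P :=
    hW.gaussian.hasGaussianLaw_fun_sub (s := (u, φ)) (t := (t, φ))
  have htu' : (t : ℝ) ≤ u := by exact_mod_cast htu
  have hmean : ∫ ω, (W u φ ω - W t φ ω) ∂P = 0 := by
    rw [integral_sub (hW.hasGaussianLaw u φ).integrable (hW.hasGaussianLaw t φ).integrable,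
      hW.mean_zero, hW.mean_zero, sub_zero]
  have hvar : Var[fun ω => W u φ ω - W t φ ω; P] = (u - t) * ipForm φ φ := by
    rw [← covariance_self hG.aemeasurable, covariance_fun_sub_fun_sub (hW.memLp u φ) (hW.memLp t φ)
      (hW.memLp u φ) (hW.memLp t φ)]
    simp only [hW.cov_eq, min_self, min_eq_left htu', min_eq_right htu']
    ring
  refine ⟨_, ?_, ⟨hG.aemeasurable, by rw [hG.map_eq_gaussianReal, hmean]⟩⟩
  rw [hvar, Real.toNNReal_le_iff_le_coe, NNReal.coe_mul, NNReal.coe_sub htu, mul_comm]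
  exact mul_le_mul_of_nonneg_right hc (by linarith)

/-- Increments after time `t` are independent of the past. -/
lemma indepFun_increments (hW : IsWhiteProcess P W) (t : ℝ≥0) :
    IndepFun (fun ω (p : ℝ≥0 × TestForm d) => W (t + p.1) p.2 ω - W t p.2 ω)
      (fun ω (p : Set.Iic t × TestForm d) => W p.1 p.2 ω) P := by
  have := hW.isProbabilityMeasure
  have hG : IsGaussianProcess (Sum.elim
      (fun (p : ℝ≥0 × TestForm d) ω => W (t + p.1) p.2 ω - W t p.2 ω)
      (fun (p : Set.Iic t × TestForm d) ω => W p.1 p.2 ω)) P := by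
    classical
    refine hW.gaussian.of_isGaussianProcess fun s => ?_
    rcases s with ⟨u, φ⟩ | ⟨r, φ⟩
    · refine ⟨{(t + u, φ), (t, φ)}, ContinuousLinearMap.proj (R := ℝ) ⟨(t + u, φ), by simp⟩
        - ContinuousLinearMap.proj (R := ℝ) ⟨(t, φ), by simp⟩, fun ω => ?_⟩
      simp
    · refine ⟨{((r : ℝ≥0), φ)}, ContinuousLinearMap.proj (R := ℝ) ⟨((r : ℝ≥0), φ), by simp⟩,
        fun ω => ?_⟩
      simp
  -- Future increments and past values are jointly Gaussian, so it suffices that they are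
  -- uncorrelated; this holds since `min (t + u) r = r = min t r` for `r ≤ t`.
  refine hG.indepFun_of_covariance_eq_zero (fun s => ?_) (fun s => ?_) fun ⟨u, φ⟩ ⟨r, ψ⟩ => ?_
  · exact (hW.hasGaussianLaw _ _).aemeasurable.sub (hW.hasGaussianLaw _ _).aemeasurable
  · exact (hW.hasGaussianLaw _ _).aemeasurable
  · change cov[fun ω => W (t + u) φ ω - W t φ ω, W r ψ; P] = 0
    rw [covariance_fun_sub_left (hW.memLp _ _) (hW.memLp _ _) (hW.memLp _ _), hW.cov_eq, hW.cov_eq]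
    have h1 : ((r : ℝ≥0) : ℝ) ≤ t := by exact_mod_cast r.2
    rw [min_eq_right h1, min_eq_right, sub_self]
    push_cast
    linarith [u.coe_nonneg]

/-- The noise after time `t`. -/
lemma shift (hW : IsWhiteProcess P W) (t : ℝ≥0) :
    IsWhiteProcess P fun u φ ω => W (t + u) φ ω - W t φ ω := by
  have := hW.isProbabilityMeasure
  refine ⟨?_, fun u φ => ?_, fun u v φ ψ => ?_⟩
  · classical
    refine hW.gaussian.of_isGaussianProcess fun ⟨u, φ⟩ => ?_
    refine ⟨{(t + u, φ), (t, φ)}, ContinuousLinearMap.proj (R := ℝ) ⟨(t + u, φ), by simp⟩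
        - ContinuousLinearMap.proj (R := ℝ) ⟨(t, φ), by simp⟩, fun ω => ?_⟩
    simp
  · rw [integral_sub (hW.hasGaussianLaw _ φ).integrable (hW.hasGaussianLaw t φ).integrable,
      hW.mean_zero, hW.mean_zero, sub_zero]
  · have h0 : ∀ u φ, ∫ ω, (W (t + u) φ ω - W t φ ω) ∂P = 0 := fun u φ => by
      rw [integral_sub (hW.hasGaussianLaw _ φ).integrable (hW.hasGaussianLaw t φ).integrable,
        hW.mean_zero, hW.mean_zero, sub_zero]
    have h1 := covariance_eq_sub (μ := P) (X := fun ω => W (t + u) φ ω - W t φ ω)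
      (Y := fun ω => W (t + v) ψ ω - W t ψ ω) ((hW.memLp _ _).sub (hW.memLp _ _))
      ((hW.memLp _ _).sub (hW.memLp _ _))
    rw [h0, h0, mul_zero, sub_zero, covariance_fun_sub_fun_sub (hW.memLp _ _) (hW.memLp _ _)
      (hW.memLp _ _) (hW.memLp _ _)] at h1
    simp only [Pi.mul_apply] at h1
    rw [← h1]
    simp only [hW.cov_eq]
    push_cast
    have e1 : min ((t : ℝ) + u) t = t := min_eq_right (by linarith [u.coe_nonneg])
    have e2 : min (t : ℝ) (t + v) = t := min_eq_left (by linarith [v.coe_nonneg])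
    rw [min_add_add_left, min_self, e1, e2]
    change _ = min (u : ℝ) v * ipForm φ ψ
    ring

lemma congr (hW : IsWhiteProcess P W) {W' : ℝ≥0 → TestForm d → Ω → ℝ}
    (h : ∀ t φ, W' t φ =ᵐ[P] W t φ) : IsWhiteProcess P W' := by
  refine ⟨hW.gaussian.congr fun p => (h p.1 p.2).symm, fun t φ => ?_, fun t u φ ψ => ?_⟩
  · rw [integral_congr_ae (h t φ), hW.mean_zero]
  · rw [← hW.covariance]
    refine integral_congr_ae ?_
    filter_upwards [h t φ, h u ψ] with ω h1 h2
    rw [h1, h2]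

/-- The law of white noise is determined by the definition. -/
lemma map_eq (hW : IsWhiteProcess P W) (hm : ∀ t φ, Measurable (W t φ)) {Ω' : Type}
    {mΩ' : MeasurableSpace Ω'} {P' : Measure Ω'} {W' : ℝ≥0 → TestForm d → Ω' → ℝ}
    (hW' : IsWhiteProcess P' W') (hm' : ∀ t φ, Measurable (W' t φ)) :
    P.map (fun ω (p : ℝ≥0 × TestForm d) => W p.1 p.2 ω)
      = P'.map (fun ω (p : ℝ≥0 × TestForm d) => W' p.1 p.2 ω) := by
  classical
  have hP := hW.isProbabilityMeasure
  have hP' := hW'.isProbabilityMeasure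
  have hM : Measurable (fun ω (p : ℝ≥0 × TestForm d) => W p.1 p.2 ω) :=
    measurable_pi_lambda _ fun p => hm p.1 p.2
  have hM' : Measurable (fun ω (p : ℝ≥0 × TestForm d) => W' p.1 p.2 ω) :=
    measurable_pi_lambda _ fun p => hm' p.1 p.2
  have := Measure.isProbabilityMeasure_map (μ := P) hM.aemeasurable
  have := Measure.isProbabilityMeasure_map (μ := P') hM'.aemeasurable
  refine IsProjectiveLimit.unique (P := fun I : Finset (ℝ≥0 × TestForm d) =>
    (P.map (fun ω (p : ℝ≥0 × TestForm d) => W p.1 p.2 ω)).map I.restrict) (fun I => rfl)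
    fun I => ?_
  rw [Measure.map_map (by fun_prop) hM']
  change _ = (P.map (fun ω (p : ℝ≥0 × TestForm d) => W p.1 p.2 ω)).map I.restrict
  rw [Measure.map_map (by fun_prop) hM]
  have hg : HasGaussianLaw (fun ω => I.restrict fun p : ℝ≥0 × TestForm d => W p.1 p.2 ω) P :=
    hW.gaussian.hasGaussianLaw I
  have hg' : HasGaussianLaw (fun ω => I.restrict fun p : ℝ≥0 × TestForm d => W' p.1 p.2 ω) P' :=
    hW'.gaussian.hasGaussianLaw I
  -- The characteristic function of a finite-dimensional marginal is expressed through the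
  -- prescribed covariance alone, so it agrees for any two such processes.
  have key : ∀ {Ω : Type} {mΩ : MeasurableSpace Ω} {P : Measure Ω} {W : ℝ≥0 → TestForm d → Ω → ℝ}
      (hW : IsWhiteProcess P W) (L : StrongDual ℝ (I → ℝ)),
      charFunDual (P.map fun ω => I.restrict fun p : ℝ≥0 × TestForm d => W p.1 p.2 ω) L
        = Complex.exp (-((∑ i : I, ∑ j : I, L (Pi.single i 1) * L (Pi.single j 1) *
          (min (i.1.1 : ℝ) j.1.1 * ipForm i.1.2 j.1.2) : ℝ) / 2)) := by
    intro Ω mΩ P W hW L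
    have := hW.isProbabilityMeasure
    have hg : HasGaussianLaw (fun ω => I.restrict fun p : ℝ≥0 × TestForm d => W p.1 p.2 ω) P :=
      hW.gaussian.hasGaussianLaw I
    have hL : (L ∘ fun ω => I.restrict fun p : ℝ≥0 × TestForm d => W p.1 p.2 ω)
        = fun ω => ∑ i : I, L (Pi.single i 1) * W i.1.1 i.1.2 ω := by
      funext ω
      simp only [Function.comp_apply]
      conv_lhs => rw [← L.coe_coe, LinearMap.pi_apply_eq_sum_univ (L : (I → ℝ) →ₗ[ℝ] ℝ)]
      refine Finset.sum_congr rfl fun i _ => ?_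
      rw [smul_eq_mul, mul_comm]
      congr 1
      simp only [ContinuousLinearMap.coe_coe]
      congr 1
      ext j
      simp [Pi.single_apply, eq_comm]
    have hmem : ∀ i : I, MemLp (fun ω => L (Pi.single i 1) * W i.1.1 i.1.2 ω) 2 P := fun i =>
      (hW.memLp _ _).const_mul _
    rw [hg.charFunDual_map_eq, hL, integral_finsetSum _ fun i _ => (hmem i).integrable one_le_two,
      ← covariance_self (Finset.aemeasurable_fun_sum _ fun i _ =>
        (hmem i).aestronglyMeasurable.aemeasurable), covariance_fun_sum_fun_sum hmem hmem]
    simp only [covariance_const_mul_left, covariance_const_mul_right, hW.cov_eq,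
      integral_const_mul, hW.mean_zero]
    simp only [mul_zero, Finset.sum_const_zero, Complex.ofReal_zero, zero_mul, zero_sub,
      mul_left_comm, mul_assoc]
  have := hg.isGaussian_map
  have := hg'.isGaussian_map
  refine Measure.ext_of_charFunDual (funext fun L => ?_)
  exact (key hW' L).trans (key hW L).symm

end IsWhiteProcess

/-! ### Existence of white noise -/

/-- The σ-algebras of the past of the process `W`, completed by the null sets. -/
def completedFiltration {Ω T : Type} {mΩ : MeasurableSpace Ω} (P : Measure Ω)
    (W : ℝ≥0 → T → Ω → ℝ) : Filtration ℝ≥0 mΩ where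
  seq t := @eventuallyMeasurableSpace Ω
    (MeasurableSpace.comap (fun ω (p : Set.Iic t × T) => W p.1 p.2 ω) MeasurableSpace.pi) (ae P) _
      ⊓ mΩ
  mono' t u htu := by
    refine inf_le_inf_right _ ?_
    rintro s ⟨s', hs', h⟩
    refine ⟨s', ?_, h⟩
    have hle : MeasurableSpace.comap (fun ω (p : Set.Iic t × T) => W p.1 p.2 ω)
        MeasurableSpace.pi ≤ MeasurableSpace.comap (fun ω (p : Set.Iic u × T) => W p.1 p.2 ω)
        MeasurableSpace.pi := by
      refine Measurable.comap_le ?_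
      refine @measurable_pi_lambda _ _ _ (MeasurableSpace.comap _ _) _ _ fun p => ?_
      exact (measurable_pi_apply (X := fun _ => ℝ)
        ((⟨p.1.1, Set.mem_Iic.mpr (p.1.2.trans htu)⟩, p.2) : Set.Iic u × T)).comp
        (comap_measurable _)
    exact hle s' hs'
  le' t := inf_le_right

/-- This is the purpose of the completion. The solution depends on the past noise only up to null
sets, since whether a noise path is good and equals its continuous modification involves the whole
path. -/
lemma measurable_completedFiltration {Ω T E : Type} {mΩ : MeasurableSpace Ω} {P : Measure Ω}
    {W : ℝ≥0 → T → Ω → ℝ} {mE : MeasurableSpace E} {t : ℝ≥0} {f g : Ω → E} (hf : Measurable f)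
    (hg : Measurable[MeasurableSpace.comap (fun ω (p : Set.Iic t × T) => W p.1 p.2 ω)
      MeasurableSpace.pi] g) (hfg : f =ᵐ[P] g) :
    Measurable[completedFiltration P W t] f := by
  intro s hs
  refine ⟨⟨g ⁻¹' s, hg hs, hfg.preimage s⟩, hf hs⟩

/-- Every event of the completed σ-algebra differs by a null set from an event of the past, which
changes no probability. -/
lemma indep_completedFiltration {Ω T : Type} {mΩ : MeasurableSpace Ω} {P : Measure Ω}
    {W : ℝ≥0 → T → Ω → ℝ} {t : ℝ≥0} {m : MeasurableSpace Ω}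
    (h : Indep m (MeasurableSpace.comap (fun ω (p : Set.Iic t × T) => W p.1 p.2 ω)
      MeasurableSpace.pi) P) :
    Indep m (completedFiltration P W t) P := by
  rw [Indep_iff] at h ⊢
  rintro s u hs ⟨⟨u', hu', huu⟩, -⟩
  rw [measure_congr (huu : u =ᵐ[P] u'), ← h s u' hs hu']
  exact measure_congr (EventuallyEq.rfl.inter huu)

/-! ### The vectors of `L²(ℝ_+ × T^d; ℝ^d)` that represent the noise -/

/-- The indicator of `(0, t]` times `φ`. -/
def noiseVecFun {d : ℕ} (t : ℝ≥0) (φ : TestForm d) (p : ℝ × (Fin d → ℝ)) :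
    EuclideanSpace ℝ (Fin d) :=
  (Set.Ioc (0 : ℝ) t).indicator (fun _ => (1 : ℝ)) p.1 • WithLp.toLp 2 fun j => (φ j).1 p.2

/-- Lebesgue measure on `ℝ_+ × T^d`. -/
def spaceTime (d : ℕ) : Measure (ℝ × (Fin d → ℝ)) :=
  (volume.restrict (Set.Ioi (0 : ℝ))).prod (volume.restrict (Set.Icc (0 : Fin d → ℝ) 1))

lemma inner_noiseVecFun {d : ℕ} (t u : ℝ≥0) (φ ψ : TestForm d) (p : ℝ × (Fin d → ℝ)) :
    inner ℝ (noiseVecFun t φ p) (noiseVecFun u ψ p)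
      = (Set.Ioc (0 : ℝ) (min (t : ℝ) u)).indicator (fun _ => (1 : ℝ)) p.1
        * ∑ j, (φ j).1 p.2 * (ψ j).1 p.2 := by
  have h1 : (Set.Ioc (0 : ℝ) (min (t : ℝ) u)).indicator (fun _ => (1 : ℝ)) p.1
      = (Set.Ioc (0 : ℝ) t).indicator (fun _ => (1 : ℝ)) p.1
        * (Set.Ioc (0 : ℝ) u).indicator (fun _ => (1 : ℝ)) p.1 := by
    simp only [Set.indicator_apply, Set.mem_Ioc, le_min_iff]
    split_ifs <;> simp_all
  rw [h1, noiseVecFun, noiseVecFun, real_inner_smul_left, real_inner_smul_right, ← mul_assoc]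
  congr 1
  simp [PiLp.inner_apply, mul_comm]

lemma measurable_noiseVecFun {d : ℕ} (t : ℝ≥0) (φ : TestForm d) :
    Measurable (noiseVecFun t φ) := by
  have h1 : Measurable fun p : ℝ × (Fin d → ℝ) =>
      (Set.Ioc (0 : ℝ) t).indicator (fun _ => (1 : ℝ)) p.1 :=
    (measurable_const.indicator measurableSet_Ioc).comp measurable_fst
  have h2 : Measurable fun p : ℝ × (Fin d → ℝ) =>
      (WithLp.toLp 2 fun j => (φ j).1 p.2 : EuclideanSpace ℝ (Fin d)) := by
    have : Continuous fun x : Fin d → ℝ =>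
        (WithLp.toLp 2 fun j => (φ j).1 x : EuclideanSpace ℝ (Fin d)) :=
      (PiLp.continuous_toLp 2 _).comp (continuous_pi fun j => continuous_testFun (φ j))
    exact this.measurable.comp measurable_snd
  exact h1.smul h2

lemma integral_indicator_Ioc {t : ℝ} (ht : 0 ≤ t) :
    ∫ r in Set.Ioi (0 : ℝ), (Set.Ioc (0 : ℝ) t).indicator (fun _ => (1 : ℝ)) r = t := by
  rw [integral_indicator measurableSet_Ioc, Measure.restrict_restrict measurableSet_Ioc,
    Set.inter_eq_left.mpr Set.Ioc_subset_Ioi_self]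
  simp [ht]

lemma memLp_noiseVecFun {d : ℕ} (t : ℝ≥0) (φ : TestForm d) :
    MemLp (noiseVecFun t φ) 2 (spaceTime d) := by
  rw [memLp_two_iff_integrable_sq_norm (measurable_noiseVecFun t φ).aestronglyMeasurable]
  simp only [← real_inner_self_eq_norm_sq, inner_noiseVecFun, min_self]
  refine Integrable.mul_prod (f := (Set.Ioc (0 : ℝ) t).indicator fun _ => (1 : ℝ))
    (g := fun x => ∑ j, (φ j).1 x * (φ j).1 x) ?_ ?_
  · refine Integrable.mono_measure ?_ Measure.restrict_le_self
    exact (integrable_indicator_iff measurableSet_Ioc).mpr (integrableOn_const (by simp))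
  · exact integrable_finsetSum _ fun j _ => integrableOn_cell (continuous_mul_testFun (φ j) (φ j))

/-- The element of `L²(ℝ_+ × T^d; ℝ^d)` whose image under space-time white noise is `W_t(φ)`. -/
def noiseVec {d : ℕ} (t : ℝ≥0) (φ : TestForm d) : Lp (EuclideanSpace ℝ (Fin d)) 2 (spaceTime d) :=
  (memLp_noiseVecFun t φ).toLp _

lemma inner_noiseVec {d : ℕ} (t u : ℝ≥0) (φ ψ : TestForm d) :
    inner ℝ (noiseVec t φ) (noiseVec u ψ) = min (t : ℝ) u * ipForm φ ψ := by
  rw [L2.inner_def]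
  have h1 : ∫ p, inner ℝ ((noiseVec t φ : ℝ × (Fin d → ℝ) → _) p) ((noiseVec u ψ : ℝ × (Fin d → ℝ) → _) p)
        ∂(spaceTime d)
      = ∫ p, (Set.Ioc (0 : ℝ) (min (t : ℝ) u)).indicator (fun _ => (1 : ℝ)) p.1
        * (∑ j, (φ j).1 p.2 * (ψ j).1 p.2) ∂(spaceTime d) := by
    refine integral_congr_ae ?_
    filter_upwards [(memLp_noiseVecFun t φ).coeFn_toLp, (memLp_noiseVecFun u ψ).coeFn_toLp]
      with p h1 h2
    rw [noiseVec, noiseVec, h1, h2, inner_noiseVecFun]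
  rw [h1, spaceTime, integral_prod_mul (f := (Set.Ioc (0 : ℝ) (min (t : ℝ) u)).indicator
    fun _ => (1 : ℝ)) (g := fun x => ∑ j, (φ j).1 x * (ψ j).1 x),
    integral_indicator_Ioc (le_min t.coe_nonneg u.coe_nonneg)]
  rfl

/-- There is a white noise, with respect to a complete filtration. -/
theorem exists_isWhiteNoise (d : ℕ) : ∃ (Ω : Type) (_mΩ : MeasurableSpace Ω) (P : Measure Ω)
    (W : ℝ≥0 → TestForm d → Ω → ℝ),
      IsProbabilityMeasure P ∧ IsWhiteNoise P (completedFiltration P W) W := by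
  obtain ⟨Ω, mΩ, P, ξ, hP, hξ⟩ :=
    exists_isIsonormal (Lp (EuclideanSpace ℝ (Fin d)) 2 (spaceTime d))
  let W₀ : ℝ≥0 → TestForm d → Ω → ℝ := fun t φ => ξ (noiseVec t φ)
  have hW₀ : IsWhiteProcess P W₀ := by
    refine ⟨hξ.gaussian.comp_right fun p : ℝ≥0 × TestForm d => noiseVec p.1 p.2,
      fun t φ => hξ.mean_zero _, fun t u φ ψ => ?_⟩
    rw [hξ.covariance, inner_noiseVec]
    rfl
  -- Each path is replaced by its continuous modification; for fixed `t` and `φ` this alters a null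
  -- set only, so Gaussianity and covariance are preserved.
  let W : ℝ≥0 → TestForm d → Ω → ℝ := fun t φ ω => contMod (fun r => W₀ r φ ω) t
  have hae : ∀ t φ, W t φ =ᵐ[P] W₀ t φ := fun t φ =>
    (hW₀.hasGaussianIncrements φ (Real.le_coe_toNNReal _)).contMod_ae_eq t
  have hW : IsWhiteProcess P W := hW₀.congr hae
  have hm : ∀ t φ, Measurable (W t φ) := fun t φ =>
    measurable_contMod (fun r => hξ.measurable _) t
  refine ⟨Ω, mΩ, P, W, hP, hW.gaussian, hW.mean_zero, hW.covariance,
    fun φ => ae_of_all _ fun ω => continuous_contMod _, fun t φ => ?_, fun t u htu => ?_⟩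
  · refine measurable_completedFiltration (hm t φ) (g := W t φ) ?_ EventuallyEq.rfl
    exact (measurable_pi_apply (X := fun _ => ℝ) ((⟨t, Set.mem_Iic.mpr le_rfl⟩, φ) : Set.Iic t × TestForm d)).comp
      (comap_measurable _)
  · refine indep_completedFiltration ?_
    refine indep_of_indep_of_le_left (hW.indepFun_increments t) (iSup_le fun φ => ?_)
    have h1 : (fun ω => W u φ ω - W t φ ω) = (fun f : ℝ≥0 × TestForm d → ℝ => f (u - t, φ)) ∘
        fun ω (p : ℝ≥0 × TestForm d) => W (t + p.1) p.2 ω - W t p.2 ω := by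
      funext ω
      simp [add_tsub_cancel_of_le htu]
    rw [h1, ← MeasurableSpace.comap_comp]
    exact MeasurableSpace.comap_mono (measurable_pi_apply _).comap_le

end AbelianYM

end

noncomputable section

namespace AbelianYM

/-! ### The solution as a function of the noise -/

/-- A Hölder exponent below `1/2` which is good enough for the noise in dimension `d` to give a
solution of class `H^{-s}`. -/
def noiseExponent (d : ℕ) (s : ℝ) : ℝ := (max (((d : ℝ) - 2 * s) / 4) 0 + 1 / 2) / 2

lemma noiseExponent_pos (d : ℕ) (s : ℝ) : 0 < noiseExponent d s := by
  have := le_max_right (((d : ℝ) - 2 * s) / 4) 0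
  unfold noiseExponent
  linarith

/-- Here the assumption on `s` enters: `s > d/2 - 1` says precisely that `(d - 2s)/4 < 1/2`, so
there is room for an exponent below `1/2`. -/
lemma noiseExponent_lt {d : ℕ} {s : ℝ} (hs : (d : ℝ) / 2 - 1 < s) : noiseExponent d s < 1 / 2 := by
  have : max (((d : ℝ) - 2 * s) / 4) 0 < 1 / 2 := max_lt (by linarith) (by norm_num)
  unfold noiseExponent
  linarith

/-- The exponent is the midpoint of an interval whose left end is at least `(d - 2s)/4`, hence
strictly larger than this threshold; that makes `wt ^ (-s - 2γ)` summable. -/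
lemma noiseExponent_spec {d : ℕ} {s : ℝ} (hs : (d : ℝ) / 2 - 1 < s) :
    -s - 2 * noiseExponent d s < -((d : ℝ) / 2) := by
  have h1 : max (((d : ℝ) - 2 * s) / 4) 0 < 1 / 2 := max_lt (by linarith) (by norm_num)
  have h2 := le_max_left (((d : ℝ) - 2 * s) / 4) 0
  unfold noiseExponent
  linarith

variable {d : ℕ} {s : ℝ}

lemma wt_le_one_add_eigen (m : Mode d) : wt m.1 ≤ 1 + eigen m := by
  unfold wt eigen
  refine add_le_add le_rfl (Finset.sum_le_sum fun i _ => ?_)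
  have : (1 : ℝ) ≤ 2 * Real.pi := by linarith [Real.pi_gt_three]
  rw [mul_pow]
  exact le_mul_of_one_le_left (sq_nonneg _) (one_le_pow₀ this)

/-- The Hölder constant of the `i`-th noise path. -/
def noiseConst (s : ℝ) (N : ℕ) (v : Fin d × Mode d → ℝ≥0 → ℝ) (i : Fin d × Mode d) : ℝ≥0∞ :=
  dyadicConst (noiseExponent d s) N (contMod (v i))

/-- The conditions on the family of noise paths under which the equation is solved. -/
structure IsGood (s : ℝ) (v : Fin d × Mode d → ℝ≥0 → ℝ) : Prop where
  zero : ∀ i, contMod (v i) 0 = 0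
  cos : ∀ j k n l, contMod (v (j, (-k, false))) (dyadic n l)
    = contMod (v (j, (k, false))) (dyadic n l)
  sin : ∀ j k n l, contMod (v (j, (-k, true))) (dyadic n l)
    = -contMod (v (j, (k, true))) (dyadic n l)
  sum : ∀ N : ℕ, ∑' i : Fin d × Mode d,
    ENNReal.ofReal (wt i.2.1 ^ (-s) * (1 + eigen i.2) ^ (-2 * noiseExponent d s))
      * noiseConst s N v i ^ 2 ≠ ∞

open Classical in
/-- The solution of `∂_t A = Δ A + C A + ξ` with initial condition `a`, where `v` are the Fourier
modes of the primitive of `ξ`. -/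
def flow (C : ℝ) (a : OneForm d s) (v : Fin d × Mode d → ℝ≥0 → ℝ) (t : ℝ≥0) : OneForm d s :=
  if IsGood s v then fun j => ofModes s fun m =>
    ou (eigen m - C) (formModes a (j, m)) (contMod (v (j, m))) t
  else a

namespace IsGood

variable {v : Fin d × Mode d → ℝ≥0 → ℝ}

lemma weight_pos (s : ℝ) (i : Fin d × Mode d) :
    0 < wt i.2.1 ^ (-s) * (1 + eigen i.2) ^ (-2 * noiseExponent d s) :=
  mul_pos (Real.rpow_pos_of_pos (wt_pos _) _)
    (Real.rpow_pos_of_pos (by linarith [eigen_nonneg i.2]) _)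

lemma noiseConst_ne_top (hv : IsGood s v) (N : ℕ) (i : Fin d × Mode d) :
    noiseConst s N v i ≠ ∞ := by
  have h1 := ENNReal.ne_top_of_tsum_ne_top (hv.sum N) i
  intro h
  rw [h] at h1
  refine h1 ?_
  rw [ENNReal.top_pow two_ne_zero, ENNReal.mul_top]
  exact (ENNReal.ofReal_pos.mpr (weight_pos s i)).ne'

lemma holder (hs : (d : ℝ) / 2 - 1 < s) (hv : IsGood s v) (N : ℕ) (i : Fin d × Mode d)
    {r t : ℝ≥0} (hrt : r ≤ t) (ht : t ≤ N) :
    |contMod (v i) t - contMod (v i) r| ≤ holderFactor (noiseExponent d s) N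
      * (noiseConst s N v i).toReal * (t - r : ℝ) ^ noiseExponent d s :=
  (dyadicBound_of_dyadicConst_ne_top (hv.noiseConst_ne_top N i)).holder (noiseExponent_pos d s)
    (by linarith [noiseExponent_lt hs]) ENNReal.toReal_nonneg
    (fun t _ => ((continuous_contMod (v i)).tendsto t).comp (tendsto_dyadicFloor t)) hrt ht

lemma summable_noiseConst (hv : IsGood s v) (N : ℕ) : Summable fun i : Fin d × Mode d =>
    wt i.2.1 ^ (-s) * (1 + eigen i.2) ^ (-2 * noiseExponent d s)
      * (noiseConst s N v i).toReal ^ 2 := by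
  refine (ENNReal.summable_toReal (hv.sum N)).congr fun i => ?_
  rw [ENNReal.toReal_mul, ENNReal.toReal_ofReal (weight_pos s i).le, ENNReal.toReal_pow]

/-- A bound for the modes of the solution up to time `N`. -/
lemma abs_ou_le (hs : (d : ℝ) / 2 - 1 < s) (hv : IsGood s v) (C : ℝ) (N : ℕ)
    (i : Fin d × Mode d) (y : ℝ) {t : ℝ≥0} (ht : t ≤ N) :
    |ou (eigen i.2 - C) y (contMod (v i)) t| ≤ Real.exp (|C| * N) * |y|
      + Real.exp ((1 + |C|) * N) * (5 + 2 * |C|) * holderFactor (noiseExponent d s) N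
        * ((noiseConst s N v i).toReal * (1 + eigen i.2) ^ (-noiseExponent d s)) := by
  rw [ou_add]
  refine (abs_add_le _ _).trans (add_le_add ?_ ?_)
  · rw [abs_mul, Real.abs_exp]
    refine mul_le_mul_of_nonneg_right (Real.exp_le_exp.mpr ?_) (abs_nonneg _)
    have h1 : (t : ℝ) ≤ N := by exact_mod_cast ht
    calc -(eigen i.2 - C) * t ≤ |C| * t := by
          refine mul_le_mul_of_nonneg_right ?_ t.coe_nonneg
          linarith [eigen_nonneg i.2, le_abs_self C]
      _ ≤ |C| * N := by gcongr
  · have h := AbelianYM.abs_ou_le (continuous_contMod (v i)) (hv.zero i) (T := N)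
      (noiseExponent_pos d s) (by linarith [noiseExponent_lt hs])
      (mul_nonneg (holderFactor_nonneg (noiseExponent_pos d s) N) ENNReal.toReal_nonneg)
      (fun r t hrt ht => hv.holder hs N i hrt ht) (κ := 1 + eigen i.2) (C := C)
      (by linarith [eigen_nonneg i.2]) ht
    rw [show 1 + eigen i.2 - 1 - C = eigen i.2 - C by ring] at h
    refine h.trans (le_of_eq ?_)
    rw [NNReal.coe_natCast]
    ring

/-- The domination that `continuous_ofModes` requires. The initial condition grows at most like `exp
(|C| N)`, and the noise contributes its Hölder constant times `(1 + eigen m)^(-γ)`, square summable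
by the condition `sum` of `IsGood`. -/
lemma exists_bound (hs : (d : ℝ) / 2 - 1 < s) (hv : IsGood s v) (C : ℝ) (a : OneForm d s)
    (j : Fin d) (N : ℕ) : ∃ b : Mode d → ℝ, (Summable fun m => wt m.1 ^ (-s) * b m ^ 2) ∧
      ∀ t : ℝ≥0, t ≤ N → ∀ m,
        |ou (eigen m - C) (formModes a (j, m)) (contMod (v (j, m))) t| ≤ b m := by
  set D := Real.exp ((1 + |C|) * N) * (5 + 2 * |C|) * holderFactor (noiseExponent d s) N
  refine ⟨fun m => Real.exp (|C| * N) * |formModes a (j, m)|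
    + D * ((noiseConst s N v (j, m)).toReal * (1 + eigen m) ^ (-noiseExponent d s)), ?_,
    fun t ht m => hv.abs_ou_le hs C N (j, m) _ ht⟩
  have h1 : Summable fun m : Mode d => wt m.1 ^ (-s) * formModes a (j, m) ^ 2 :=
    summable_sq_modes (a j)
  have h2 : Summable fun m : Mode d => wt m.1 ^ (-s) *
      ((noiseConst s N v (j, m)).toReal * (1 + eigen m) ^ (-noiseExponent d s)) ^ 2 := by
    have h3 := (hv.summable_noiseConst N).comp_injective (Prod.mk_right_injective j)
    refine h3.congr fun m => ?_
    have hp : 0 < 1 + eigen m := by linarith [eigen_nonneg m]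
    simp only [Function.comp_apply]
    rw [mul_pow, ← Real.rpow_natCast ((1 + eigen m) ^ _), ← Real.rpow_mul hp.le,
      show -noiseExponent d s * ((2 : ℕ) : ℝ) = -2 * noiseExponent d s by push_cast; ring]
    ring
  have hw : ∀ m : Mode d, 0 ≤ wt m.1 ^ (-s) := fun m => Real.rpow_nonneg (wt_pos m.1).le _
  refine Summable.of_nonneg_of_le (fun m => mul_nonneg (hw m) (sq_nonneg _)) (fun m => ?_)
    ((h1.mul_left (2 * Real.exp (|C| * N) ^ 2)).add (h2.mul_left (2 * D ^ 2)))
  set p := Real.exp (|C| * N) * |formModes a (j, m)|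
  set q := D * ((noiseConst s N v (j, m)).toReal * (1 + eigen m) ^ (-noiseExponent d s))
  have e1 : 2 * Real.exp (|C| * N) ^ 2 * (wt m.1 ^ (-s) * formModes a (j, m) ^ 2)
      = wt m.1 ^ (-s) * (2 * p ^ 2) := by
    simp only [p, mul_pow, sq_abs]; ring
  have e2 : 2 * D ^ 2 * (wt m.1 ^ (-s) *
      ((noiseConst s N v (j, m)).toReal * (1 + eigen m) ^ (-noiseExponent d s)) ^ 2)
      = wt m.1 ^ (-s) * (2 * q ^ 2) := by
    simp only [q, mul_pow]; ring
  rw [e1, e2, ← mul_add]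
  refine mul_le_mul_of_nonneg_left ?_ (hw m)
  nlinarith [sq_nonneg (p - q)]

lemma summable_ou (hs : (d : ℝ) / 2 - 1 < s) (hv : IsGood s v) (C : ℝ) (a : OneForm d s)
    (j : Fin d) (t : ℝ≥0) : Summable fun m : Mode d => wt m.1 ^ (-s) *
      ou (eigen m - C) (formModes a (j, m)) (contMod (v (j, m))) t ^ 2 :=
  (continuous_ofModes (fun _ => continuous_ou (continuous_contMod _) _ _)
    (hv.exists_bound hs C a j)).1 t

/-- `IsGood` asks for the symmetry at dyadic times only, so that it is a countable family of
conditions; continuity extends it to all times. -/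
lemma contMod_cos (hv : IsGood s v) (j : Fin d) (k : Fin d → ℤ) :
    contMod (v (j, (-k, false))) = contMod (v (j, (k, false))) := by
  funext t
  have h1 := ((continuous_contMod (v (j, (-k, false)))).tendsto t).comp (tendsto_dyadicFloor t)
  have h2 := ((continuous_contMod (v (j, (k, false)))).tendsto t).comp (tendsto_dyadicFloor t)
  exact tendsto_nhds_unique h1 (h2.congr fun n => (hv.cos j k _ _).symm)

lemma contMod_sin (hv : IsGood s v) (j : Fin d) (k : Fin d → ℤ) :
    contMod (v (j, (-k, true))) = fun t => -contMod (v (j, (k, true))) t := by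
  funext t
  have h1 := ((continuous_contMod (v (j, (-k, true)))).tendsto t).comp (tendsto_dyadicFloor t)
  have h2 := ((continuous_contMod (v (j, (k, true)))).tendsto t).comp (tendsto_dyadicFloor t)
  exact tendsto_nhds_unique h1 (h2.neg.congr fun n => (hv.sin j k _ _).symm)

end IsGood

lemma eigen_neg (k : Fin d → ℤ) (b : Bool) : eigen ((-k, b) : Mode d) = eigen (k, b) := by
  simp [eigen]

lemma ou_neg {w : ℝ≥0 → ℝ} (hw : Continuous w) (μ y : ℝ) (t : ℝ≥0) :
    ou μ (-y) (fun r => -w r) t = -ou μ y w t := by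
  rw [ou_eq_of_continuous (w := fun r => -w r) hw.neg, ou_eq_of_continuous hw]
  simp only [mul_neg, intervalIntegral.integral_neg]
  ring

lemma continuous_flow (hs : (d : ℝ) / 2 - 1 < s) (C : ℝ) (a : OneForm d s)
    (v : Fin d × Mode d → ℝ≥0 → ℝ) : Continuous (flow C a v) := by
  by_cases hv : IsGood s v
  · have : flow C a v = fun t j => ofModes s fun m =>
        ou (eigen m - C) (formModes a (j, m)) (contMod (v (j, m))) t := by
      funext t; rw [flow, if_pos hv]
    rw [this]
    exact continuous_pi fun j => (continuous_ofModes
      (fun _ => continuous_ou (continuous_contMod _) _ _) (hv.exists_bound hs C a j)).2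
  · have : flow C a v = fun _ => a := by
      funext t; rw [flow, if_neg hv]
    rw [this]
    exact continuous_const

/-- Values of `ofModes` on the modes. -/
lemma ofModes_mode {y : Mode d → ℝ} (hy : Summable fun m => wt m.1 ^ (-s) * y m ^ 2)
    (hc : ∀ k, y (-k, false) = y (k, false)) (hsin : ∀ k, y (-k, true) = -y (k, true))
    (n : Mode d) : (ofModes s y).1 (mode n) = y n := by
  have h1 := (hasSum_ofModes hy (mode n)).comp tendsto_box
  obtain ⟨N₀, hN₀⟩ := exists_box_subset {n}
  have hn : n.1 ∈ box d N₀ := (Finset.mem_product.mp (hN₀ (Finset.mem_singleton_self n))).1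
  refine tendsto_nhds_unique h1 (tendsto_const_nhds.congr' ?_)
  filter_upwards [eventually_ge_atTop N₀] with N hN
  have hn' : n.1 ∈ box d N := by
    refine Finset.Icc_subset_Icc ?_ ?_ hn <;> intro i <;> simp [hN]
  have h2 := coef_trigPoly hc hsin N n
  rw [if_pos hn'] at h2
  rw [← h2, trigPoly, coef_sum]
  refine Finset.sum_congr rfl fun _ _ => ?_
  rw [coef_smul, mul_comm]
  simp only [coef, ip_comm]

/-- As the modes are overcomplete, a prescribed family is attained only if it has the parity in `k`
of a genuine functional. The initial condition has it, the noise has it by `IsGood`, and the scalar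
equation preserves it because its rate is even in `k`. -/
lemma formModes_flow (hs : (d : ℝ) / 2 - 1 < s) (C : ℝ) (a : OneForm d s)
    {v : Fin d × Mode d → ℝ≥0 → ℝ} (hv : IsGood s v) (t : ℝ≥0) (i : Fin d × Mode d) :
    formModes (flow C a v t) i = ou (eigen i.2 - C) (formModes a i) (contMod (v i)) t := by
  rw [flow, if_pos hv]
  refine ofModes_mode (hv.summable_ou hs C a i.1 t) (fun k => ?_) (fun k => ?_) i.2
  · rw [eigen_neg, hv.contMod_cos]
    congr 1
    exact apply_mode_neg_cos _ _
  · rw [eigen_neg, hv.contMod_sin, ← ou_neg (continuous_contMod _)]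
    congr 1
    exact apply_mode_neg_sin _ _

lemma ext_formModes {a b : OneForm d s} (h : ∀ i, formModes a i = formModes b i) : a = b := by
  funext j
  refine Subtype.ext (LinearMap.ext fun φ => ?_)
  refine (hasSum_apply (a j) φ).unique ?_
  have h1 := hasSum_apply (b j) φ
  have h2 : ∀ m, (a j).1 (mode m) = (b j).1 (mode m) := fun m => h (j, m)
  simp only [h2]
  exact h1

lemma ou_zero {w : ℝ≥0 → ℝ} (hw : Continuous w) (μ y : ℝ) : ou μ y w 0 = w 0 + y := by
  rw [ou_eq_of_continuous hw]
  simp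

lemma flow_zero (hs : (d : ℝ) / 2 - 1 < s) (C : ℝ) (a : OneForm d s)
    (v : Fin d × Mode d → ℝ≥0 → ℝ) : flow C a v 0 = a := by
  by_cases hv : IsGood s v
  · refine ext_formModes fun i => ?_
    rw [formModes_flow hs C a hv, ou_zero (continuous_contMod _), hv.zero, zero_add]
  · rw [flow, if_neg hv]

/-- All conditions are countable in number and involve the noise through measurable functionals of
its modifications. -/
lemma measurableSet_isGood {Ω : Type*} {mΩ : MeasurableSpace Ω}
    {V : Fin d × Mode d → ℝ≥0 → Ω → ℝ} (hV : ∀ i t, Measurable (V i t)) (s : ℝ) :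
    MeasurableSet {ω | IsGood s fun i t => V i t ω} := by
  have hc : ∀ i t, Measurable fun ω => contMod (fun r => V i r ω) t := fun i t =>
    measurable_contMod (hV i) t
  have h : {ω | IsGood s fun i t => V i t ω} =
      (⋂ i, {ω | contMod (fun r => V i r ω) 0 = 0}) ∩
      (⋂ (j) (k) (n) (l), {ω | contMod (fun r => V (j, (-k, false)) r ω) (dyadic n l)
        = contMod (fun r => V (j, (k, false)) r ω) (dyadic n l)}) ∩
      (⋂ (j) (k) (n) (l), {ω | contMod (fun r => V (j, (-k, true)) r ω) (dyadic n l)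
        = -contMod (fun r => V (j, (k, true)) r ω) (dyadic n l)}) ∩
      (⋂ N : ℕ, {ω | ∑' i : Fin d × Mode d,
        ENNReal.ofReal (wt i.2.1 ^ (-s) * (1 + eigen i.2) ^ (-2 * noiseExponent d s))
          * noiseConst s N (fun i t => V i t ω) i ^ 2 ≠ ∞}) := by
    ext ω
    simp only [Set.mem_inter_iff, Set.mem_iInter, Set.mem_ofPred_eq]
    exact ⟨fun h => ⟨⟨⟨h.zero, h.cos⟩, h.sin⟩, h.sum⟩, fun h => ⟨h.1.1.1, h.1.1.2, h.1.2, h.2⟩⟩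
  rw [h]
  refine (((MeasurableSet.iInter fun i => ?_).inter ?_).inter ?_).inter
    (MeasurableSet.iInter fun N => ?_)
  · exact measurableSet_eq_fun (hc i 0) measurable_const
  · exact MeasurableSet.iInter fun j => MeasurableSet.iInter fun k => MeasurableSet.iInter fun n =>
      MeasurableSet.iInter fun l => measurableSet_eq_fun (hc _ _) (hc _ _)
  · exact MeasurableSet.iInter fun j => MeasurableSet.iInter fun k => MeasurableSet.iInter fun n =>
      MeasurableSet.iInter fun l => measurableSet_eq_fun (hc _ _) (hc _ _).neg
  · have hm : Measurable fun ω => ∑' i : Fin d × Mode d,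
        ENNReal.ofReal (wt i.2.1 ^ (-s) * (1 + eigen i.2) ^ (-2 * noiseExponent d s))
          * noiseConst s N (fun i t => V i t ω) i ^ 2 :=
      Measurable.tsum fun i =>
        ((measurable_dyadicConst (fun t => hc i t) _ N).pow_const 2).const_mul _
    exact hm (measurableSet_singleton ∞).compl

/-- The solution depends measurably on the initial condition and the noise. -/
lemma measurable_flow (hs : (d : ℝ) / 2 - 1 < s) {Ω : Type*} {mΩ : MeasurableSpace Ω}
    {V : Fin d × Mode d → ℝ≥0 → Ω → ℝ} (hV : ∀ i t, Measurable (V i t)) (C : ℝ)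
    {a : Ω → OneForm d s} (ha : Measurable a) (t : ℝ≥0) :
    Measurable fun ω => flow C (a ω) (fun i r => V i r ω) t := by
  classical
  refine measurable_oneForm_iff.mpr fun i => ?_
  have h : (fun ω => formModes (flow C (a ω) (fun i r => V i r ω) t) i) = fun ω =>
      if IsGood s fun i t => V i t ω then
        Real.exp (-(eigen i.2 - C) * t) * formModes (a ω) i
          + ou (eigen i.2 - C) 0 (fun r => contMod (fun r => V i r ω) r) t
      else formModes (a ω) i := by
    funext ω
    split_ifs with hg
    · rw [formModes_flow hs C (a ω) hg, ou_add]
    · rw [flow, if_neg hg]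
  have ha' : Measurable fun ω => formModes (a ω) i := measurable_oneForm_iff.mp ha i
  rw [h]
  exact Measurable.ite (measurableSet_isGood hV s)
    ((ha'.const_mul _).add (measurable_ou (fun r _ => measurable_contMod (hV i) r) _ _)) ha'

end AbelianYM

end

noncomputable section

namespace AbelianYM

variable {d : ℕ} {s : ℝ}

/-! ### Solutions of the equation -/

/-- The Fourier modes, as test forms. -/
def formMode (i : Fin d × Mode d) : TestForm d := Pi.single i.1 (mode i.2)

/-- The Fourier modes of the noise. -/
def modePath {Ω : Type*} (W : ℝ≥0 → TestForm d → Ω → ℝ) (ω : Ω) (i : Fin d × Mode d)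
    (t : ℝ≥0) : ℝ := W t (formMode i) ω

lemma pair_formMode (a : OneForm d s) (i : Fin d × Mode d) :
    pair a (formMode i) = formModes a i := by
  rw [pair, Finset.sum_eq_single i.1]
  · simp [formMode, formModes]
  · intro j _ hj
    simp [formMode, hj]
  · simp

lemma pair_add (a : OneForm d s) (φ ψ : TestForm d) : pair a (φ + ψ) = pair a φ + pair a ψ := by
  simp [pair, Finset.sum_add_distrib]

lemma pair_smul (a : OneForm d s) (c : ℝ) (φ : TestForm d) : pair a (c • φ) = c * pair a φ := by
  simp [pair, Finset.mul_sum]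

lemma pair_sub (a : OneForm d s) (φ ψ : TestForm d) : pair a (φ - ψ) = pair a φ - pair a ψ := by
  simp [pair, Finset.sum_sub_distrib]

lemma pair_sum (a : OneForm d s) {ι : Type*} (S : Finset ι) (c : ι → ℝ) (f : ι → TestForm d) :
    pair a (∑ i ∈ S, c i • f i) = ∑ i ∈ S, c i * pair a (f i) := by
  classical
  induction S using Finset.induction_on with
  | empty => simp [pair]
  | insert i S hi ih => rw [Finset.sum_insert hi, Finset.sum_insert hi, pair_add, pair_smul, ih]

lemma genOp_formMode (C : ℝ) (i : Fin d × Mode d) :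
    genOp C (formMode i) = (-(eigen i.2 - C)) • formMode i := by
  funext j
  by_cases hj : j = i.1
  · subst hj
    simp only [genOp, formMode, Pi.single_eq_same, laplacian_mode, Pi.smul_apply]
    rw [← add_smul]
    congr 1; ring
  · have h0 : laplacian (0 : TestFun d) = 0 := by
      have := laplacian_smul 0 (0 : TestFun d)
      simpa using this
    simp [genOp, formMode, hj, h0]

lemma genOp_sum (C : ℝ) {ι : Type*} (S : Finset ι) (c : ι → ℝ) (f : ι → TestForm d) :
    genOp C (∑ i ∈ S, c i • f i) = ∑ i ∈ S, c i • genOp C (f i) := by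
  classical
  have h0 : laplacian (0 : TestFun d) = 0 := by
    have := laplacian_smul 0 (0 : TestFun d)
    simpa using this
  induction S using Finset.induction_on with
  | empty => funext j; simp [genOp, h0]
  | insert i S hi ih =>
    rw [Finset.sum_insert hi, Finset.sum_insert hi, ← ih]
    funext j
    simp only [genOp, Pi.add_apply, Pi.smul_apply, laplacian_add, laplacian_smul, smul_add]
    rw [smul_comm C (c i)]
    abel

lemma continuous_pair (φ : TestForm d) : Continuous fun a : OneForm d s => pair a φ :=
  continuous_finsetSum _ fun j _ => (continuous_apply (φ j)).comp (_root_.continuous_apply j)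

lemma abs_pair_le (a : OneForm d s) (φ : TestForm d) :
    |pair a φ| ≤ ‖a‖ * ∑ j, √(hsq s (φ j)) := by
  rw [Finset.mul_sum]
  refine (Finset.abs_sum_le_sum_abs _ _).trans (Finset.sum_le_sum fun j _ => ?_)
  exact (abs_apply_le (a j) (φ j)).trans
    (mul_le_mul_of_nonneg_right (norm_le_pi_norm a j) (Real.sqrt_nonneg _))

/-- The truncated Fourier series of a test form. -/
def formSum (N : ℕ) (φ : TestForm d) : TestForm d := fun j => fourierSum N (φ j)

/-- The indices of the truncated Fourier series. -/
def formBox (d N : ℕ) : Finset (Fin d × Mode d) := Finset.univ ×ˢ (box d N ×ˢ Finset.univ)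

lemma formSum_eq (N : ℕ) (φ : TestForm d) :
    formSum N φ = ∑ i ∈ formBox d N, coef (φ i.1) i.2 • formMode i := by
  funext j
  rw [formBox, Finset.sum_product, Finset.sum_apply, Finset.sum_eq_single j]
  · rw [Finset.sum_apply]
    simp [formSum, fourierSum, trigPoly, formMode]
  · intro l _ hl
    rw [Finset.sum_apply]
    simp [formMode, hl.symm]
  · simp

lemma tendsto_sum_sqrt_hsq (s : ℝ) (φ : TestForm d) :
    Tendsto (fun N => ∑ j, √(hsq s ((φ - formSum N φ) j))) atTop (𝓝 0) := by
  have h : Tendsto (fun N => ∑ j, √(hsq s ((φ - formSum N φ) j))) atTop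
      (𝓝 (∑ _j : Fin d, √0)) :=
    tendsto_finsetSum _ fun j _ => (tendsto_hsq_sub_fourierSum s (φ j)).sqrt
  simpa using h

lemma tendsto_pair_formSum (a : OneForm d s) (φ : TestForm d) :
    Tendsto (fun N => pair a (formSum N φ)) atTop (𝓝 (pair a φ)) := by
  refine tendsto_finsetSum _ fun j _ => tendsto_apply_fourierSum (a j) (φ j)

lemma tendsto_ipForm_sub_formSum (φ : TestForm d) :
    Tendsto (fun N => ipForm (φ - formSum N φ) (φ - formSum N φ)) atTop (𝓝 0) := by
  simp only [ipForm_eq_sum]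
  have h : Tendsto (fun N => ∑ j, ip ((φ - formSum N φ) j) ((φ - formSum N φ) j)) atTop
      (𝓝 (∑ _j : Fin d, 0)) := by
    refine tendsto_finsetSum _ fun j _ => ?_
    simp only [ip_self_eq_hsq]
    exact tendsto_hsq_sub_fourierSum 0 (φ j)
  simpa using h

lemma ipForm_formMode_le (i : Fin d × Mode d) : ipForm (formMode i) (formMode i) ≤ 1 := by
  rw [ipForm_eq_sum, Finset.sum_eq_single i.1]
  · simp only [formMode, Pi.single_eq_same]
    refine (le_abs_self _).trans (abs_torusInt_le fun x => ?_)
    rw [abs_mul]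
    exact mul_le_one₀ (abs_mode_le _ _) (abs_nonneg _) (abs_mode_le _ _)
  · intro j _ hj
    simp only [formMode, Pi.single_eq_of_ne hj]
    exact (ipₗ 0).map_zero
  · simp

/-- The bilinear form `ipForm`. -/
def ipFormₗ (φ : TestForm d) : TestForm d →ₗ[ℝ] ℝ where
  toFun := ipForm φ
  map_add' ψ χ := by simp [ipForm_eq_sum, ip_add_right, Finset.sum_add_distrib]
  map_smul' c ψ := by simp [ipForm_eq_sum, ip_smul_right, Finset.mul_sum]

lemma ipForm_comm (φ ψ : TestForm d) : ipForm φ ψ = ipForm ψ φ := by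
  simp only [ipForm_eq_sum, ip_comm]

/-- The expansion is written in the shape in which bilinearity of the covariance expands the
corresponding combination of noise variables, so that the two can be compared term by term. -/
lemma ipForm_sub_sum (φ : TestForm d) {ι : Type*} (S : Finset ι) (c : ι → ℝ) (f : ι → TestForm d) :
    ipForm (φ - ∑ i ∈ S, c i • f i) (φ - ∑ i ∈ S, c i • f i) = ipForm φ φ
      - ∑ i ∈ S, c i * ipForm φ (f i) - ∑ i ∈ S, c i * ipForm (f i) φ
      + ∑ i ∈ S, ∑ j ∈ S, c i * (c j * ipForm (f i) (f j)) := by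
  have h1 : ∀ ψ : TestForm d, ipForm ψ (φ - ∑ i ∈ S, c i • f i)
      = ipForm ψ φ - ∑ i ∈ S, c i * ipForm ψ (f i) := fun ψ => by
    change ipFormₗ ψ (φ - ∑ i ∈ S, c i • f i) = _
    simp only [map_sub, map_sum, map_smul, smul_eq_mul]
    rfl
  have h2 : ∀ ψ : TestForm d, ipForm (φ - ∑ i ∈ S, c i • f i) ψ
      = ipForm φ ψ - ∑ i ∈ S, c i * ipForm (f i) ψ := fun ψ => by
    rw [ipForm_comm, h1, ipForm_comm ψ φ]
    simp only [ipForm_comm ψ]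
  rw [h1, h2]
  simp only [h2, mul_sub, Finset.sum_sub_distrib, Finset.mul_sum]
  rw [Finset.sum_comm]
  have : ∀ i j, c j * (c i * ipForm (f i) (f j)) = c i * (c j * ipForm (f i) (f j)) :=
    fun i j => by ring
  simp only [this]
  ring

/-! ### Almost sure linearity of the noise, and regularity of its modes -/

namespace IsWhiteProcess

variable {Ω : Type} {mΩ : MeasurableSpace Ω} {P : Measure Ω} {W : ℝ≥0 → TestForm d → Ω → ℝ}

/-- Linearity of `W t` in the test form is not part of the definition of white noise. It is
recovered in `L²` from the covariance, by computing the second moment of the defect. -/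
lemma lintegral_sub_sum (hW : IsWhiteProcess P W) (t : ℝ≥0) (φ : TestForm d) {ι : Type*}
    (S : Finset ι) (c : ι → ℝ) (f : ι → TestForm d) :
    ∫⁻ ω, ‖W t φ ω - ∑ i ∈ S, c i * W t (f i) ω‖ₑ ^ 2 ∂P
      = ENNReal.ofReal (t * ipForm (φ - ∑ i ∈ S, c i • f i) (φ - ∑ i ∈ S, c i • f i)) := by
  have := hW.isProbabilityMeasure
  have hm : ∀ i, MemLp (fun ω => c i * W t (f i) ω) 2 P := fun i => (hW.memLp t (f i)).const_mul _
  have hS : MemLp (fun ω => ∑ i ∈ S, c i * W t (f i) ω) 2 P := memLp_finsetSum _ fun i _ => hm i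
  have hZ : MemLp (fun ω => W t φ ω - ∑ i ∈ S, c i * W t (f i) ω) 2 P := (hW.memLp t φ).sub hS
  have hmean : ∫ ω, (W t φ ω - ∑ i ∈ S, c i * W t (f i) ω) ∂P = 0 := by
    rw [integral_sub ((hW.memLp t φ).integrable one_le_two) (hS.integrable one_le_two),
      integral_finsetSum _ fun i _ => (hm i).integrable one_le_two]
    simp [integral_const_mul, hW.mean_zero]
  have hvar := covariance_eq_sub hZ hZ
  rw [hmean, mul_zero, sub_zero, covariance_fun_sub_fun_sub (hW.memLp t φ) hS (hW.memLp t φ) hS,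
    covariance_fun_sum_right' (fun i _ => hm i) (hW.memLp t φ),
    covariance_fun_sum_left' (fun i _ => hm i) (hW.memLp t φ),
    covariance_fun_sum_fun_sum' (fun i _ => hm i) (fun i _ => hm i)] at hvar
  simp only [covariance_const_mul_left, covariance_const_mul_right, hW.cov_eq, min_self] at hvar
  have hvar' : ∫ ω, (W t φ ω - ∑ i ∈ S, c i * W t (f i) ω) ^ 2 ∂P
      = t * ipForm (φ - ∑ i ∈ S, c i • f i) (φ - ∑ i ∈ S, c i • f i) := by
    rw [ipForm_sub_sum]
    simp only [sq]
    refine hvar.symm.trans ?_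
    simp only [mul_add, mul_sub, Finset.mul_sum]
    refine congrArg₂ (· + ·) (congrArg₂ (· - ·) (congrArg₂ (· - ·) rfl ?_) ?_) ?_
    · exact Finset.sum_congr rfl fun i _ => by ring
    · exact Finset.sum_congr rfl fun i _ => by ring
    · exact Finset.sum_congr rfl fun i _ => Finset.sum_congr rfl fun j _ => by ring
  rw [← hvar', ofReal_integral_eq_lintegral_ofReal hZ.integrable_sq (ae_of_all _ fun _ => sq_nonneg _)]
  refine lintegral_congr fun ω => ?_
  rw [← ofReal_norm, ← ENNReal.ofReal_pow (norm_nonneg _), Real.norm_eq_abs, sq_abs]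

lemma neg_ae_eq (hW : IsWhiteProcess P W) (t : ℝ≥0) (φ : TestForm d) :
    W t (-φ) =ᵐ[P] fun ω => -W t φ ω := by
  have h := hW.lintegral_sub_sum t (-φ) {()} (fun _ => -1) (fun _ => φ)
  have e : -φ - (-1 : ℝ) • φ = 0 := by
    rw [neg_one_smul ℝ φ, sub_neg_eq_add, neg_add_cancel]
  simp only [Finset.sum_singleton, sub_neg_eq_add, neg_mul, one_mul, e] at h
  have h0 : ipForm (0 : TestForm d) 0 = 0 := (ipFormₗ 0).map_zero
  have hm : AEMeasurable (fun ω => ‖W t (-φ) ω + W t φ ω‖ₑ ^ 2) P :=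
    ((hW.hasGaussianLaw _ _).aemeasurable.add (hW.hasGaussianLaw _ _).aemeasurable).enorm.pow_const 2
  rw [h0, mul_zero, ENNReal.ofReal_zero, lintegral_eq_zero_iff' hm] at h
  filter_upwards [h] with ω hω
  simp at hω
  linarith

/-- The noise is the sum of its Fourier series: if the series converges almost surely then its
sum is the noise. -/
lemma ae_eq_of_tendsto (hW : IsWhiteProcess P W) (t : ℝ≥0) (φ : TestForm d) {Z : Ω → ℝ}
    (hZ : ∀ᵐ ω ∂P, Tendsto (fun N => ∑ i ∈ formBox d N, coef (φ i.1) i.2 * W t (formMode i) ω)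
      atTop (𝓝 (Z ω))) : W t φ =ᵐ[P] Z := by
  let D : ℕ → Ω → ℝ := fun N ω => W t φ ω - ∑ i ∈ formBox d N, coef (φ i.1) i.2 * W t (formMode i) ω
  have hD : ∀ N, AEMeasurable (fun ω => ‖D N ω‖ₑ ^ 2) P := fun N =>
    ((hW.hasGaussianLaw _ _).aemeasurable.sub (Finset.aemeasurable_fun_sum _ fun i _ =>
      (hW.hasGaussianLaw _ _).aemeasurable.const_mul _)).enorm.pow_const 2
  -- Fatou again: the second moment of the remainder is `t` times the squared `L²` norm of the tail
  -- of the Fourier series, which tends to zero by Parseval.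
  have h1 : ∫⁻ ω, liminf (fun N => ‖D N ω‖ₑ ^ 2) atTop ∂P = 0 := by
    refine le_antisymm ((lintegral_liminf_le' hD).trans ?_) zero_le
    have h2 : Tendsto (fun N => ∫⁻ ω, ‖D N ω‖ₑ ^ 2 ∂P) atTop (𝓝 0) := by
      have h3 : ∀ N, ∫⁻ ω, ‖D N ω‖ₑ ^ 2 ∂P
          = ENNReal.ofReal (t * ipForm (φ - formSum N φ) (φ - formSum N φ)) := fun N => by
        rw [formSum_eq]
        exact hW.lintegral_sub_sum t φ _ _ _
      simp only [h3]
      have h4 := (tendsto_ipForm_sub_formSum φ).const_mul (t : ℝ)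
      rw [mul_zero] at h4
      simpa using ENNReal.tendsto_ofReal h4
    rw [h2.liminf_eq]
  have hm : AEMeasurable (fun ω => liminf (fun N => ‖D N ω‖ₑ ^ 2) atTop) P := by
    simp only [liminf_eq_iSup_iInf_of_nat]
    exact AEMeasurable.iSup fun n => AEMeasurable.iInf fun i => AEMeasurable.iInf fun _ => hD i
  filter_upwards [hZ, (lintegral_eq_zero_iff' hm).mp h1] with ω h2 h3
  have h4 : Tendsto (fun N => ‖D N ω‖ₑ ^ 2) atTop (𝓝 (‖W t φ ω - Z ω‖ₑ ^ 2)) :=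
    ENNReal.Tendsto.pow ((continuous_enorm.tendsto _).comp (h2.const_sub (W t φ ω)))
  simp only [h4.liminf_eq, Pi.zero_apply, ne_eq, OfNat.ofNat_ne_zero, not_false_eq_true,
    pow_eq_zero_iff, enorm_eq_zero] at h3
  linarith

lemma hasGaussianIncrements_formMode (hW : IsWhiteProcess P W) (i : Fin d × Mode d) :
    HasGaussianIncrements P 1 fun t => W t (formMode i) :=
  hW.hasGaussianIncrements _ (by simpa using ipForm_formMode_le i)

lemma contMod_ae_eq (hW : IsWhiteProcess P W) (i : Fin d × Mode d) (t : ℝ≥0) :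
    (fun ω => contMod (modePath W ω i) t) =ᵐ[P] W t (formMode i) := by
  have := hW.isProbabilityMeasure
  exact (hW.hasGaussianIncrements_formMode i).contMod_ae_eq t

lemma zero_ae_eq (hW : IsWhiteProcess P W) (φ : TestForm d) : W 0 φ =ᵐ[P] 0 := by
  have h := hW.lintegral_sub_sum 0 φ (∅ : Finset Unit) (fun _ => 0) (fun _ => φ)
  simp only [Finset.sum_empty, sub_zero, NNReal.coe_zero, zero_mul, ENNReal.ofReal_zero] at h
  have hm : AEMeasurable (fun ω => ‖W 0 φ ω‖ₑ ^ 2) P :=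
    (hW.hasGaussianLaw _ _).aemeasurable.enorm.pow_const 2
  rw [lintegral_eq_zero_iff' hm] at h
  filter_upwards [h] with ω hω
  simpa using hω

lemma ae_contMod_eq (hW : IsWhiteProcess P W)
    (hc : ∀ φ, ∀ᵐ ω ∂P, Continuous fun t => W t φ ω) :
    ∀ᵐ ω ∂P, ∀ i, contMod (modePath W ω i) = modePath W ω i := by
  have := hW.isProbabilityMeasure
  refine ae_all_iff.mpr fun i => ?_
  filter_upwards [hc (formMode i), ae_all_iff.mpr fun N =>
    (hW.hasGaussianIncrements_formMode i).ae_dyadicConst_ne_top (γ := 1 / 4)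
      (by norm_num) N] with ω h1 h2
  exact contMod_eq_of_continuous h1 h2

/-- The expectation of the weighted sum of squared Hölder constants is finite: these constants have
a common second-moment bound, and `wt ^ (-s - 2γ)` is summable. The remaining conditions are
countably many almost sure identities. -/
theorem ae_isGood (hs : (d : ℝ) / 2 - 1 < s) (hW : IsWhiteProcess P W) :
    ∀ᵐ ω ∂P, IsGood s (modePath W ω) := by
  have := hW.isProbabilityMeasure
  have hsum : ∀ N : ℕ, ∀ᵐ ω ∂P, ∑' i : Fin d × Mode d,
      ENNReal.ofReal (wt i.2.1 ^ (-s) * (1 + eigen i.2) ^ (-2 * noiseExponent d s))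
        * noiseConst s N (modePath W ω) i ^ 2 ≠ ∞ := by
    intro N
    obtain ⟨M, hM, h⟩ := exists_lintegral_dyadicConst_sq_le (noiseExponent_lt hs) 1 N
    have hB : ∀ i, HasGaussianIncrements P 1 fun t ω => contMod (modePath W ω i) t := fun i =>
      (hW.hasGaussianIncrements_formMode i).congr (hW.contMod_ae_eq i)
    have hm : ∀ i, AEMeasurable (fun ω =>
        ENNReal.ofReal (wt i.2.1 ^ (-s) * (1 + eigen i.2) ^ (-2 * noiseExponent d s))
        * noiseConst s N (modePath W ω) i ^ 2) P := fun i =>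
      ((hB i).aemeasurable_dyadicConst.pow_const 2).const_mul _
    have hle : ∫⁻ ω, ∑' i : Fin d × Mode d,
        ENNReal.ofReal (wt i.2.1 ^ (-s) * (1 + eigen i.2) ^ (-2 * noiseExponent d s))
          * noiseConst s N (modePath W ω) i ^ 2 ∂P ≠ ∞ := by
      rw [lintegral_tsum hm]
      have h1 : ∑' i : Fin d × Mode d, ∫⁻ ω,
          ENNReal.ofReal (wt i.2.1 ^ (-s) * (1 + eigen i.2) ^ (-2 * noiseExponent d s))
            * noiseConst s N (modePath W ω) i ^ 2 ∂P
          ≤ ∑' i : Fin d × Mode d, ENNReal.ofReal (wt i.2.1 ^ (-s - 2 * noiseExponent d s)) * M := by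
        refine ENNReal.tsum_le_tsum fun i => ?_
        rw [lintegral_const_mul' _ _ ENNReal.ofReal_ne_top]
        refine mul_le_mul' (ENNReal.ofReal_le_ofReal ?_) (h Ω mΩ P _ ‹_› (hB i))
        rw [sub_eq_add_neg, Real.rpow_add (wt_pos _), ← neg_mul]
        refine mul_le_mul_of_nonneg_left ?_ (Real.rpow_nonneg (wt_pos _).le _)
        exact Real.rpow_le_rpow_of_nonpos (wt_pos _) (wt_le_one_add_eigen i.2)
          (by linarith [noiseExponent_pos d s])
      refine (lt_of_le_of_lt h1 ?_).ne
      rw [ENNReal.tsum_mul_right]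
      refine ENNReal.mul_lt_top ?_ hM.lt_top
      rw [ENNReal.tsum_prod (f := fun (_ : Fin d) (m : Mode d) =>
        ENNReal.ofReal (wt m.1 ^ (-s - 2 * noiseExponent d s)))]
      simp only [tsum_fintype, Finset.sum_const]
      rw [nsmul_eq_mul]
      refine ENNReal.mul_lt_top (by simp) ?_
      rw [← ENNReal.ofReal_tsum_of_nonneg (fun m => Real.rpow_nonneg (wt_pos _).le _)
        (summable_wt_mode (noiseExponent_spec hs))]
      exact ENNReal.ofReal_lt_top
    filter_upwards [ae_lt_top' (AEMeasurable.tsum hm) hle] with ω hω using hω.ne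
  have hzero : ∀ i, ∀ᵐ ω ∂P, contMod (modePath W ω i) 0 = 0 := fun i => by
    filter_upwards [hW.contMod_ae_eq i 0, hW.zero_ae_eq (formMode i)] with ω h1 h2
    rw [h1, h2]; rfl
  have hcos : ∀ j k n l, ∀ᵐ ω ∂P, contMod (modePath W ω (j, (-k, false))) (dyadic n l)
      = contMod (modePath W ω (j, (k, false))) (dyadic n l) := fun j k n l => ae_of_all _ fun ω => by
    have : formMode ((j, (-k, false)) : Fin d × Mode d) = formMode (j, (k, false)) := by
      simp [formMode, mode, cosMode_neg]
    have h : modePath W ω (j, (-k, false)) = modePath W ω (j, (k, false)) :=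
      funext fun t => congrArg (fun φ => W t φ ω) this
    rw [h]
  have hsin : ∀ j k n l, ∀ᵐ ω ∂P, contMod (modePath W ω (j, (-k, true))) (dyadic n l)
      = -contMod (modePath W ω (j, (k, true))) (dyadic n l) := fun j k n l => by
    have : formMode ((j, (-k, true)) : Fin d × Mode d) = -formMode (j, (k, true)) := by
      simp [formMode, mode, sinMode_neg, Pi.single_neg]
    filter_upwards [hW.contMod_ae_eq (j, (-k, true)) (dyadic n l),
      hW.contMod_ae_eq (j, (k, true)) (dyadic n l),
      hW.neg_ae_eq (dyadic n l) (formMode (j, (k, true)))] with ω h1 h2 h3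
    rw [h1, h2, this, h3]
  filter_upwards [ae_all_iff.mpr hsum, ae_all_iff.mpr hzero,
    ae_all_iff.mpr fun j => ae_all_iff.mpr fun k => ae_all_iff.mpr fun n => ae_all_iff.mpr
      fun l => hcos j k n l,
    ae_all_iff.mpr fun j => ae_all_iff.mpr fun k => ae_all_iff.mpr fun n => ae_all_iff.mpr
      fun l => hsin j k n l] with ω h1 h2 h3 h4
  exact ⟨h2, h3, h4, h1⟩

end IsWhiteProcess

/-! ### Existence and uniqueness of solutions -/

namespace IsWhiteNoise

variable {Ω : Type} {mΩ : MeasurableSpace Ω} {P : Measure Ω} {𝓕 : Filtration ℝ≥0 mΩ}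
  {W : ℝ≥0 → TestForm d → Ω → ℝ}

lemma ae_contMod_eq (hW : IsWhiteNoise P 𝓕 W) :
    ∀ᵐ ω ∂P, ∀ i, contMod (modePath W ω i) = modePath W ω i :=
  hW.isWhiteProcess.ae_contMod_eq hW.continuous

lemma ae_continuous_modePath (hW : IsWhiteNoise P 𝓕 W) :
    ∀ᵐ ω ∂P, ∀ i, Continuous (modePath W ω i) := ae_all_iff.mpr fun _ => hW.continuous _

/-- Existence of solutions. -/
theorem isSolution_flow (hs : (d : ℝ) / 2 - 1 < s) (hW : IsWhiteNoise P 𝓕 W) (C : ℝ)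
    (a : OneForm d s) : IsSolution P W C a fun ω t => flow C a (modePath W ω) t where
  measurable t := measurable_flow hs (V := fun i r => W r (formMode i))
    (fun i r => hW.measurable r _) C measurable_const t
  continuous ω := continuous_flow hs C a _
  init := ae_of_all _ fun ω => flow_zero hs C a _
  equation φ := by
    have := hW.isWhiteProcess.isProbabilityMeasure
    let X : Ω → ℝ≥0 → OneForm d s := fun ω t => flow C a (modePath W ω) t
    have hX : ∀ ω, Continuous (X ω) := fun ω => continuous_flow hs C a _
    -- `E ψ` is the noise that the path `X` would require in order to solve the equation tested
    -- against `ψ`; the aim is that it equals `W` for `ψ = φ`.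
    let E : TestForm d → Ω → ℝ≥0 → ℝ := fun ψ ω t => pair (X ω t) ψ - pair (X ω 0) ψ
      - ∫ r in (0 : ℝ)..t, pair (X ω r.toNNReal) (genOp C ψ)
    have hXr : ∀ ω, Continuous fun r : ℝ => X ω r.toNNReal := fun ω =>
      (hX ω).comp continuous_real_toNNReal
    have hEc : ∀ ψ ω, Continuous (E ψ ω) := fun ψ ω => by
      have h1 : Continuous fun r : ℝ => pair (X ω r.toNNReal) (genOp C ψ) :=
        (continuous_pair _).comp (hXr ω)
      have h2 : Continuous fun t : ℝ => ∫ r in (0 : ℝ)..t, pair (X ω r.toNNReal) (genOp C ψ) :=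
        intervalIntegral.continuous_primitive (fun a b => h1.intervalIntegrable a b) 0
      exact (((continuous_pair ψ).comp (hX ω)).sub continuous_const).sub
        (h2.comp NNReal.continuous_coe)
    -- the equation for the modes
    have hmode : ∀ᵐ ω ∂P, ∀ i t, E (formMode i) ω t = W t (formMode i) ω := by
      filter_upwards [hW.isWhiteProcess.ae_isGood hs, hW.ae_contMod_eq] with ω hg hc i t
      have h1 : ∀ t, pair (X ω t) (formMode i)
          = ou (eigen i.2 - C) (formModes a i) (contMod (modePath W ω i)) t := fun t => by
        rw [pair_formMode]; exact formModes_flow hs C a hg t i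
      have h2 := ou_equation (continuous_contMod (modePath W ω i)) (eigen i.2 - C) (formModes a i) t
      have h3 : pair (X ω 0) (formMode i) = formModes a i := by
        rw [pair_formMode]
        exact congrArg (fun b => formModes b i) (flow_zero hs C a _)
      have h4 : ∀ r : ℝ, pair (X ω r.toNNReal) (genOp C (formMode i))
          = -(eigen i.2 - C) * ou (eigen i.2 - C) (formModes a i) (contMod (modePath W ω i))
            r.toNNReal := fun r => by rw [genOp_formMode, pair_smul, h1]
      have h5 : contMod (modePath W ω i) t = W t (formMode i) ω := congrFun (hc i) t
      change pair (X ω t) (formMode i) - pair (X ω 0) (formMode i)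
        - (∫ r in (0 : ℝ)..t, pair (X ω r.toNNReal) (genOp C (formMode i))) = _
      rw [h3, h1 t]
      simp only [h4]
      linarith
    -- the equation for trigonometric polynomials
    have hpoly : ∀ᵐ ω ∂P, ∀ N t, E (formSum N φ) ω t
        = ∑ i ∈ formBox d N, coef (φ i.1) i.2 * W t (formMode i) ω := by
      filter_upwards [hmode] with ω h N t
      have h1 : ∀ i, IntervalIntegrable
          (fun r : ℝ => coef (φ i.1) i.2 * pair (X ω r.toNNReal) (genOp C (formMode i)))
          volume 0 t := fun i =>
        (continuous_const.mul ((continuous_pair _).comp (hXr ω))).intervalIntegrable _ _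
      simp only [formSum_eq, E, pair_sum, genOp_sum]
      rw [intervalIntegral.integral_finsetSum fun i _ => h1 i, ← Finset.sum_sub_distrib,
        ← Finset.sum_sub_distrib]
      refine Finset.sum_congr rfl fun i _ => ?_
      rw [intervalIntegral.integral_const_mul, ← h i t]
      simp only [E]
      ring
    have hlim : ∀ ω t, Tendsto (fun N => E (formSum N φ) ω t) atTop (𝓝 (E φ ω t)) := by
      intro ω t
      refine ((tendsto_pair_formSum _ φ).sub (tendsto_pair_formSum _ φ)).sub ?_
      obtain ⟨K, hK⟩ := (isCompact_Icc (a := (0 : ℝ)) (b := t)).exists_bound_of_continuousOn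
        (hXr ω).continuousOn
      have hgen : ∀ N, genOp C (formSum N φ) = formSum N (genOp C φ) := by
        intro N
        rw [formSum_eq, formSum_eq, genOp_sum]
        refine Finset.sum_congr rfl fun i _ => ?_
        rw [genOp_formMode, smul_smul]
        congr 1
        simp only [genOp]
        rw [coef_add, coef_laplacian, coef_smul]
        ring
      refine tendsto_iff_norm_sub_tendsto_zero.mpr ?_
      have hz : Tendsto (fun N => K * (∑ j, √(hsq s ((genOp C φ - formSum N (genOp C φ)) j)))
          * |(t : ℝ) - 0|) atTop (𝓝 0) := by
        simpa using ((tendsto_sum_sqrt_hsq s (genOp C φ)).const_mul K).mul_const |(t : ℝ) - 0|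
      refine squeeze_zero (fun _ => norm_nonneg _) (fun N => ?_) hz
      have hi : ∀ ψ, IntervalIntegrable (fun r : ℝ => pair (X ω r.toNNReal) ψ) volume 0 t :=
        fun ψ => ((continuous_pair ψ).comp (hXr ω)).intervalIntegrable _ _
      rw [norm_sub_rev, ← intervalIntegral.integral_sub (hi _) (hi _)]
      refine intervalIntegral.norm_integral_le_of_norm_le_const fun r hr => ?_
      rw [Set.uIoc_of_le t.coe_nonneg] at hr
      rw [hgen, ← pair_sub, Real.norm_eq_abs]
      refine (abs_pair_le _ _).trans (mul_le_mul_of_nonneg_right (hK r ⟨hr.1.le, hr.2⟩) ?_)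
      exact Finset.sum_nonneg fun _ _ => Real.sqrt_nonneg _
    have hae : ∀ t, W t φ =ᵐ[P] fun ω => E φ ω t := fun t =>
      hW.isWhiteProcess.ae_eq_of_tendsto t φ (by
        filter_upwards [hpoly] with ω h
        exact (hlim ω t).congr fun N => h N t)
    -- For a fixed time the identity holds off a null set; dyadic times are countable, and both
    -- sides are continuous in time.
    have hall : ∀ᵐ ω ∂P, ∀ n l, W (dyadic n l) φ ω = E φ ω (dyadic n l) :=
      ae_all_iff.mpr fun n => ae_all_iff.mpr fun l => hae _
    filter_upwards [hall, hW.continuous φ] with ω h1 h2 t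
    have h3 := (h2.tendsto t).comp (tendsto_dyadicFloor t)
    have h4 := ((hEc φ ω).tendsto t).comp (tendsto_dyadicFloor t)
    have h5 : W t φ ω = E φ ω t := tendsto_nhds_unique h3 (h4.congr fun n => (h1 n _).symm)
    rw [h5]
    simp only [E, X]
    ring

/-- Uniqueness of solutions. -/
theorem eq_flow (hs : (d : ℝ) / 2 - 1 < s) (hW : IsWhiteNoise P 𝓕 W) {C : ℝ} {a : OneForm d s}
    {A : Ω → ℝ≥0 → OneForm d s} (hA : IsSolution P W C a A) :
    ∀ᵐ ω ∂P, ∀ t, A ω t = flow C a (modePath W ω) t := by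
  filter_upwards [hW.isWhiteProcess.ae_isGood hs, hW.ae_contMod_eq, hW.ae_continuous_modePath,
    hA.init, ae_all_iff.mpr fun i => hA.equation (formMode i)] with ω hg hc hcont h0 heq t
  refine ext_formModes fun i => ?_
  rw [formModes_flow hs C a hg, hc i]
  refine eq_ou_of_equation (y := fun t => formModes (A ω t) i) (hcont i)
    ((continuous_formModes i).comp (hA.continuous ω)) (fun t => ?_) t
  have h1 := heq i t
  simp only [genOp_formMode, pair_smul, pair_formMode, h0] at h1
  exact h1

end IsWhiteNoise

end AbelianYM

end

noncomputable section

namespace AbelianYM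

variable {d : ℕ} {s : ℝ}

/-! ### Laws of solutions, and the observable -/

/-- Joint measurability in the initial condition and the noise path, on the space of all noise
paths. It lets laws be transported from one noise to another, and transition probabilities depend
measurably on the starting point. -/
lemma measurable_flow_path (hs : (d : ℝ) / 2 - 1 < s) (C : ℝ) (t : ℝ≥0) :
    Measurable fun q : OneForm d s × (ℝ≥0 × TestForm d → ℝ) =>
      flow C q.1 (fun i r => q.2 (r, formMode i)) t :=
  measurable_flow hs (V := fun i r (q : OneForm d s × (ℝ≥0 × TestForm d → ℝ)) =>
    q.2 (r, formMode i)) (fun _ _ => (measurable_pi_apply _).comp measurable_snd) C measurable_fst t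

lemma measurable_noisePath {Ω : Type} {mΩ : MeasurableSpace Ω}
    {W : ℝ≥0 → TestForm d → Ω → ℝ} (hm : ∀ t φ, Measurable (W t φ)) :
    Measurable fun ω (p : ℝ≥0 × TestForm d) => W p.1 p.2 ω :=
  measurable_pi_lambda _ fun _ => hm _ _

lemma measurable_flow_modePath (hs : (d : ℝ) / 2 - 1 < s) {Ω : Type} {mΩ : MeasurableSpace Ω}
    {W : ℝ≥0 → TestForm d → Ω → ℝ} (hm : ∀ t φ, Measurable (W t φ)) (C : ℝ) (a : OneForm d s) :
    Measurable fun ω t => flow C a (modePath W ω) t :=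
  measurable_pi_lambda _ fun t => measurable_flow hs (V := fun i r => W r (formMode i))
    (fun _ _ => hm _ _) C measurable_const t

/-- The law of the solution does not depend on the realization of the noise. -/
lemma IsWhiteProcess.map_flow_eq (hs : (d : ℝ) / 2 - 1 < s) {Ω Ω' : Type} {mΩ : MeasurableSpace Ω}
    {mΩ' : MeasurableSpace Ω'} {P : Measure Ω} {P' : Measure Ω'} {W : ℝ≥0 → TestForm d → Ω → ℝ}
    {W' : ℝ≥0 → TestForm d → Ω' → ℝ} (hW : IsWhiteProcess P W) (hm : ∀ t φ, Measurable (W t φ))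
    (hW' : IsWhiteProcess P' W') (hm' : ∀ t φ, Measurable (W' t φ)) (C : ℝ) (a : OneForm d s) :
    P.map (fun ω t => flow C a (modePath W ω) t)
      = P'.map fun ω t => flow C a (modePath W' ω) t := by
  have hF : Measurable fun (p : ℝ≥0 × TestForm d → ℝ) (t : ℝ≥0) =>
      flow C a (fun i r => p (r, formMode i)) t :=
    measurable_pi_lambda _ fun t => (measurable_flow_path hs C t).comp
      (measurable_const.prodMk measurable_id)
  have h := congrArg (Measure.map fun (p : ℝ≥0 × TestForm d → ℝ) (t : ℝ≥0) =>
    flow C a (fun i r => p (r, formMode i)) t) (hW.map_eq hm hW' hm')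
  rw [Measure.map_map hF (measurable_noisePath hm),
    Measure.map_map hF (measurable_noisePath hm')] at h
  exact h

/-- The solution is affine in its initial value, so the common noise contribution `ou _ 0` cancels.
-/
lemma formModes_flow_sub (hs : (d : ℝ) / 2 - 1 < s) (C : ℝ) (a b : OneForm d s)
    {v : Fin d × Mode d → ℝ≥0 → ℝ} (hv : IsGood s v) (t : ℝ≥0) (i : Fin d × Mode d) :
    formModes (flow C a v t) i - formModes (flow C b v t) i
      = Real.exp (-(eigen i.2 - C) * t) * (formModes a i - formModes b i) := by
  rw [formModes_flow hs C a hv, formModes_flow hs C b hv, ou_add, ou_add _ (formModes b i)]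
  ring

/-- Without mass, the equation preserves gauge equivalence. -/
lemma gaugeEquiv_flow (hs : (d : ℝ) / 2 - 1 < s) {a b : OneForm d s} (h : GaugeEquiv a b)
    (v : Fin d × Mode d → ℝ≥0 → ℝ) (t : ℝ≥0) : GaugeEquiv (flow 0 a v t) (flow 0 b v t) := by
  by_cases hv : IsGood s v
  · refine gaugeEquiv_iff.mpr ?_
    have := (gaugeEquiv_iff.mp h).heat t
    refine (iff_of_eq (congrArg GaugeTrivial (funext fun i => ?_))).mp this
    rw [formModes_flow_sub hs 0 a b hv, sub_zero]
  -- Off the good set the flow is constant in time by convention, so equivalence holds there too and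
  -- no almost sure qualifier is needed.
  · simpa only [flow, if_neg hv] using h

/-- The solution restarted at a positive time solves the equation with the restarted noise. -/
lemma flow_add (hs : (d : ℝ) / 2 - 1 < s) (C : ℝ) (a : OneForm d s)
    {v : Fin d × Mode d → ℝ≥0 → ℝ} (hv : IsGood s v) (hc : ∀ i, contMod (v i) = v i) (t : ℝ≥0)
    (hv' : IsGood s fun i r => v i (t + r) - v i t)
    (hc' : ∀ i, contMod (fun r => v i (t + r) - v i t) = fun r => v i (t + r) - v i t) (u : ℝ≥0) :
    flow C a v (t + u) = flow C (flow C a v t) (fun i r => v i (t + r) - v i t) u := by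
  refine ext_formModes fun i => ?_
  rw [formModes_flow hs C a hv, formModes_flow hs C _ hv', formModes_flow hs C a hv, hc i, hc' i]
  exact ou_add_time (hc i ▸ continuous_contMod (v i)) _ _ t u

/-! ### The observable as a function of the zero mode -/

variable [NeZero d]

lemma observable_eq_exp (a : OneForm d s) :
    observable a = Complex.exp (Complex.I * (formModes a (0, (0, false)) : ℝ)) := by
  simp only [observable, formModes, mode, cosMode_zero]

lemma continuous_observable : Continuous (observable : OneForm d s → ℂ) := by
  have h : Continuous fun a : OneForm d s => Complex.exp (Complex.I
      * (formModes a (0, (0, false)) : ℝ)) :=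
    Complex.continuous_exp.comp (continuous_const.mul
      (Complex.continuous_ofReal.comp (continuous_formModes _)))
  exact h.congr fun a => (observable_eq_exp a).symm

lemma measurable_observable : Measurable (observable : OneForm d s → ℂ) := by
  have h : Measurable fun a : OneForm d s => Complex.exp (Complex.I
      * (formModes a (0, (0, false)) : ℝ)) :=
    Complex.continuous_exp.measurable.comp (measurable_const.mul
      (Complex.continuous_ofReal.measurable.comp (measurable_oneForm_iff.mp measurable_id _)))
  exact (funext (observable_eq_exp (d := d) (s := s))) ▸ h

lemma norm_observable (a : OneForm d s) : ‖observable a‖ = 1 := by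
  rw [observable_eq_exp, mul_comm, Complex.norm_exp_ofReal_mul_I]

lemma observable_zero : observable (0 : OneForm d s) = 1 := by
  rw [observable_eq_exp, formModes_zero]; simp

lemma formModes_constForm_two_pi :
    formModes (constForm d s (Pi.single 0 (2 * Real.pi))) (0, (0, false)) = 2 * Real.pi := by
  rw [formModes_constForm]
  simp [mode, torusInt_cosMode]

/-- At frequency zero only the mass acts, so the difference `2π` of the means becomes `2π e^{Ct}`,
which changes the observable by a deterministic phase. -/
lemma observable_flow_constForm (hs : (d : ℝ) / 2 - 1 < s) (C : ℝ)
    {v : Fin d × Mode d → ℝ≥0 → ℝ} (hv : IsGood s v) (t : ℝ≥0) :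
    observable (flow C (constForm d s (Pi.single 0 (2 * Real.pi))) v t)
      = Complex.exp (Complex.I * (2 * Real.pi * Real.exp (C * t) : ℝ))
        * observable (flow C (0 : OneForm d s) v t) := by
  have h := formModes_flow_sub hs C (constForm d s (Pi.single 0 (2 * Real.pi))) 0 hv t
    (0, (0, false))
  rw [formModes_constForm_two_pi, formModes_zero, eigen_zero] at h
  rw [observable_eq_exp, observable_eq_exp, ← Complex.exp_add, sub_eq_iff_eq_add.mp h]
  congr 1
  simp only [zero_sub, neg_neg, sub_zero]
  push_cast
  ring

lemma exp_two_pi_ne_one {x : ℝ} (h0 : 0 < x) (h1 : x ≠ 1) (h2 : x < 2) :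
    Complex.exp (Complex.I * (2 * Real.pi * x : ℝ)) ≠ 1 := by
  intro h
  obtain ⟨n, hn⟩ := Complex.exp_eq_one_iff.mp h
  have h3 : Complex.I * 2 * Real.pi * (x : ℂ) = Complex.I * 2 * Real.pi * (n : ℂ) := by
    push_cast at hn
    linear_combination hn
  have h4 : (x : ℂ) = (n : ℂ) :=
    mul_left_cancel₀ (by simp [Real.pi_ne_zero]) h3
  have h5 : x = (n : ℝ) := by exact_mod_cast h4
  subst h5
  have h6 : (0 : ℤ) < n := by exact_mod_cast h0
  have h7 : n < 2 := by exact_mod_cast h2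
  exact h1 (by have : n = 1 := by omega
               rw [this]; simp)

/-- The two expectations differ by the factor `exp (2πi e^{Ct})`. It is not `1` as long as `0 <
e^{Ct} < 2` and `e^{Ct} ≠ 1`, and the common factor `ψ t` is nonzero for small `t` by continuity and
`ψ 0 = 1`. Uniqueness of the law makes `ψ`, hence `t₀`, independent of the probability spaces. -/
theorem exists_observable_ne (hs : (d : ℝ) / 2 - 1 < s) {C : ℝ} (hC : C ≠ 0) :
    ∃ t₀ : ℝ≥0, 0 < t₀ ∧ ∀ (Ω Ω' : Type) (mΩ : MeasurableSpace Ω) (mΩ' : MeasurableSpace Ω')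
      (P : Measure Ω) (P' : Measure Ω') (𝓕 : Filtration ℝ≥0 mΩ) (𝓕' : Filtration ℝ≥0 mΩ')
      (W : ℝ≥0 → TestForm d → Ω → ℝ) (W' : ℝ≥0 → TestForm d → Ω' → ℝ)
      (A : Ω → ℝ≥0 → OneForm d s) (B : Ω' → ℝ≥0 → OneForm d s),
      IsWhiteNoise P 𝓕 W → IsWhiteNoise P' 𝓕' W' → IsSolution P W C 0 A →
      IsSolution P' W' C (constForm d s (Pi.single 0 (2 * Real.pi))) B →
      ∀ t : ℝ≥0, 0 < t → t < t₀ →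
        ∫ ω, observable (A ω t) ∂P ≠ ∫ ω, observable (B ω t) ∂P' := by
  obtain ⟨Ω₀, mΩ₀, P₀, W₀, hP₀, hW₀⟩ := exists_isWhiteNoise d
  let ψ : ℝ≥0 → ℂ := fun t => ∫ ω, observable (flow C (0 : OneForm d s) (modePath W₀ ω) t) ∂P₀
  have hψ : ∀ (Ω : Type) (mΩ : MeasurableSpace Ω) (P : Measure Ω) (𝓕 : Filtration ℝ≥0 mΩ)
      (W : ℝ≥0 → TestForm d → Ω → ℝ), IsWhiteNoise P 𝓕 W → ∀ t,
      ∫ ω, observable (flow C (0 : OneForm d s) (modePath W ω) t) ∂P = ψ t := by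
    intro Ω mΩ P 𝓕 W hW t
    have hF : Measurable fun x : ℝ≥0 → OneForm d s => observable (x t) :=
      measurable_observable.comp (measurable_pi_apply t)
    have h1 := hW.isWhiteProcess.map_flow_eq hs (fun t φ => hW.measurable t φ)
      hW₀.isWhiteProcess (fun t φ => hW₀.measurable t φ) C (0 : OneForm d s)
    have h2 := congrArg (fun μ : Measure (ℝ≥0 → OneForm d s) => ∫ x, observable (x t) ∂μ) h1
    rwa [integral_map (measurable_flow_modePath hs (fun t φ => hW.measurable t φ) C _).aemeasurable
      hF.aestronglyMeasurable,
      integral_map (measurable_flow_modePath hs (fun t φ => hW₀.measurable t φ) C _).aemeasurable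
      hF.aestronglyMeasurable] at h2
  have hc : Continuous ψ := by
    refine continuous_of_dominated (bound := fun _ => 1) (fun t => ?_) (fun t => ?_)
      (integrable_const _) ?_
    · exact (measurable_observable.comp ((measurable_pi_apply t).comp (measurable_flow_modePath hs
        (fun t φ => hW₀.measurable t φ) C _))).aestronglyMeasurable
    · exact ae_of_all _ fun ω => (norm_observable _).le
    · exact ae_of_all _ fun ω => continuous_observable.comp (continuous_flow hs C _ _)
  have h0 : ψ 0 = 1 := by
    simp only [ψ, flow_zero hs, observable_zero]
    simp
  have hexp : Continuous fun t : ℝ≥0 => Real.exp (C * t) := by fun_prop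
  have hne : ∀ᶠ t in 𝓝 (0 : ℝ≥0), ψ t ≠ 0 ∧ Real.exp (C * t) < 2 := by
    refine (hc.continuousAt.eventually_ne (by simp [h0])).and ?_
    refine hexp.continuousAt.eventually_lt continuousAt_const ?_
    simp
  obtain ⟨ε, hε, h⟩ := Metric.eventually_nhds_iff.mp hne
  refine ⟨ε.toNNReal, by simpa using hε, ?_⟩
  intro Ω Ω' mΩ mΩ' P P' 𝓕 𝓕' W W' A B hW hW' hA hB t ht0 ht
  have ht' : (t : ℝ) < ε := by
    have := NNReal.coe_lt_coe.mpr ht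
    rwa [Real.coe_toNNReal _ hε.le] at this
  obtain ⟨h1, h2⟩ := h (y := t) (by rw [NNReal.dist_eq]; simpa using ht')
  have hA' : ∫ ω, observable (A ω t) ∂P = ψ t := by
    rw [← hψ Ω mΩ P 𝓕 W hW t]
    refine integral_congr_ae ?_
    filter_upwards [hW.eq_flow hs hA] with ω hω
    rw [hω t]
  have hB' : ∫ ω, observable (B ω t) ∂P'
      = Complex.exp (Complex.I * (2 * Real.pi * Real.exp (C * t) : ℝ)) * ψ t := by
    rw [← hψ Ω' mΩ' P' 𝓕' W' hW' t, ← integral_const_mul]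
    refine integral_congr_ae ?_
    filter_upwards [hW'.eq_flow hs hB, hW'.isWhiteProcess.ae_isGood hs] with ω hω hg
    rw [hω t, observable_flow_constForm hs C hg]
  rw [hA', hB']
  intro h3
  have h4 := mul_right_cancel₀ h1 ((one_mul (ψ t)).trans h3)
  refine exp_two_pi_ne_one (Real.exp_pos _) ?_ h2 h4.symm
  rw [Ne, Real.exp_eq_one_iff]
  exact mul_ne_zero hC (by exact_mod_cast ht0.ne')

end AbelianYM

end

noncomputable section

namespace AbelianYM

variable {d : ℕ} {s : ℝ}

/-! ### Generative processes without mass -/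

/-- One-sided limits bound the function near each point; compactness of `[0, T]` does the rest. -/
lemma exists_abs_le_of_cadlag {g : ℝ≥0 → ℝ} {T : ℝ≥0}
    (hr : ∀ r ≤ T, ∃ l, Tendsto g (𝓝[≥] r) (𝓝 l)) (hl : ∀ r ≤ T, ∃ l, Tendsto g (𝓝[<] r) (𝓝 l)) :
    ∃ M, ∀ r ≤ T, |g r| ≤ M := by
  have h : ∃ M, ∀ r ∈ Set.Iic T, |g r| ≤ M := by
    have hc : IsCompact (Set.Iic T) := by
      rw [← Set.Icc_bot]; exact isCompact_Icc
    refine hc.induction_on (p := fun S => ∃ M, ∀ r ∈ S, |g r| ≤ M) ⟨0, by simp⟩ ?_ ?_ ?_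
    · exact fun S S' hS ⟨M, hM⟩ => ⟨M, fun r hr => hM r (hS hr)⟩
    · rintro S S' ⟨M, hM⟩ ⟨M', hM'⟩
      refine ⟨max M M', fun r hr => ?_⟩
      rcases hr with hr | hr
      · exact (hM r hr).trans (le_max_left _ _)
      · exact (hM' r hr).trans (le_max_right _ _)
    · intro r hrT
      obtain ⟨l, h1⟩ := hr r hrT
      obtain ⟨l', h2⟩ := hl r hrT
      have e1 : ∀ᶠ x in 𝓝[≥] r, |g x| ≤ |l| + 1 + (|l'| + 1) := by
        filter_upwards [h1.abs.eventually_le_const (lt_add_one |l|)] with x hx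
        linarith [abs_nonneg l']
      have e2 : ∀ᶠ x in 𝓝[<] r, |g x| ≤ |l| + 1 + (|l'| + 1) := by
        filter_upwards [h2.abs.eventually_le_const (lt_add_one |l'|)] with x hx
        linarith [abs_nonneg l]
      have e3 : ∀ᶠ x in 𝓝 r, |g x| ≤ |l| + 1 + (|l'| + 1) := by
        rw [← nhdsLT_sup_nhdsGE]
        exact eventually_sup.mpr ⟨e2, e1⟩
      exact ⟨_, mem_nhdsWithin_of_mem_nhds e3, _, fun x hx => hx⟩
  exact h

/-- Measurability comes from right-continuity: the function is the pointwise limit of step functions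
sampling it at `(⌊(n + 1) r⌋ + 1) / (n + 1)`, a point to the right of `r`, truncated at `T`. -/
lemma intervalIntegrable_of_cadlag {g : ℝ≥0 → ℝ} {u T : ℝ≥0} (huT : u ≤ T)
    (hr : ∀ r ≤ T, Tendsto g (𝓝[≥] r) (𝓝 (g r))) (hl : ∀ r ≤ T, ∃ l, Tendsto g (𝓝[<] r) (𝓝 l)) :
    IntervalIntegrable (fun r : ℝ => g r.toNNReal) volume u T := by
  obtain ⟨M, hM⟩ := exists_abs_le_of_cadlag (fun r h => ⟨_, hr r h⟩) hl
  rw [intervalIntegrable_iff_integrableOn_Ioc_of_le (NNReal.coe_le_coe.mpr huT)]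
  let G : ℕ → ℝ → ℝ := fun n r => g (min (((⌊((n : ℝ) + 1) * r⌋₊ : ℝ≥0) + 1) / (n + 1)) T)
  have hG : ∀ n, Measurable (G n) := fun n =>
    (measurable_of_countable fun k : ℕ => g (min (((k : ℝ≥0) + 1) / (n + 1)) T)).comp
      (Nat.measurable_floor.comp (measurable_const.mul measurable_id))
  have hlim : ∀ r ∈ Set.Ioc (u : ℝ) T, Tendsto (fun n => G n r) atTop (𝓝 (g r.toNNReal)) := by
    intro r hr'
    have hr0 : 0 ≤ r := u.coe_nonneg.trans hr'.1.le
    have hrT : r.toNNReal ≤ T := Real.toNNReal_le_iff_le_coe.mpr hr'.2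
    refine (hr _ hrT).comp (tendsto_nhdsWithin_iff.mpr ⟨?_, Eventually.of_forall fun n => ?_⟩)
    · have h1 : Tendsto (fun n : ℕ => ((⌊((n : ℝ) + 1) * r⌋₊ : ℝ≥0) + 1) / ((n : ℝ≥0) + 1)) atTop
          (𝓝 r.toNNReal) := by
        rw [← NNReal.tendsto_coe]
        have h2 : Tendsto (fun n : ℕ => r + 1 / ((n : ℝ) + 1)) atTop (𝓝 (r + 0)) :=
          tendsto_const_nhds.add tendsto_one_div_add_atTop_nhds_zero_nat
        rw [add_zero] at h2
        rw [Real.coe_toNNReal r hr0]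
        refine tendsto_of_tendsto_of_tendsto_of_le_of_le tendsto_const_nhds h2 (fun n => ?_)
          fun n => ?_
        · push_cast
          rw [le_div_iff₀ (by positivity), mul_comm]
          exact (Nat.lt_floor_add_one _).le
        · push_cast
          have : r + 1 / ((n : ℝ) + 1) = ((n + 1) * r + 1) / ((n : ℝ) + 1) := by
            field_simp
          rw [this]
          exact div_le_div_of_nonneg_right
            (add_le_add (Nat.floor_le (by positivity)) le_rfl) (by positivity)
      have h3 := h1.min (tendsto_const_nhds (x := T))
      rwa [min_eq_left hrT] at h3
    · refine le_min ?_ hrT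
      rw [← NNReal.coe_le_coe, Real.coe_toNNReal r hr0]
      push_cast
      rw [le_div_iff₀ (by positivity), mul_comm]
      exact (Nat.lt_floor_add_one _).le
  have hmeas : AEStronglyMeasurable (fun r : ℝ => g r.toNNReal)
      (volume.restrict (Set.Ioc (u : ℝ) T)) :=
    aestronglyMeasurable_of_tendsto_ae atTop (fun n => (hG n).aestronglyMeasurable)
      ((ae_restrict_iff' measurableSet_Ioc).mpr (ae_of_all _ hlim))
  refine IntegrableOn.of_bound measure_Ioc_lt_top hmeas M ?_
  exact (ae_restrict_iff' measurableSet_Ioc).mpr (ae_of_all _ fun r hr' =>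
    hM _ (Real.toNNReal_le_iff_le_coe.mpr hr'.2))

namespace IsCadlag

variable {f : ℝ≥0 → State d s}

lemma exists_eq_inl (hf : IsCadlag f) {r t : ℝ≥0} {b : OneForm d s} (hrt : r ≤ t)
    (ht : f t = Sum.inl b) : ∃ c, f r = Sum.inl c := by
  rcases h : f r with c | c
  · exact ⟨c, rfl⟩
  · exact absurd (hf.absorbing r t hrt h) (by rw [ht]; simp)

lemma tendsto_statePair {l : Filter ℝ≥0} {b : OneForm d s} (h : Tendsto f l (𝓝 (Sum.inl b)))
    (φ : TestForm d) : Tendsto (fun t => statePair (f t) φ) l (𝓝 (pair b φ)) := by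
  have hc : Continuous fun x : State d s => statePair x φ :=
    Continuous.sumElim (continuous_pair φ) continuous_const
  exact (hc.tendsto (Sum.inl b)).comp h

lemma intervalIntegrable (hf : IsCadlag f) {u t : ℝ≥0} (hut : u ≤ t) {b : OneForm d s}
    (ht : f t = Sum.inl b) (φ : TestForm d) :
    IntervalIntegrable (fun r : ℝ => statePair (f r.toNNReal) φ) volume u t := by
  refine intervalIntegrable_of_cadlag (g := fun r => statePair (f r) φ) hut (fun r hr => ?_)
    fun r hr => ?_
  · obtain ⟨c, hc⟩ := hf.exists_eq_inl hr ht
    have := tendsto_statePair (hf.right_cont r c hc) φ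
    simpa [hc, statePair] using this
  · obtain ⟨c, hc⟩ := hf.exists_eq_inl hr ht
    obtain ⟨l, hl⟩ := hf.left_lim r c hc
    exact ⟨_, tendsto_statePair hl φ⟩

end IsCadlag

lemma exists_eq_inl_of_lt_explosionTime {f : ℝ≥0 → State d s} {t : ℝ≥0}
    (h : (t : WithTop ℝ≥0) < explosionTime f) : ∃ b, f t = Sum.inl b := by
  rcases hft : f t with c | c
  · exact ⟨c, rfl⟩
  · have hle : explosionTime f ≤ t := sInf_le ⟨t, hft, rfl⟩
    exact absurd hle (not_le.mpr h)

/-- The state space is open in the sum and the path is right-continuous at `0`. Positivity ensures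
that the explosion time has nontrivial left neighbourhoods, without which the blow-up condition
would be vacuous. -/
lemma IsCadlag.explosionTime_pos {f : ℝ≥0 → State d s} (hf : IsCadlag f) {a : OneForm d s}
    (h0 : f 0 = Sum.inl a) : 0 < explosionTime f := by
  have h1 : ∀ᶠ t in 𝓝[≥] (0 : ℝ≥0), f t ∈ Set.range Sum.inl :=
    (hf.right_cont 0 a h0).eventually (isOpen_range_inl.mem_nhds ⟨a, rfl⟩)
  have h2 : Set.Ici (0 : ℝ≥0) = Set.univ := Set.eq_univ_of_forall fun t => zero_le (a := t)
  rw [h2, nhdsWithin_univ] at h1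
  obtain ⟨ε, hε, h3⟩ := Metric.eventually_nhds_iff.mp h1
  obtain ⟨δ, hδ0, hδε⟩ : ∃ δ : ℝ≥0, 0 < δ ∧ (δ : ℝ) < ε :=
    ⟨(ε / 2).toNNReal, by simpa using hε, by
      rw [Real.coe_toNNReal _ (half_pos hε).le]; exact half_lt_self hε⟩
  obtain ⟨b, hb⟩ : f δ ∈ Set.range Sum.inl := h3 (by rw [NNReal.dist_eq]; simpa using hδε)
  refine lt_of_lt_of_le (b := (δ : WithTop ℝ≥0)) ?_ (le_sInf ?_)
  · exact_mod_cast hδ0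
  · rintro _ ⟨r, hr, rfl⟩
    refine WithTop.coe_le_coe.mpr (le_of_not_gt fun hlt => ?_)
    have := hf.absorbing r δ hlt.le hr
    rw [← hb] at this
    simp at this

lemma orbitNorm_le {b c : OneForm d s} (h : GaugeEquiv c b) : orbitNorm (Sum.inl b) ≤ ‖c‖ :=
  csInf_le ⟨0, by rintro _ ⟨e, _, rfl⟩; exact norm_nonneg e⟩ ⟨c, h, rfl⟩

/-! ### Comparison of a generative path with the continuous solution -/

/-- Between two jumps, a path which solves the equation without mass remains gauge equivalent
to the continuous solution driven by the same noise. -/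
lemma gaugeEquiv_of_equation {v : Fin d × Mode d → ℝ≥0 → ℝ} (hv : ∀ i, Continuous (v i))
    {a : OneForm d s} {X : ℝ≥0 → OneForm d s} (hXc : Continuous X)
    (hX : ∀ t i, formModes (X t) i = ou (eigen i.2) (formModes a i) (v i) t)
    {f : ℝ≥0 → State d s} (hf : IsCadlag f) {u t : ℝ≥0} (hut : u ≤ t) {b c : OneForm d s}
    (hu : f u = Sum.inl b) (ht : f t = Sum.inl c)
    (heq : ∀ i, ∀ r : ℝ≥0, u ≤ r → r ≤ t → statePair (f r) (formMode i)
      = statePair (f u) (formMode i)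
        + (∫ r in (u : ℝ)..r, statePair (f r.toNNReal) (genOp 0 (formMode i))) + (v i r - v i u))
    (h : GaugeEquiv b (X u)) : GaugeEquiv c (X t) := by
  rw [gaugeEquiv_iff] at h ⊢
  have key : ∀ i, formModes c i - formModes (X t) i
      = Real.exp (-eigen i.2 * (t - u)) * (formModes b i - formModes (X u) i) := by
    intro i
    let g : ℝ≥0 → ℝ := fun r => statePair (f r) (formMode i)
    let x : ℝ≥0 → ℝ := fun r => formModes (X r) i
    have hx : Continuous x := (continuous_formModes i).comp hXc
    have hxr : Continuous fun r : ℝ => x r.toNNReal := hx.comp continuous_real_toNNReal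
    have hxi : ∀ p q : ℝ, IntervalIntegrable (fun r : ℝ => x r.toNNReal) volume p q :=
      fun p q => hxr.intervalIntegrable p q
    have hgi : IntervalIntegrable (fun r : ℝ => g r.toNNReal) volume u t :=
      hf.intervalIntegrable hut ht (formMode i)
    have hgen : ∀ y : State d s, statePair y (genOp 0 (formMode i))
        = -eigen i.2 * statePair y (formMode i) := by
      rintro (y | y)
      · simp only [statePair, Sum.elim_inl]
        rw [genOp_formMode, pair_smul, sub_zero]
      · simp [statePair]
    have hxeq : ∀ r : ℝ≥0, u ≤ r → x r = x u + (-eigen i.2) * (∫ r in (u : ℝ)..r, x r.toNNReal)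
        + (v i r - v i u) := by
      intro r _
      have h1 := ou_equation (hv i) (eigen i.2) (formModes a i) r
      have h2 := ou_equation (hv i) (eigen i.2) (formModes a i) u
      simp only [← hX, intervalIntegral.integral_const_mul] at h1 h2
      have h3 := intervalIntegral.integral_add_adjacent_intervals (μ := volume) (hxi 0 u) (hxi u r)
      simp only [x] at h3 ⊢
      rw [h1, h2, ← h3]
      ring
    have hgeq : ∀ r : ℝ≥0, u ≤ r → r ≤ t → g r = g u + (-eigen i.2)
        * (∫ r in (u : ℝ)..r, g r.toNNReal) + (v i r - v i u) := by
      intro r h1 h2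
      have h3 := heq i r h1 h2
      simp only [hgen, intervalIntegral.integral_const_mul] at h3
      exact h3
    have hut' : (u : ℝ) ≤ t := NNReal.coe_le_coe.mpr hut
    -- The noise increments are the same in both equations, so the difference solves a homogeneous
    -- linear equation.
    have hD := exp_of_integral_eq (f := fun r : ℝ => g r.toNNReal - x r.toNNReal)
      (c := g u - x u) (κ := -eigen i.2) hut' (hgi.sub (hxi _ _)) (fun r hr => by
        have hr0 : 0 ≤ r := u.coe_nonneg.trans hr.1
        have h1 : u ≤ r.toNNReal := NNReal.le_toNNReal_of_coe_le hr.1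
        have h2 : r.toNNReal ≤ t := Real.toNNReal_le_iff_le_coe.mpr hr.2
        have hsub : IntervalIntegrable (fun r : ℝ => g r.toNNReal) volume u r :=
          hgi.mono_set (by
            rw [Set.uIcc_of_le hr.1, Set.uIcc_of_le hut']
            exact Set.Icc_subset_Icc_right hr.2)
        rw [intervalIntegral.integral_sub hsub (hxi _ _), hgeq _ h1 h2, hxeq _ h1,
          Real.coe_toNNReal r hr0]
        ring) t ⟨hut', le_rfl⟩
    have e1 : g u = formModes b i := by
      simp only [g, hu, statePair, Sum.elim_inl, pair_formMode]
    have e2 : g t = formModes c i := by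
      simp only [g, ht, statePair, Sum.elim_inl, pair_formMode]
    simp only [Real.toNNReal_coe, e1, e2, x] at hD
    rw [hD, mul_comm]
  have := h.heat (t - u)
  exact (iff_of_eq (congrArg GaugeTrivial (funext fun i => (key i).symm))).mp this

/-- A path which follows the equation without mass up to gauge equivalence, with jumps at
exhausting times, is global and projects to the continuous solution. -/
theorem exists_gaugeEquiv_of_generative {v : Fin d × Mode d → ℝ≥0 → ℝ} (hv : ∀ i, Continuous (v i))
    {a : OneForm d s} {X : ℝ≥0 → OneForm d s} (hXc : Continuous X) (hX0 : X 0 = a)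
    (hX : ∀ t i, formModes (X t) i = ou (eigen i.2) (formModes a i) (v i) t)
    {f : ℝ≥0 → State d s} (hf : IsCadlag f) (hf0 : f 0 = Sum.inl a) {σ : ℕ → WithTop ℝ≥0}
    (hσ0 : σ 0 = 0) (hσ : Monotone σ)
    (heq : ∀ i, ∀ (j : ℕ) (u t : ℝ≥0), σ j = u → u ≤ t → (t : WithTop ℝ≥0) < σ (j + 1) →
      statePair (f t) (formMode i) = statePair (f u) (formMode i)
        + (∫ r in (u : ℝ)..t, statePair (f r.toNNReal) (genOp 0 (formMode i))) + (v i t - v i u))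
    (hjump : ∀ (j : ℕ) (u : ℝ≥0) (b : OneForm d s), σ (j + 1) = u → f u = Sum.inl b →
      ∃ l : OneForm d s, Tendsto f (𝓝[<] u) (𝓝 (Sum.inl l)) ∧ GaugeEquiv b l)
    (hex : Tendsto σ atTop (𝓝 (explosionTime f)))
    (hblow : ∀ T : ℝ≥0, explosionTime f = T →
      Tendsto (fun t => orbitNorm (f t)) (𝓝[<] T) atTop) (t : ℝ≥0) :
    ∃ b, f t = Sum.inl b ∧ GaugeEquiv b (X t) := by
  have hle : ∀ j, σ j ≤ explosionTime f := fun j => hσ.ge_of_tendsto hex j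
  -- Induction on the number of jumps, with the jump time `σ j` itself included: equivalence just
  -- after a jump is the starting point for the next interval.
  have hind : ∀ (j : ℕ) (t : ℝ≥0), (t : WithTop ℝ≥0) ≤ σ j → (t : WithTop ℝ≥0) < explosionTime f →
      ∃ b, f t = Sum.inl b ∧ GaugeEquiv b (X t) := by
    intro j
    induction j with
    | zero =>
      intro t ht _
      rw [hσ0] at ht
      have : t = 0 := by
        have h : t ≤ 0 := by exact_mod_cast ht
        exact le_antisymm h zero_le
      subst this
      exact ⟨a, hf0, hX0 ▸ (GaugeEquiv.equivalence d s).refl a⟩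
    | succ j ih =>
      intro t ht htT
      rcases le_or_gt (t : WithTop ℝ≥0) (σ j) with h | h
      · exact ih t h htT
      obtain ⟨u, hu⟩ := WithTop.ne_top_iff_exists.mp (ne_top_of_lt h)
      have hut : u < t := by rw [← hu] at h; exact_mod_cast h
      obtain ⟨b, hb, hbX⟩ := ih u hu.le (hu ▸ (h.trans htT))
      have hbefore : ∀ r : ℝ≥0, u ≤ r → (r : WithTop ℝ≥0) < σ (j + 1) →
          ∃ c, f r = Sum.inl c ∧ GaugeEquiv c (X r) := by
        intro r hur hr
        obtain ⟨c, hc⟩ := exists_eq_inl_of_lt_explosionTime (hr.trans_le (hle (j + 1)))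
        refine ⟨c, hc, gaugeEquiv_of_equation hv hXc hX hf hur hb hc (fun i q hq hqr => ?_) hbX⟩
        exact heq i j u q hu.symm hq (lt_of_le_of_lt (by exact_mod_cast hqr) hr)
      rcases lt_or_eq_of_le ht with h' | h'
      · exact hbefore t hut.le h'
      obtain ⟨c, hc⟩ := exists_eq_inl_of_lt_explosionTime htT
      obtain ⟨l, hl, hcl⟩ := hjump j t c h'.symm hc
      refine ⟨c, hc, (GaugeEquiv.equivalence d s).trans hcl (gaugeEquiv_iff.mpr ?_)⟩
      have : (𝓝[<] t).NeBot := nhdsLT_neBot_of_exists_lt ⟨u, hut⟩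
      -- The new value is equivalent to the left limit of the path, so it remains to compare that
      -- left limit with `X t`: equivalence holds at earlier times, `X` is continuous, and the
      -- condition on modes is closed.
      refine GaugeTrivial.of_tendsto (l := 𝓝[<] t)
        (z := fun r i => statePair (f r) (formMode i) - formModes (X r) i) ?_ fun i => ?_
      · filter_upwards [Ico_mem_nhdsLT hut] with r hr
        obtain ⟨e, he, heX⟩ := hbefore r hr.1 (by rw [← h']; exact_mod_cast hr.2)
        have := gaugeEquiv_iff.mp heX
        simpa only [he, statePair, Sum.elim_inl, pair_formMode] using this
      · have h1 := IsCadlag.tendsto_statePair hl (formMode i)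
        rw [pair_formMode] at h1
        exact h1.sub ((((continuous_formModes i).comp hXc).tendsto t).mono_left
          nhdsWithin_le_nhds)
  have hall : ∀ t : ℝ≥0, (t : WithTop ℝ≥0) < explosionTime f →
      ∃ b, f t = Sum.inl b ∧ GaugeEquiv b (X t) := by
    intro t ht
    obtain ⟨j, hj⟩ := (hex.eventually (lt_mem_nhds ht)).exists
    exact hind j t hj.le ht
  refine hall t ?_
  -- A finite explosion time is impossible: just before it `X` represents the orbit of the path, so
  -- the orbit norm is at most `‖X‖`, which has a finite limit there.
  suffices h : explosionTime f = ⊤ by rw [h]; exact WithTop.coe_lt_top t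
  by_contra hne
  obtain ⟨T, hT⟩ := WithTop.ne_top_iff_exists.mp hne
  have hT0 : 0 < T := by
    have := hf.explosionTime_pos hf0
    rw [← hT] at this
    exact_mod_cast this
  have : (𝓝[<] T).NeBot := nhdsLT_neBot_of_exists_lt ⟨0, hT0⟩
  have h1 := hblow T hT.symm
  have h2 : Tendsto (fun t => ‖X t‖) (𝓝[<] T) (𝓝 ‖X T‖) :=
    (hXc.norm.tendsto T).mono_left nhdsWithin_le_nhds
  refine not_tendsto_nhds_of_tendsto_atTop (tendsto_atTop_mono' _ ?_ h1) _ h2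
  filter_upwards [self_mem_nhdsWithin] with r hr
  obtain ⟨b, hb, hbX⟩ := hall r (by rw [← hT]; exact_mod_cast hr)
  rw [hb]
  exact orbitNorm_le ((GaugeEquiv.equivalence d s).symm hbX)

lemma measurable_projPath : Measurable (projPath : CadlagPath d s → ℝ≥0 → Orbit d s ⊕ Unit) := by
  refine measurable_pi_lambda _ fun t => ?_
  exact (Measurable.sumMap measurable_quotient_mk'' measurable_id).comp
    ((measurable_pi_apply t).comp measurable_subtype_coe)

/-- The projection of the solution without mass to the gauge orbits. -/
def orbitFlow (a : OneForm d s) (v : Fin d × Mode d → ℝ≥0 → ℝ) (t : ℝ≥0) : Orbit d s :=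
  Quotient.mk (gaugeSetoid d s) (flow 0 a v t)

/-- The projection of a generative measure without mass. -/
theorem IsGenerative.map_projPath (hs : (d : ℝ) / 2 - 1 < s) {a : OneForm d s}
    {μ : Measure (CadlagPath d s)} (hμ : IsGenerative 0 a μ) {Ω₀ : Type} {mΩ₀ : MeasurableSpace Ω₀}
    {P₀ : Measure Ω₀} {W₀ : ℝ≥0 → TestForm d → Ω₀ → ℝ} (hW₀ : IsWhiteProcess P₀ W₀)
    (hm₀ : ∀ t φ, Measurable (W₀ t φ)) :
    μ.map projPath = P₀.map fun ω t => Sum.inl (orbitFlow a (modePath W₀ ω) t) := by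
  obtain ⟨Ω, mΩ, P, 𝓕, W, A, σ, hP, hW, hA, rfl⟩ := hμ
  have hm : ∀ t φ, Measurable (W t φ) := fun t φ => hW.measurable t φ
  have hF : Measurable fun (x : ℝ≥0 → OneForm d s) (t : ℝ≥0) =>
      (Sum.inl (Quotient.mk (gaugeSetoid d s) (x t)) : Orbit d s ⊕ Unit) :=
    measurable_pi_lambda _ fun t => measurable_inl.comp
      (measurable_quotient_mk''.comp (measurable_pi_apply t))
  rw [Measure.map_map measurable_projPath hA.measurable]
  have h1 : projPath ∘ A =ᵐ[P] fun ω t => Sum.inl (orbitFlow a (modePath W ω) t) := by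
    filter_upwards [hW.isWhiteProcess.ae_isGood hs, hW.ae_contMod_eq, hW.ae_continuous_modePath,
      hA.init, ae_all_iff.mpr fun i => hA.equation (formMode i), hA.jump, hA.exhaust,
      hA.blow_up] with ω hg hc hcont h0 heq hjump hex hblow
    funext t
    obtain ⟨b, hb, hbX⟩ := exists_gaugeEquiv_of_generative (v := modePath W ω)
      (X := flow 0 a (modePath W ω)) hcont (continuous_flow hs 0 a _) (flow_zero hs 0 a _)
      (fun t i => by rw [formModes_flow hs 0 a hg, hc i, sub_zero]) (A ω).2 h0
      (hA.stopping_zero ω) (hA.stopping_mono ω) heq hjump hex hblow t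
    simp only [Function.comp_apply, projPath, hb, Sum.map_inl]
    exact congrArg Sum.inl (Quotient.sound hbX)
  rw [Measure.map_congr h1]
  have h2 := congrArg (Measure.map fun (x : ℝ≥0 → OneForm d s) (t : ℝ≥0) =>
      (Sum.inl (Quotient.mk (gaugeSetoid d s) (x t)) : Orbit d s ⊕ Unit))
    (hW.isWhiteProcess.map_flow_eq hs hm hW₀ hm₀ 0 a)
  rwa [Measure.map_map hF (measurable_flow_modePath hs hm 0 a),
    Measure.map_map hF (measurable_flow_modePath hs hm₀ 0 a)] at h2

end AbelianYM

end

noncomputable section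

namespace AbelianYM

variable {d : ℕ} {s : ℝ}

/-! ### Existence of generative measures, and gauge covariance -/

/-- The solution, as a càdlàg path which never reaches the cemetery. -/
def flowCadlag (hs : (d : ℝ) / 2 - 1 < s) (C : ℝ) (a : OneForm d s)
    (v : Fin d × Mode d → ℝ≥0 → ℝ) : CadlagPath d s :=
  ⟨fun t => Sum.inl (flow C a v t), by
    have hc : Continuous fun t => (Sum.inl (flow C a v t) : State d s) :=
      continuous_inl.comp (continuous_flow hs C a v)
    refine ⟨fun t u _ h => absurd h (by simp), fun t b h => ?_, fun t b _ => ⟨flow C a v t, ?_⟩⟩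
    · rw [← h]; exact (hc.tendsto t).mono_left nhdsWithin_le_nhds
    · exact (hc.tendsto t).mono_left nhdsWithin_le_nhds⟩

lemma measurable_flowCadlag (hs : (d : ℝ) / 2 - 1 < s) {Ω : Type} {mΩ : MeasurableSpace Ω}
    {W : ℝ≥0 → TestForm d → Ω → ℝ} (hm : ∀ t φ, Measurable (W t φ)) (C : ℝ) (a : OneForm d s) :
    Measurable fun ω => flowCadlag hs C a (modePath W ω) := by
  refine Measurable.subtype_mk (measurable_pi_lambda _ fun t => measurable_inl.comp ?_)
  exact (measurable_pi_apply t).comp (measurable_flow_modePath hs hm C a)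

lemma explosionTime_flowCadlag (hs : (d : ℝ) / 2 - 1 < s) (C : ℝ) (a : OneForm d s)
    (v : Fin d × Mode d → ℝ≥0 → ℝ) : explosionTime (flowCadlag hs C a v).1 = ⊤ := by
  refine sInf_eq_top.mpr ?_
  rintro _ ⟨t, ht, rfl⟩
  exact absurd ht (by simp [flowCadlag])

/-- The solution is adapted to the completed filtration of the noise. -/
lemma measurable_flow_completedFiltration (hs : (d : ℝ) / 2 - 1 < s) {Ω : Type}
    {mΩ : MeasurableSpace Ω} {P : Measure Ω} {W : ℝ≥0 → TestForm d → Ω → ℝ}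
    (hW : IsWhiteNoise P (completedFiltration P W) W) (C : ℝ) (a : OneForm d s) {t r : ℝ≥0}
    (hrt : r ≤ t) :
    Measurable[completedFiltration P W t] fun ω => flow C a (modePath W ω) r := by
  have hm : Measurable fun ω => flow C a (modePath W ω) r := (measurable_pi_apply r).comp
    (measurable_flow_modePath hs (fun t φ => hW.measurable t φ) C a)
  refine measurable_oneForm_iff.mpr fun i => ?_
  refine measurable_completedFiltration
    (g := fun ω => ou (eigen i.2 - C) (formModes a i) (fun q => W q (formMode i) ω) r)
    (measurable_oneForm_iff.mp hm i) ?_ ?_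
  · refine measurable_ou (mΩ := MeasurableSpace.comap
      (fun ω (p : Set.Iic t × TestForm d) => W p.1 p.2 ω) MeasurableSpace.pi) (fun q hq => ?_) _ _
    exact (measurable_pi_apply (X := fun _ => ℝ)
      ((⟨q, Set.mem_Iic.mpr (hq.trans hrt)⟩, formMode i) : Set.Iic t × TestForm d)).comp
      (comap_measurable _)
  · filter_upwards [hW.isWhiteProcess.ae_isGood hs, hW.ae_contMod_eq] with ω hg hc
    rw [formModes_flow hs C a hg, hc i]
    rfl

/-- The law of the solution is generative. -/
theorem isGenerative_map_flowCadlag (hs : (d : ℝ) / 2 - 1 < s) {Ω : Type}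
    {mΩ : MeasurableSpace Ω} {P : Measure Ω} [IsProbabilityMeasure P]
    {W : ℝ≥0 → TestForm d → Ω → ℝ} (hW : IsWhiteNoise P (completedFiltration P W) W) (C : ℝ)
    (a : OneForm d s) : IsGenerative C a (P.map fun ω => flowCadlag hs C a (modePath W ω)) := by
  refine ⟨Ω, mΩ, P, completedFiltration P W, W, fun ω => flowCadlag hs C a (modePath W ω),
    -- No jumps at all: the first interval is the whole half-line, and the constant value `⊤` agrees
    -- with the infinite explosion time.
    fun j _ => if j = 0 then 0 else ⊤, inferInstance, hW, ?_, rfl⟩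
  refine
    { measurable := measurable_flowCadlag hs (fun t φ => hW.measurable t φ) C a
      adapted := fun t => measurable_inl.comp
        (measurable_flow_completedFiltration hs hW C a le_rfl)
      init := ae_of_all _ fun ω => congrArg Sum.inl (flow_zero hs C a _)
      stopping := fun j t => ?_
      stopping_zero := fun _ => rfl
      stopping_mono := fun _ i j hij => ?_
      equation := fun φ => ?_
      jump := ae_of_all _ fun ω j u b h => absurd h (by
        rw [if_neg (Nat.succ_ne_zero j)]; exact WithTop.top_ne_coe)
      exhaust := ae_of_all _ fun ω => ?_
      blow_up := ae_of_all _ fun ω T h => ?_ }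
  · by_cases hj : j = 0 <;> simp [hj]
  · by_cases hi : i = 0
    · simp [hi]
    · have hj : j ≠ 0 := fun h => hi (by omega)
      simp [hi, hj]
  · filter_upwards [(hW.isSolution_flow hs C a).equation φ, hW.isWhiteProcess.zero_ae_eq φ]
      with ω h1 h2 j u t hju hut _
    by_cases hj : j = 0
    · rw [if_pos hj] at hju
      have hu : u = 0 := by exact_mod_cast hju.symm
      subst hu
      have h3 : W 0 φ ω = 0 := h2
      rw [h3, sub_zero]
      exact h1 t
    · rw [if_neg hj] at hju
      exact absurd hju WithTop.top_ne_coe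
  · rw [explosionTime_flowCadlag hs]
    refine tendsto_const_nhds.congr' ?_
    filter_upwards [eventually_ge_atTop 1] with j hj
    rw [if_neg (by omega)]
  · rw [explosionTime_flowCadlag hs] at h
    exact absurd h WithTop.top_ne_coe

theorem exists_isGenerative (hs : (d : ℝ) / 2 - 1 < s) (C : ℝ) (a : OneForm d s) :
    ∃ μ, IsGenerative C a μ := by
  obtain ⟨Ω, mΩ, P, W, hP, hW⟩ := exists_isWhiteNoise d
  exact ⟨_, isGenerative_map_flowCadlag hs hW C a⟩

lemma orbitFlow_congr (hs : (d : ℝ) / 2 - 1 < s) {a b : OneForm d s} (h : GaugeEquiv a b)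
    (v : Fin d × Mode d → ℝ≥0 → ℝ) : orbitFlow a v = orbitFlow b v :=
  funext fun t => Quotient.sound (gaugeEquiv_flow hs h v t)

/-- Both projected laws are laws of `orbitFlow` driven by one reference noise, and `orbitFlow`
depends on the initial condition only through its orbit. -/
theorem isGaugeCovariant_zero (hs : (d : ℝ) / 2 - 1 < s) : IsGaugeCovariant d s 0 := by
  obtain ⟨Ω, mΩ, P, W, hP, hW⟩ := exists_isWhiteNoise d
  intro a b hab μ ν hμ hν
  rw [hμ.map_projPath hs hW.isWhiteProcess fun t φ => hW.measurable t φ,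
    hν.map_projPath hs hW.isWhiteProcess fun t φ => hW.measurable t φ]
  simp only [orbitFlow_congr hs hab]

/-- The observable, as a function on the space of orbits. -/
def orbitObservable [NeZero d] : Orbit d s ⊕ Unit → ℂ :=
  Sum.elim (Quotient.lift observable fun _ _ h => observable_eq h) fun _ => 0

lemma measurable_orbitObservable [NeZero d] :
    Measurable (orbitObservable : Orbit d s ⊕ Unit → ℂ) :=
  Measurable.sumElim (measurable_from_quotient.mpr measurable_observable) measurable_const

/-- The observable descends to orbits, so covariance would equate its expectations from the
equivalent initial conditions `0` and `(2π, 0, …, 0)`; at time `t₀ / 2` they differ. -/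
theorem IsGaugeCovariant.eq_zero [NeZero d] (hs : (d : ℝ) / 2 - 1 < s) {C : ℝ}
    (h : IsGaugeCovariant d s C) : C = 0 := by
  by_contra hC
  obtain ⟨Ω, mΩ, P, W, hP, hW⟩ := exists_isWhiteNoise d
  have hm : ∀ t φ, Measurable (W t φ) := fun t φ => hW.measurable t φ
  obtain ⟨t₀, ht₀, hne⟩ := exists_observable_ne hs hC
  have hint : ∀ a : OneForm d s,
      ∫ x, orbitObservable (x (t₀ / 2)) ∂((P.map fun ω => flowCadlag hs C a (modePath W ω)).map
        projPath) = ∫ ω, observable (flow C a (modePath W ω) (t₀ / 2)) ∂P := by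
    intro a
    have hF : Measurable fun x : ℝ≥0 → Orbit d s ⊕ Unit => orbitObservable (x (t₀ / 2)) :=
      measurable_orbitObservable.comp (measurable_pi_apply _)
    rw [Measure.map_map measurable_projPath (measurable_flowCadlag hs hm C a),
      integral_map (measurable_projPath.comp (measurable_flowCadlag hs hm C a)).aemeasurable
        hF.aestronglyMeasurable]
    rfl
  refine hne Ω Ω mΩ mΩ P P _ _ W W _ _ hW hW (hW.isSolution_flow hs C _)
    (hW.isSolution_flow hs C _) (t₀ / 2) (half_pos ht₀) (half_lt_self ht₀) ?_
  rw [← hint, ← hint, h _ _ gaugeEquiv_zero_constForm _ _ (isGenerative_map_flowCadlag hs hW C _)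
    (isGenerative_map_flowCadlag hs hW C _)]

/-! ### The Markov process on the space of orbits -/

section Markov

variable {Ω : Type} {mΩ : MeasurableSpace Ω} {P : Measure Ω} {W : ℝ≥0 → TestForm d → Ω → ℝ}

/-- The law of the projected solution without mass. -/
def orbitLaw (P : Measure Ω) (W : ℝ≥0 → TestForm d → Ω → ℝ) (x : Orbit d s) :
    Measure (ℝ≥0 → Orbit d s ⊕ Unit) :=
  P.map fun ω t => Sum.inl (orbitFlow x.out (modePath W ω) t)

/-- The choice of representative in `orbitLaw` is immaterial. Measurability statements are made
through an arbitrary representative instead, as nothing is known about measurability of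
`Quotient.out`. -/
lemma orbitLaw_mk (hs : (d : ℝ) / 2 - 1 < s) (a : OneForm d s) :
    orbitLaw P W (Quotient.mk (gaugeSetoid d s) a)
      = P.map fun ω t => Sum.inl (orbitFlow a (modePath W ω) t) := by
  have h : GaugeEquiv (Quotient.mk (gaugeSetoid d s) a).out a :=
    Quotient.exact (s := gaugeSetoid d s) (Quotient.out_eq _)
  simp only [orbitLaw, orbitFlow_congr hs h]

lemma measurable_orbitFlow (hs : (d : ℝ) / 2 - 1 < s) (hm : ∀ t φ, Measurable (W t φ))
    (a : OneForm d s) : Measurable fun ω t => orbitFlow a (modePath W ω) t :=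
  measurable_pi_lambda _ fun t => measurable_quotient_mk''.comp
    ((measurable_pi_apply t).comp (measurable_flow_modePath hs hm 0 a))

lemma measurable_inl_orbitFlow (hs : (d : ℝ) / 2 - 1 < s) (hm : ∀ t φ, Measurable (W t φ))
    (a : OneForm d s) : Measurable fun ω t =>
      (Sum.inl (orbitFlow a (modePath W ω) t) : Orbit d s ⊕ Unit) :=
  measurable_pi_lambda _ fun t => measurable_inl.comp
    ((measurable_pi_apply t).comp (measurable_orbitFlow hs hm a))

lemma measurable_inl_orbitFlow_path (hs : (d : ℝ) / 2 - 1 < s) (t : ℝ≥0) :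
    Measurable fun q : OneForm d s × (ℝ≥0 × TestForm d → ℝ) =>
      (Sum.inl (orbitFlow q.1 (fun i r => q.2 (r, formMode i)) t) : Orbit d s ⊕ Unit) :=
  measurable_inl.comp (measurable_quotient_mk''.comp (measurable_flow_path hs 0 t))

lemma measurableSet_eval_mem {E : Type} [MeasurableSpace E] {F : Set E} (hF : MeasurableSet F)
    (t : ℝ≥0) : MeasurableSet {X : ℝ≥0 → E | X t ∈ F} :=
  measurable_pi_apply t hF

lemma orbitLaw_mk_eval (hs : (d : ℝ) / 2 - 1 < s) (hm : ∀ t φ, Measurable (W t φ))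
    (a : OneForm d s) (t : ℝ≥0) {F : Set (Orbit d s ⊕ Unit)} (hF : MeasurableSet F) :
    orbitLaw P W (Quotient.mk (gaugeSetoid d s) a) {X | X t ∈ F}
      = P.map (fun ω (p : ℝ≥0 × TestForm d) => W p.1 p.2 ω)
        {z | Sum.inl (orbitFlow a (fun i r => z (r, formMode i)) t) ∈ F} := by
  rw [orbitLaw_mk hs, Measure.map_apply (measurable_inl_orbitFlow hs hm a)
    (measurableSet_eval_mem hF t), Measure.map_apply (measurable_noisePath hm)]
  · rfl
  · exact ((measurable_inl_orbitFlow_path hs t).comp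
      (measurable_const.prodMk measurable_id)) hF

/-- For the quotient σ-algebra, measurability is tested on representatives `a`. There the value is
the noise law of the section at `a` of a measurable set in the product, which is measurable in `a`.
-/
lemma measurable_orbitLaw_eval (hs : (d : ℝ) / 2 - 1 < s) [SFinite P]
    (hm : ∀ t φ, Measurable (W t φ)) (t : ℝ≥0) {F : Set (Orbit d s ⊕ Unit)}
    (hF : MeasurableSet F) :
    Measurable fun x : Orbit d s => orbitLaw P W x {X | X t ∈ F} := by
  refine measurable_from_quotient.mpr ?_
  have h : Measurable fun a : OneForm d s => P.map (fun ω (p : ℝ≥0 × TestForm d) => W p.1 p.2 ω)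
      {z | Sum.inl (orbitFlow a (fun i r => z (r, formMode i)) t) ∈ F} :=
    measurable_measure_prodMk_left (measurable_inl_orbitFlow_path hs t hF)
  have e : (fun x : Orbit d s => orbitLaw P W x {X | X t ∈ F}) ∘ Quotient.mk''
      = fun a => P.map (fun ω (p : ℝ≥0 × TestForm d) => W p.1 p.2 ω)
        {z | Sum.inl (orbitFlow a (fun i r => z (r, formMode i)) t) ∈ F} :=
    funext fun a => orbitLaw_mk_eval hs hm a t hF
  rw [e]
  exact h

lemma measurable_withCemetery_orbitLaw (hs : (d : ℝ) / 2 - 1 < s) [SFinite P]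
    (hm : ∀ t φ, Measurable (W t φ)) (t : ℝ≥0) {F : Set (Orbit d s ⊕ Unit)}
    (hF : MeasurableSet F) :
    Measurable fun y => withCemetery (orbitLaw (s := s) P W) y {X | X t ∈ F} := by
  refine measurable_fun_sum ?_ ?_
  · exact measurable_orbitLaw_eval hs hm t hF
  · exact measurable_const

/-- The solution up to a time is independent of the later increments of the noise. -/
lemma indepFun_flow_increments (hs : (d : ℝ) / 2 - 1 < s)
    (hW : IsWhiteNoise P (completedFiltration P W) W) (C : ℝ) (a : OneForm d s) (t : ℝ≥0) :
    IndepFun (fun ω (r : Set.Iic t) => flow C a (modePath W ω) r)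
      (fun ω (p : ℝ≥0 × TestForm d) => W (t + p.1) p.2 ω - W t p.2 ω) P := by
  have h1 := indep_completedFiltration (hW.isWhiteProcess.indepFun_increments t)
  refine (indep_of_indep_of_le_right h1 ?_).symm
  have h2 : Measurable[completedFiltration P W t]
      fun ω (r : Set.Iic t) => flow C a (modePath W ω) r :=
    @measurable_pi_lambda _ _ _ (completedFiltration P W t) _ _ fun r =>
      measurable_flow_completedFiltration hs hW C a r.2
  exact h2.comap_le

/-- The Markov property. -/
theorem orbitLaw_markov (hs : (d : ℝ) / 2 - 1 < s) [IsProbabilityMeasure P]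
    (hW : IsWhiteNoise P (completedFiltration P W) W) (x : Orbit d s) (t u : ℝ≥0)
    {G : Set (Set.Iic t → Orbit d s ⊕ Unit)} {F : Set (Orbit d s ⊕ Unit)} (hG : MeasurableSet G)
    (hF : MeasurableSet F) :
    orbitLaw P W x ({X | (fun r : Set.Iic t => X r) ∈ G} ∩ {X | X (t + u) ∈ F})
      = ∫⁻ X in {X | (fun r : Set.Iic t => X r) ∈ G},
        withCemetery (orbitLaw P W) (X t) {Y | Y u ∈ F} ∂(orbitLaw P W x) := by
  induction x using Quotient.inductionOn with | h a => ?_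
  have hm : ∀ t φ, Measurable (W t φ) := fun t φ => hW.measurable t φ
  -- `H` is the whole path of the solution up to time `t` and `Z` the restarted noise. They are
  -- independent and `Z` has the law of the original noise, so integrating out `Z` produces the
  -- transition probability `κ`.
  let H : Ω → Set.Iic t → OneForm d s := fun ω r => flow 0 a (modePath W ω) r
  let Z : Ω → ℝ≥0 × TestForm d → ℝ := fun ω p => W (t + p.1) p.2 ω - W t p.2 ω
  let t' : Set.Iic t := ⟨t, Set.mem_Iic.mpr le_rfl⟩
  have hH : Measurable H := measurable_pi_lambda _ fun r =>
    (measurable_pi_apply (r : ℝ≥0)).comp (measurable_flow_modePath hs hm 0 a)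
  have hZm : ∀ u φ, Measurable fun ω => W (t + u) φ ω - W t φ ω := fun u φ =>
    (hm _ _).sub (hm _ _)
  have hZ : Measurable Z := measurable_pi_lambda _ fun p => hZm _ _
  have hZlaw : P.map Z = P.map (fun ω (p : ℝ≥0 × TestForm d) => W p.1 p.2 ω) :=
    (hW.isWhiteProcess.shift t).map_eq hZm hW.isWhiteProcess hm
  let G' : Set (Set.Iic t → OneForm d s) :=
    {h | (fun r => (Sum.inl (Quotient.mk (gaugeSetoid d s) (h r)) : Orbit d s ⊕ Unit)) ∈ G}
  have hG' : MeasurableSet G' := by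
    have : Measurable fun (h : Set.Iic t → OneForm d s) (r : Set.Iic t) =>
        (Sum.inl (Quotient.mk (gaugeSetoid d s) (h r)) : Orbit d s ⊕ Unit) :=
      measurable_pi_lambda _ fun r => measurable_inl.comp
        (measurable_quotient_mk''.comp (measurable_pi_apply r))
    exact this hG
  let S : Set (OneForm d s × (ℝ≥0 × TestForm d → ℝ)) :=
    {q | Sum.inl (orbitFlow q.1 (fun i r => q.2 (r, formMode i)) u) ∈ F}
  have hS : MeasurableSet S := measurable_inl_orbitFlow_path hs u hF
  let S' : Set ((Set.Iic t → OneForm d s) × (ℝ≥0 × TestForm d → ℝ)) :=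
    {q | q.1 ∈ G' ∧ (q.1 t', q.2) ∈ S}
  have hS' : MeasurableSet S' := by
    have hp : Measurable fun q : (Set.Iic t → OneForm d s) × (ℝ≥0 × TestForm d → ℝ) =>
        (q.1 t', q.2) :=
      ((measurable_pi_apply t').comp measurable_fst).prodMk measurable_snd
    exact (measurable_fst hG').inter (hp hS)
  let κ : OneForm d s → ℝ≥0∞ := fun b => P.map Z (Prod.mk b ⁻¹' S)
  have hκ : ∀ b, orbitLaw P W (Quotient.mk (gaugeSetoid d s) b) {Y | Y u ∈ F} = κ b := fun b => by
    rw [orbitLaw_mk_eval hs hm b u hF, ← hZlaw]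
    rfl
  have hκm : Measurable κ := measurable_measure_prodMk_left hS
  have hGm : MeasurableSet {X : ℝ≥0 → Orbit d s ⊕ Unit | (fun r : Set.Iic t => X r) ∈ G} := by
    have : Measurable fun (X : ℝ≥0 → Orbit d s ⊕ Unit) (r : Set.Iic t) => X r :=
      measurable_pi_lambda _ fun r => measurable_pi_apply _
    exact this hG
  have hO := measurable_inl_orbitFlow hs hm a
  have hleft : orbitLaw P W (Quotient.mk (gaugeSetoid d s) a)
      ({X | (fun r : Set.Iic t => X r) ∈ G} ∩ {X | X (t + u) ∈ F})
      = P ((fun ω => (H ω, Z ω)) ⁻¹' S') := by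
    rw [orbitLaw_mk hs, Measure.map_apply hO (hGm.inter (measurableSet_eval_mem hF _))]
    refine measure_congr ?_
    -- The restarted noise is again a white process, hence almost surely good and equal to its
    -- continuous modification; this is what the flow property requires.
    have hshift := hW.isWhiteProcess.shift t
    have hcont : ∀ φ, ∀ᵐ ω ∂P, Continuous fun u => W (t + u) φ ω - W t φ ω := fun φ => by
      filter_upwards [hW.continuous φ] with ω h
      exact (h.comp (continuous_const.add continuous_id)).sub continuous_const
    filter_upwards [hW.isWhiteProcess.ae_isGood hs, hW.ae_contMod_eq, hshift.ae_isGood hs,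
      hshift.ae_contMod_eq hcont] with ω h1 h2 h3 h4
    have h5 : flow 0 a (modePath W ω) (t + u)
        = flow 0 (flow 0 a (modePath W ω) t) (fun i r => Z ω (r, formMode i)) u :=
      flow_add hs 0 a h1 h2 t h3 h4 u
    refine propext (and_congr Iff.rfl ?_)
    change (Sum.inl (Quotient.mk (gaugeSetoid d s) (flow 0 a (modePath W ω) (t + u)))
      : Orbit d s ⊕ Unit) ∈ F ↔ _
    rw [h5]
    rfl
  have hright : ∫⁻ X in {X | (fun r : Set.Iic t => X r) ∈ G},
        withCemetery (orbitLaw P W) (X t) {Y | Y u ∈ F}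
          ∂(orbitLaw P W (Quotient.mk (gaugeSetoid d s) a))
      = ∫⁻ ω in H ⁻¹' G', κ (H ω t') ∂P := by
    have hmeas : Measurable fun X : ℝ≥0 → Orbit d s ⊕ Unit =>
        withCemetery (orbitLaw P W) (X t) {Y | Y u ∈ F} :=
      (measurable_withCemetery_orbitLaw hs hm u hF).comp (measurable_pi_apply t)
    rw [orbitLaw_mk hs, setLIntegral_map hGm hmeas hO]
    exact setLIntegral_congr_fun (hH hG') fun ω _ => hκ _
  -- By independence the joint law is a product, and Fubini reduces the claim to the measure of
  -- sections of `S'`.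
  rw [hleft, hright, ← Measure.map_apply (hH.prodMk hZ) hS',
    (indepFun_iff_map_prod_eq_prod_map_map hH.aemeasurable hZ.aemeasurable).mp
      (indepFun_flow_increments hs hW 0 a t), Measure.prod_apply hS',
    ← lintegral_indicator (hH hG')]
  have hind : ∀ h, P.map Z (Prod.mk h ⁻¹' S') = G'.indicator (fun h => κ (h t')) h := fun h => by
    by_cases hh : h ∈ G'
    · rw [Set.indicator_of_mem hh]
      exact congrArg _ (Set.ext fun z => and_iff_right hh)
    · rw [Set.indicator_of_notMem hh]
      have : Prod.mk h ⁻¹' S' = ∅ := Set.eq_empty_of_forall_notMem fun z hz => hh hz.1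
      rw [this, measure_empty]
  simp only [hind]
  have hκt : Measurable fun h : Set.Iic t → OneForm d s => κ (h t') :=
    hκm.comp (measurable_pi_apply t')
  rw [lintegral_map (hκt.indicator hG') hH]
  rfl

theorem isContinuousMarkov_orbitLaw (hs : (d : ℝ) / 2 - 1 < s) [IsProbabilityMeasure P]
    (hW : IsWhiteNoise P (completedFiltration P W) W) :
    IsContinuousMarkov (orbitLaw (s := s) P W) where
  continuous x := by
    have hm : ∀ t φ, Measurable (W t φ) := fun t φ => hW.measurable t φ
    refine ⟨Ω, mΩ, P, fun ω t => orbitFlow x.out (modePath W ω) t, inferInstance,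
      measurable_orbitFlow hs hm _, fun ω => ?_, fun ω => ?_, rfl⟩
    · change Quotient.mk (gaugeSetoid d s) (flow 0 x.out (modePath W ω) 0) = x
      rw [flow_zero hs]
      exact Quotient.out_eq x
    · exact continuous_quotient_mk'.comp (continuous_flow hs 0 _ _)
  measurable t _ hF := measurable_withCemetery_orbitLaw hs (fun t φ => hW.measurable t φ) t hF
  markov x t u _ _ hG hF := orbitLaw_markov hs hW x t u hG hF

end Markov

end AbelianYM

end

/-! ### Assembly of the theorem -/

theorem mainTheorem9 (d : ℕ) [NeZero d] (s : ℝ) (hs : (d : ℝ) / 2 - 1 < s) :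
    -- generative measures exist, for every bare mass and every initial condition
    (∀ (C : ℝ) (a : OneForm d s), ∃ μ, IsGenerative C a μ) ∧
    -- the bare mass 0 makes the dynamics gauge covariant, and it is the only one
    (∀ C : ℝ, IsGaugeCovariant d s C ↔ C = 0) ∧
    -- for the bare mass 0, the projected laws are those of a continuous Markov process on orbits
    (∃ Q : Orbit d s → Measure (ℝ≥0 → Orbit d s ⊕ Unit),
      (∀ (a : OneForm d s) (μ : Measure (CadlagPath d s)), IsGenerative 0 a μ →
        μ.map projPath = Q (Quotient.mk (gaugeSetoid d s) a)) ∧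
      IsContinuousMarkov Q) ∧
    -- for the bare mass 0, solutions driven by the same noise remain gauge equivalent
    (∀ (Ω : Type) (mΩ : MeasurableSpace Ω) (P : Measure Ω) (𝓕 : Filtration ℝ≥0 mΩ)
      (W : ℝ≥0 → TestForm d → Ω → ℝ) (a b : OneForm d s) (A B : Ω → ℝ≥0 → OneForm d s),
      IsProbabilityMeasure P → IsWhiteNoise P 𝓕 W → GaugeEquiv a b →
      IsSolution P W 0 a A → IsSolution P W 0 b B →
        ∀ᵐ ω ∂P, ∀ t, GaugeEquiv (A ω t) (B ω t)) ∧
    -- the initial conditions 0 and (2π, 0, …, 0) are gauge equivalent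
    GaugeEquiv (0 : OneForm d s) (constForm d s (Pi.single 0 (2 * Real.pi))) ∧
    -- the observable is gauge invariant
    (∀ a b : OneForm d s, GaugeEquiv a b → observable a = observable b) ∧
    -- for a non-zero bare mass, there are solutions from these two initial conditions, on one
    -- space and with the same noise
    (∀ C : ℝ, C ≠ 0 →
      ∃ (Ω : Type) (mΩ : MeasurableSpace Ω) (P : Measure Ω) (𝓕 : Filtration ℝ≥0 mΩ)
        (W : ℝ≥0 → TestForm d → Ω → ℝ) (A B : Ω → ℝ≥0 → OneForm d s),
        IsProbabilityMeasure P ∧ IsWhiteNoise P 𝓕 W ∧ IsSolution P W C 0 A ∧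
        IsSolution P W C (constForm d s (Pi.single 0 (2 * Real.pi))) B) ∧
    -- and all such solutions, on whichever spaces and with whichever noises, give the observable
    -- different expectations at all sufficiently small positive times
    (∀ C : ℝ, C ≠ 0 → ∃ t₀ : ℝ≥0, 0 < t₀ ∧
      ∀ (Ω Ω' : Type) (mΩ : MeasurableSpace Ω) (mΩ' : MeasurableSpace Ω')
        (P : Measure Ω) (P' : Measure Ω') (𝓕 : Filtration ℝ≥0 mΩ) (𝓕' : Filtration ℝ≥0 mΩ')
        (W : ℝ≥0 → TestForm d → Ω → ℝ) (W' : ℝ≥0 → TestForm d → Ω' → ℝ)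
        (A : Ω → ℝ≥0 → OneForm d s) (B : Ω' → ℝ≥0 → OneForm d s),
        IsProbabilityMeasure P → IsProbabilityMeasure P' →
        IsWhiteNoise P 𝓕 W → IsWhiteNoise P' 𝓕' W' →
        IsSolution P W C 0 A →
        IsSolution P' W' C (constForm d s (Pi.single 0 (2 * Real.pi))) B →
        ∀ t : ℝ≥0, 0 < t → t < t₀ →
          ∫ ω, observable (A ω t) ∂P ≠ ∫ ω, observable (B ω t) ∂P') := by
  refine ⟨fun C a => exists_isGenerative hs C a,
    fun C => ⟨fun h => h.eq_zero hs, fun h => h ▸ isGaugeCovariant_zero hs⟩, ?_, ?_,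
    gaugeEquiv_zero_constForm, fun a b h => observable_eq h, fun C _ => ?_, fun C hC => ?_⟩
  · obtain ⟨Ω, mΩ, P, W, hP, hW⟩ := exists_isWhiteNoise d
    refine ⟨orbitLaw P W, fun a μ hμ => ?_, isContinuousMarkov_orbitLaw hs hW⟩
    rw [orbitLaw_mk hs]
    exact hμ.map_projPath hs hW.isWhiteProcess fun t φ => hW.measurable t φ
  · intro Ω mΩ P 𝓕 W a b A B _ hW hab hA hB
    filter_upwards [hW.eq_flow hs hA, hW.eq_flow hs hB] with ω h1 h2 t
    rw [h1, h2]
    exact gaugeEquiv_flow hs hab _ t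
  · obtain ⟨Ω, mΩ, P, W, hP, hW⟩ := exists_isWhiteNoise d
    exact ⟨Ω, mΩ, P, _, W, _, _, hP, hW, hW.isSolution_flow hs C _, hW.isSolution_flow hs C _⟩
  · obtain ⟨t₀, ht₀, h⟩ := exists_observable_ne hs hC
    exact ⟨t₀, ht₀, fun Ω Ω' mΩ mΩ' P P' 𝓕 𝓕' W W' A B _ _ hW hW' hA hB =>
      h Ω Ω' mΩ mΩ' P P' 𝓕 𝓕' W W' A B hW hW' hA hB⟩
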